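/- **Setting.** Let $\mathcal H$ be a complex Hilbert space and $K_0$ a selfadjoint operator in $\mathcal H$ with $\langle\psi,K_0\psi\rangle\ge c_K\|\psi\|^2$ for some $c_K>0$. For $r\ge 0$ let $\mathcal H^r=D(K_0^r)$, and for $r<0$ let $\mathcal H^r=(\mathcal H^{-r})'$, with norm $\|\psi\|_r=\|K_0^r\psi\|$; put $\mathcal H^{\infty}=\bigcap_r\mathcal H^r$ and $\mathcal H^{-\infty}=\bigcup_r\mathcal H^r$. For each $m\in\mathbb R$ let $\mathcal A_m$ be a linear subspace of $\bigcap_{s\in\mathbb R}\mathcal L(\mathcal H^s,\mathcal H^{s-m})$. Suppose: *Assumption I.* (i) $K_0^m\in\mathcal A_m$ for all $m\in\mathbb R$. (ii) Each $\mathcal A_m$ is a Fréchet space for a countable family of seminorms, continuously embedded in $\bigcap_s\mathcal L(\mathcal H^s,\mathcal H^{s-m})$; and $\mathcal A_{m'}\subseteq\mathcal A_m$ continuously for $m'\le m$. (iii) $(A,B)\mapsto AB$ maps $\mathcal A_m\times\mathcal A_n$ continuously into $\mathcal A_{m+n}$. (iv) $(A,B)\mapsto[A,B]$ maps $\mathcal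 A_m\times\mathcal A_n$ continuously into $\mathcal A_{m+n-1}$. (v) If $A:\mathcal H^{\infty}\to\mathcal H^{-\infty}$ is linear and there is $m\in\mathbb R$ such that for every $N>0$ one can write $A=A^{(N)}+S^{(N)}$ with $A^{(N)}\in\mathcal A_m$ and $S^{(N)}$ extending to an element of $\mathcal L(\mathcal H^\kappa,\mathcal H^{\kappa+N})$ for every $\kappa\in\mathbb R$, then $A\in\mathcal A_m$. (vi) If $A\in\mathcal A_m$, then its adjoint $A^*$, defined by $\langle u,Av\rangle=\langle A^*u,v\rangle$ for $u,v\in\mathcal H^\infty$, belongs to $\mathcal A_m$. *Assumption II.* For every $m\in\mathbb R$ and $A\in\mathcal A_m$, the map $\tau\mapsto e^{i\tau K_0}Ae^{-i\tau K_0}$ is a bounded continuous map $\mathbb R\to\mathcal A_m$. *Assumption A.* $\mathrm{spec}(K_0)\subseteq\mathbb N+\lambda$ for some $\lambda>0$. *Assumption B.* $H_0=f(K_0)$, where $f\in C^\infty(\mathbb R)$ is a real elliptic classical symbol of order $\mu>1$: there are real $c_j$ with $c_0>0$ such that for all $k\ge1$, $N\ge1$ there is $C_{k,N}$ with $$\Bigl|\frac{d^k}{dx^k}\Bigl(f(x)-\sum_{0\le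 j\le N-1}c_jx^{\mu-j}\Bigr)\Bigr|\le C_{k,N}|x^{\mu-N-k}|,\qquad x\ge1 .$$ Let $\rho<\mu$ and $V\in C_b^\infty(\mathbb R,\mathcal A_\rho)$, i.e. $V$ is smooth and each of its time derivatives (including $V$ itself) is bounded in every seminorm of $\mathcal A_\rho$; let every $V(t)$ be symmetric on $\mathcal H^\infty$. **Theorem.** $H(t)=H_0+V(t)$ generates a propagator: there are bounded operators $\mathcal U(t,s)$ on $\mathcal H$, $t,s\in\mathbb R$, isometric (hence unitary), with $\mathcal U(s,s)=\mathbf 1$ and $\mathcal U(t,r)\,\mathcal U(r,s)=\mathcal U(t,s)$, such that $\mathcal U(t,s)\in\mathcal L(\mathcal H^r)$ for every $r\in\mathbb R$, $(t,s)\mapsto\mathcal U(t,s)$ is strongly continuous on every $\mathcal H^r$, and for $\psi_0\in\mathcal H^\infty$ the function $\psi(t)=\mathcal U(t,s)\psi_0$ takes values in $\mathcal H^\infty$, is differentiable in every norm $\|\cdot\|_r$, and is the unique such solution of $i\partial_t\psi=H(t)\psi$, $\psi(s)=\psi_0$. Moreover, for every $r>0$ and $\epsilon>0$ there is $C_{r,\epsilon}>0$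 such that $$\|\mathcal U(t,s)\psi\|_r\le C_{r,\epsilon}\langle t-s\rangle^\epsilon\|\psi\|_r\qquad\text{for all }t,s\in\mathbb R,\ \psi\in\mathcal H^r,\qquad \langle t\rangle=\sqrt{1+t^2}.$$ -/

import Mathlib

open Filter Topology
open scoped InnerProductSpace ContDiff

noncomputable section

namespace SobolevGrowth

variable {H : Type*} [NormedAddCommGroup H] [InnerProductSpace ℂ H] [CompleteSpace H]

/-! ## Seminorm calculus

The topology of a Fréchet space is handled through a defining family of seminorms. -/

/-- `u : ℝ → E` is differentiable at `t` with derivative `v`, for the topology of the family `p`. -/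
def HasSeminormDerivAt {ι E : Type*} [AddCommGroup E] [Module ℂ E] (p : ι → Seminorm ℂ E)
    (u : ℝ → E) (v : E) (t : ℝ) : Prop :=
  ∀ i, Tendsto (fun h : ℝ => p i (((h : ℂ)⁻¹) • (u (t + h) - u t) - v)) (𝓝[≠] 0) (𝓝 0)

/-- `u ∈ C⁰_b(ℝ, E)`: continuous, and bounded in every seminorm. -/
def IsCb {ι E : Type*} [AddCommGroup E] [Module ℂ E] (p : ι → Seminorm ℂ E) (u : ℝ → E) : Prop :=
  (∀ i t, Tendsto (fun t' => p i (u t' - u t)) (𝓝 t) (𝓝 0)) ∧ ∀ i, ∃ C : ℝ, ∀ t, p i (u t) ≤ C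

/-- `u ∈ C^∞_b(ℝ, E)`: there are derivatives `D 0 = u, D 1, D 2, …` of every order, and each of
them is continuous and bounded in every seminorm. -/
def IsCbInfty {ι E : Type*} [AddCommGroup E] [Module ℂ E] (p : ι → Seminorm ℂ E)
    (u : ℝ → E) : Prop :=
  ∃ D : ℕ → ℝ → E, D 0 = u ∧
    (∀ k t, HasSeminormDerivAt p (D k) (D (k + 1) t) t) ∧ ∀ k, IsCb p (D k)

/-- The countable family of seminorms `p` makes `E` a Fréchet space: it separates points and
`E` is complete for it. -/
def IsFrechet {E : Type*} [AddCommGroup E] [Module ℂ E] (p : ℕ → Seminorm ℂ E) : Prop :=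
  (∀ a, (∀ j, p j a = 0) → a = 0) ∧
  ∀ u : ℕ → E, (∀ j, ∀ ε > 0, ∃ N, ∀ k ≥ N, ∀ l ≥ N, p j (u k - u l) < ε) →
    ∃ a, ∀ j, Tendsto (fun k => p j (u k - a)) atTop (𝓝 0)

/-! ## The reference operator and its scale of Hilbert spaces -/

/-- A reference operator `K₀`: a (possibly unbounded) positive selfadjoint operator in `H`. -/
structure ReferenceOperator (H : Type*) [NormedAddCommGroup H] [InnerProductSpace ℂ H]
    [CompleteSpace H] where
  /-- the operator -/
  op : H →ₗ.[ℂ] H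
  selfAdjoint : IsSelfAdjoint op
  positive : ∃ c : ℝ, 0 < c ∧ ∀ ψ : op.domain, c * ‖(ψ : H)‖ ^ 2 ≤ (⟪(ψ : H), op ψ⟫_ℂ).re

/-- The spectrum of an unbounded operator: the complement of the set of `z` for which `T - z` has
a bounded everywhere defined two-sided inverse. -/
def spectrumOf (T : H →ₗ.[ℂ] H) : Set ℂ :=
  {z | ¬ ∃ R : H →L[ℂ] H,
    (∀ φ : H, ∃ h : R φ ∈ T.domain, T ⟨R φ, h⟩ - z • R φ = φ) ∧
    ∀ ψ : T.domain, R (T ψ - z • (ψ : H)) = ψ}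

namespace ReferenceOperator

variable (K : ReferenceOperator H)

/-- The eigenspace `ker (K₀ - x)` (the zero space unless `x` is an eigenvalue). -/
def eigenspace (x : ℝ) : Submodule ℂ H where
  carrier := {ψ | ∃ h : ψ ∈ K.op.domain, K.op ⟨ψ, h⟩ = (x : ℂ) • ψ}
  add_mem' := by
    rintro a b ⟨ha, ha'⟩ ⟨hb, hb'⟩
    refine ⟨K.op.domain.add_mem ha hb, ?_⟩
    have := K.op.map_add ⟨a, ha⟩ ⟨b, hb⟩
    rw [ha', hb', ← smul_add] at this
    exact this
  zero_mem' := by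
    refine ⟨K.op.domain.zero_mem, ?_⟩
    have := K.op.map_zero
    rw [smul_zero]
    exact this
  smul_mem' := by
    rintro c a ⟨ha, ha'⟩
    refine ⟨K.op.domain.smul_mem c ha, ?_⟩
    have := K.op.map_smul c ⟨a, ha⟩
    rw [ha', smul_comm] at this
    exact this

theorem isClosed_eigenspace (x : ℝ) : IsClosed (K.eigenspace x : Set H) := by
  have h : (K.eigenspace x : Set H) =
      (fun ψ : H => (ψ, (x : ℂ) • ψ)) ⁻¹' (K.op.graph : Set (H × H)) := by
    ext ψ
    simp only [Set.mem_preimage, SetLike.mem_coe, LinearPMap.mem_graph_iff]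
    constructor
    · rintro ⟨h1, h2⟩
      exact ⟨⟨ψ, h1⟩, rfl, h2⟩
    · rintro ⟨⟨y, hy⟩, h1, h2⟩
      dsimp only at h1 h2
      subst h1
      exact ⟨hy, h2⟩
  rw [h]
  exact IsClosed.preimage (by fun_prop) K.selfAdjoint.isClosed

instance (x : ℝ) : CompleteSpace (K.eigenspace x) :=
  (K.isClosed_eigenspace x).completeSpace_coe

/-- The orthogonal projection of `H` onto `ker (K₀ - x)`. -/
def proj (x : ℝ) : H →L[ℂ] H := (K.eigenspace x).starProjection

/-- The functional calculus `g(K₀) = ∑ₓ g(x) Pₓ` (sum over the eigenvalues `x` of `K₀`), on its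
natural domain. This is the spectral calculus of `K₀` if `K₀` has pure point spectrum, which is
the case as soon as the spectrum of the selfadjoint operator `K₀` is contained in `ℕ + lam`. -/
def func (g : ℝ → ℂ) : H →ₗ.[ℂ] H where
  domain :=
    { carrier := {ψ | Summable fun x : ℝ => g x • K.proj x ψ}
      add_mem' := fun {a b} ha hb => by
        have ha' : Summable fun x : ℝ => g x • K.proj x a := ha
        have hb' : Summable fun x : ℝ => g x • K.proj x b := hb
        change Summable fun x : ℝ => g x • K.proj x (a + b)
        simpa [smul_add] using ha'.add hb'
      zero_mem' := by simp [summable_zero]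
      smul_mem' := fun c a ha => by
        have ha' : Summable fun x : ℝ => g x • K.proj x a := ha
        change Summable fun x : ℝ => g x • K.proj x (c • a)
        simpa [smul_comm _ c] using ha'.const_smul c }
  toFun :=
    { toFun := fun ψ => ∑' x : ℝ, g x • K.proj x ψ
      map_add' := fun a b => by
        simpa [smul_add] using Summable.tsum_add a.2 b.2
      map_smul' := fun c a => by
        simpa [smul_comm _ c] using Summable.tsum_const_smul c a.2 }

/-- The power `K₀ ^ r`, for every real `r`. -/
def pow (r : ℝ) : H →ₗ.[ℂ] H := K.func fun x => ((x ^ r : ℝ) : ℂ)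

/-- `H^∞ = ⋂ᵣ D(K₀ ^ r)`. -/
def smooth : Submodule ℂ H := ⨅ r : ℝ, (K.pow r).domain

theorem mem_pow_domain (r : ℝ) (ψ : K.smooth) : (ψ : H) ∈ (K.pow r).domain :=
  (Submodule.mem_iInf _).1 ψ.2 r

/-- The norm `‖ψ‖_r = ‖K₀ ^ r ψ‖` on `H^∞`, for every real `r`. For `r < 0` it is the norm of
the dual space `H^r = (H^{-r})'`. -/
def sob (r : ℝ) : Seminorm ℂ K.smooth :=
  (normSeminorm ℂ H).comp
    ((K.pow r).toFun.comp (Submodule.inclusion (iInf_le (fun r : ℝ => (K.pow r).domain) r)))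

/-! `H^∞` is dense in every `H^s`, `s ∈ ℝ`. So restriction to `H^∞` identifies the elements of
`⋂ₛ L(H^s, H^{s-m})` with the endomorphisms of `H^∞` that are bounded from `‖·‖_s` to `‖·‖_{s-m}`
for every real `s`; operators of finite order are represented in this way throughout. -/

/-- `A ∈ ⋂ₛ L(H^s, H^{s-m})`. -/
def IsOfOrder (m : ℝ) (A : Module.End ℂ K.smooth) : Prop :=
  ∀ s : ℝ, ∃ C : ℝ, ∀ ψ, K.sob (s - m) (A ψ) ≤ C * K.sob s ψ

/-- `S` is `N`-smoothing: it extends to `L(H^κ, H^{κ+N})` for every real `κ`. -/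
def IsSmoothing (N : ℝ) (S : Module.End ℂ K.smooth) : Prop := K.IsOfOrder (-N) S

/-- `B` is the (formal) adjoint of `A` on `H^∞`. -/
def IsAdjointPair (A B : Module.End ℂ K.smooth) : Prop :=
  ∀ u v : K.smooth, ⟪(u : H), (A v : H)⟫_ℂ = ⟪(B u : H), (v : H)⟫_ℂ

/-- `A` is symmetric on `H^∞`. -/
def IsSymm (A : Module.End ℂ K.smooth) : Prop := K.IsAdjointPair A A

/-- The endomorphism `B` of `H^∞` is the restriction of the unbounded operator `T`. -/
def IsRestriction (T : H →ₗ.[ℂ] H) (B : Module.End ℂ K.smooth) : Prop :=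
  ∀ ψ : K.smooth, ∃ h : (ψ : H) ∈ T.domain, T ⟨ψ, h⟩ = B ψ

/-! ### The unitary group of `K₀` on `H^∞` -/

theorem inner_eigenspace {x y : ℝ} (hxy : x ≠ y) {a b : H} (ha : a ∈ K.eigenspace x)
    (hb : b ∈ K.eigenspace y) : ⟪a, b⟫_ℂ = 0 := by
  obtain ⟨ha, ha'⟩ := ha
  obtain ⟨hb, hb'⟩ := hb
  have hs := LinearPMap.adjoint_isFormalAdjoint K.selfAdjoint.dense_domain
  rw [LinearPMap.isSelfAdjoint_def.mp K.selfAdjoint] at hs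
  have h := hs ⟨a, ha⟩ ⟨b, hb⟩
  rw [ha', hb', inner_smul_left, inner_smul_right] at h
  simp only [Complex.conj_ofReal] at h
  have h2 : ((x : ℂ) - y) * ⟪a, b⟫_ℂ = 0 := by rw [sub_mul, h, sub_self]
  rcases mul_eq_zero.1 h2 with h3 | h3
  · exact absurd (by exact_mod_cast sub_eq_zero.1 h3) hxy
  · exact h3

theorem orthogonalFamily :
    OrthogonalFamily ℂ (fun x : ℝ => K.eigenspace x) fun x => (K.eigenspace x).subtypeₗᵢ :=
  fun _ _ hxy a b => K.inner_eigenspace hxy a.2 b.2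

theorem proj_mem (x : ℝ) (ψ : H) : K.proj x ψ ∈ K.eigenspace x :=
  Submodule.starProjection_apply_mem _ _

theorem summable_iff (g : ℝ → ℂ) (ψ : H) :
    (Summable fun x : ℝ => g x • K.proj x ψ) ↔
      Summable fun x : ℝ => ‖g x • K.proj x ψ‖ ^ 2 :=
  K.orthogonalFamily.summable_iff_norm_sq_summable
    fun x => ⟨g x • K.proj x ψ, (K.eigenspace x).smul_mem _ (K.proj_mem x ψ)⟩

theorem proj_proj_self (x : ℝ) (ψ : H) : K.proj x (K.proj x ψ) = K.proj x ψ :=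
  Submodule.starProjection_eq_self_iff.2 (K.proj_mem x ψ)

theorem proj_proj_ne {x y : ℝ} (hxy : x ≠ y) (ψ : H) : K.proj x (K.proj y ψ) = 0 := by
  refine Submodule.eq_starProjection_of_mem_of_inner_eq_zero (Submodule.zero_mem _) ?_
  intro w hw
  rw [sub_zero]
  exact K.inner_eigenspace hxy.symm (K.proj_mem y ψ) hw

theorem proj_tsum (g : ℝ → ℂ) (ψ : H) (h : Summable fun x : ℝ => g x • K.proj x ψ) (x : ℝ) :
    K.proj x (∑' y : ℝ, g y • K.proj y ψ) = g x • K.proj x ψ := by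
  rw [(K.proj x).map_tsum h, tsum_eq_single x]
  · rw [map_smul, proj_proj_self]
  · intro y hy
    rw [map_smul, K.proj_proj_ne hy.symm, smul_zero]

theorem func_mem_smooth (g : ℝ → ℂ) (hg : ∀ x, ‖g x‖ ≤ 1) (ψ : K.smooth) :
    ∃ h : (ψ : H) ∈ (K.func g).domain, K.func g ⟨ψ, h⟩ ∈ K.smooth := by
  have key : ∀ r : ℝ,
      Summable fun x : ℝ => (((x ^ r : ℝ) : ℂ) * g x) • K.proj x (ψ : H) := by
    intro r
    have h0 : Summable fun x : ℝ => ((x ^ r : ℝ) : ℂ) • K.proj x (ψ : H) := K.mem_pow_domain r ψ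
    rw [summable_iff] at h0 ⊢
    refine Summable.of_nonneg_of_le (fun x => by positivity) (fun x => ?_) h0
    gcongr
    rw [norm_smul, norm_smul, norm_mul]
    exact mul_le_mul_of_nonneg_right
      (mul_le_of_le_one_right (norm_nonneg _) (hg x)) (norm_nonneg _)
  have hd : Summable fun x : ℝ => g x • K.proj x (ψ : H) := by simpa using key 0
  refine ⟨hd, (Submodule.mem_iInf _).2 fun r => ?_⟩
  change Summable fun x : ℝ =>
    ((x ^ r : ℝ) : ℂ) • K.proj x (∑' y : ℝ, g y • K.proj y (ψ : H))
  refine (key r).congr fun x => ?_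
  rw [K.proj_tsum g _ hd, smul_smul]

theorem norm_exp_le (τ x : ℝ) : ‖Complex.exp (Complex.I * τ * x)‖ ≤ 1 := by
  rw [Complex.norm_exp]
  simp

/-- `e^{iτK₀}` as an operator on `H^∞`. -/
def expOp (τ : ℝ) : Module.End ℂ K.smooth where
  toFun ψ :=
    ⟨K.func (fun x => Complex.exp (Complex.I * τ * x))
        ⟨ψ, (K.func_mem_smooth _ (norm_exp_le τ) ψ).1⟩,
      (K.func_mem_smooth _ (norm_exp_le τ) ψ).2⟩
  map_add' a b := Subtype.ext <| (K.func _).map_add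
    ⟨a, (K.func_mem_smooth _ (norm_exp_le τ) a).1⟩ ⟨b, (K.func_mem_smooth _ (norm_exp_le τ) b).1⟩
  map_smul' c a := Subtype.ext <| (K.func _).map_smul c
    ⟨a, (K.func_mem_smooth _ (norm_exp_le τ) a).1⟩

end ReferenceOperator

/-! ## Graded algebras of operators -/

/-- The data of a graded family of operator classes: for every real `m` a linear space `cls m` of
operators on `H^∞`, with a countable family of seminorms. -/
structure OperatorClasses (K : ReferenceOperator H) where
  cls : ℝ → Submodule ℂ (Module.End ℂ K.smooth)
  semi : ∀ m : ℝ, ℕ → Seminorm ℂ (cls m)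

/-- `cls` is a graded algebra over `K₀`: elements of `cls m` have order `m`, and the
axioms (i)–(vi) of the abstract pseudodifferential calculus hold. Continuity of (bi)linear maps is
expressed by the seminorms (`F.sup p` is the maximum of the seminorms `p j`, `j ∈ F`). -/
structure IsGradedAlgebra {K : ReferenceOperator H} (𝒜 : OperatorClasses K) : Prop where
  isOfOrder : ∀ m, ∀ A ∈ 𝒜.cls m, K.IsOfOrder m A
  /-- (i) -/
  pow_mem : ∀ m : ℝ, ∃ B ∈ 𝒜.cls m, K.IsRestriction (K.pow m) B
  /-- (ii) -/
  isFrechet : ∀ m, IsFrechet (𝒜.semi m)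
  embedding_continuous : ∀ m s : ℝ, ∃ (F : Finset ℕ) (C : ℝ), ∀ (A : 𝒜.cls m) (ψ : K.smooth),
    K.sob (s - m) ((A : Module.End ℂ K.smooth) ψ) ≤ C * (F.sup (𝒜.semi m)) A * K.sob s ψ
  cls_mono : ∀ ⦃m' m : ℝ⦄, m' ≤ m → 𝒜.cls m' ≤ 𝒜.cls m
  cls_mono_continuous : ∀ ⦃m' m : ℝ⦄ (h : m' ≤ m), ∀ j, ∃ (F : Finset ℕ) (C : ℝ),
    ∀ A : 𝒜.cls m', 𝒜.semi m j (Submodule.inclusion (cls_mono h) A) ≤ C * (F.sup (𝒜.semi m')) A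
  /-- (iii) -/
  mul_mem : ∀ m n : ℝ, ∀ A ∈ 𝒜.cls m, ∀ B ∈ 𝒜.cls n, A * B ∈ 𝒜.cls (m + n)
  mul_continuous : ∀ (m n : ℝ) (j : ℕ), ∃ (F G : Finset ℕ) (C : ℝ),
    ∀ (A : 𝒜.cls m) (B : 𝒜.cls n),
      𝒜.semi (m + n) j ⟨(A : Module.End ℂ K.smooth) * B, mul_mem m n A A.2 B B.2⟩ ≤
        C * (F.sup (𝒜.semi m)) A * (G.sup (𝒜.semi n)) B
  /-- (iv) -/
  commutator_mem : ∀ m n : ℝ, ∀ A ∈ 𝒜.cls m, ∀ B ∈ 𝒜.cls n,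
    A * B - B * A ∈ 𝒜.cls (m + n - 1)
  commutator_continuous : ∀ (m n : ℝ) (j : ℕ), ∃ (F G : Finset ℕ) (C : ℝ),
    ∀ (A : 𝒜.cls m) (B : 𝒜.cls n),
      𝒜.semi (m + n - 1) j ⟨(A : Module.End ℂ K.smooth) * B - B * A,
          commutator_mem m n A A.2 B B.2⟩ ≤
        C * (F.sup (𝒜.semi m)) A * (G.sup (𝒜.semi n)) B
  /-- (v); an operator with such a decomposition maps `H^∞` to itself -/
  smoothing_perturbation : ∀ (m : ℝ) (A : Module.End ℂ K.smooth),
    (∀ N : ℝ, 0 < N → ∃ B ∈ 𝒜.cls m, ∃ S, K.IsSmoothing N S ∧ A = B + S) → A ∈ 𝒜.cls m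
  /-- (vi) -/
  adjoint_mem : ∀ m, ∀ A ∈ 𝒜.cls m, ∃ B ∈ 𝒜.cls m, K.IsAdjointPair A B

/-- The Egorov property: for `A ∈ cls m`, `τ ↦ e^{iτK₀} A e^{-iτK₀}` belongs to
`C⁰_b(ℝ, cls m)`. -/
def HasEgorovProperty {K : ReferenceOperator H} (𝒜 : OperatorClasses K) : Prop :=
  ∀ m, ∀ A ∈ 𝒜.cls m, ∃ F : ℝ → 𝒜.cls m,
    (∀ τ, (F τ : Module.End ℂ K.smooth) = K.expOp τ * A * K.expOp (-τ)) ∧ IsCb (𝒜.semi m) F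

/-! ## Classical symbols -/

/-- `f` is an elliptic classical symbol of order `ρ` (at `+∞`): it is smooth, real valued and has an
asymptotic expansion `∑ⱼ cⱼ x^{ρ-j}` with leading coefficient `c₀ > 0`. -/
def IsEllipticSymbol (f : ℝ → ℝ) (ρ : ℝ) : Prop :=
  ContDiff ℝ ∞ f ∧ ∃ c : ℕ → ℝ, 0 < c 0 ∧ ∀ k : ℕ, 1 ≤ k → ∀ N : ℕ, 1 ≤ N → ∃ C : ℝ, ∀ x : ℝ,
    1 ≤ x →
      |iteratedDeriv k (fun y => f y - ∑ j ∈ Finset.range N, c j * y ^ (ρ - j)) x| ≤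
        C * |x ^ (ρ - N - k)|

/-! ## Schrödinger equations and propagators -/

/-- `u : ℝ → H^∞` solves `i ∂ₜ u = (H₀ + V(t)) u` on `ℝ`, differentiability being in `H^∞`, i.e.
in every norm `‖·‖_r`, `r ∈ ℝ`. -/
def IsSolution (K : ReferenceOperator H) (H₀ : H →ₗ.[ℂ] H) (V : ℝ → Module.End ℂ K.smooth)
    (u : ℝ → K.smooth) : Prop :=
  ∀ t, ∃ (v : K.smooth) (h : (u t : H) ∈ H₀.domain),
    HasSeminormDerivAt K.sob u v t ∧ Complex.I • (v : H) = H₀ ⟨u t, h⟩ + (V t (u t) : H)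

/-- `U ∈ L(H^r)` with operator norm at most `C`. For `r ≥ 0`, `D(K₀ ^ r)` is `H^r`; for `r < 0` it
is `H`, a dense subspace of `H^r`, and the condition says that `U` extends to `H^r`. -/
def IsBoundedOn (K : ReferenceOperator H) (r C : ℝ) (U : H →L[ℂ] H) : Prop :=
  ∀ ψ : (K.pow r).domain, ∃ h : U ψ ∈ (K.pow r).domain,
    ‖K.pow r ⟨U ψ, h⟩‖ ≤ C * ‖K.pow r ψ‖

/-- `U(t, s)` is the propagator generated by `H₀ + V(t)` in the scale of spaces `H^r`. -/
structure IsPropagator (K : ReferenceOperator H) (H₀ : H →ₗ.[ℂ] H)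
    (V : ℝ → Module.End ℂ K.smooth) (U : ℝ → ℝ → H →L[ℂ] H) : Prop where
  self : ∀ s, U s s = ContinuousLinearMap.id ℂ H
  comp : ∀ t r s, (U t r).comp (U r s) = U t s
  isometry : ∀ t s ψ, ‖U t s ψ‖ = ‖ψ‖
  /-- `U(t, s) ∈ L(H^r)` for every real `r` -/
  bounded : ∀ r t s, ∃ C, IsBoundedOn K r C (U t s)
  /-- strong continuity on `H^r` for every real `r` -/
  continuous : ∀ (r : ℝ) (ψ : (K.pow r).domain),
    ∃ h : ∀ t s, U t s ψ ∈ (K.pow r).domain,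
      Continuous fun p : ℝ × ℝ => K.pow r ⟨U p.1 p.2 ψ, h p.1 p.2⟩
  /-- `t ↦ U(t, s) ψ` is a solution, for every `ψ ∈ H^∞` -/
  solution : ∀ (s : ℝ) (ψ : K.smooth), ∃ u : ℝ → K.smooth,
    (∀ t, (u t : H) = U t s ψ) ∧ IsSolution K H₀ V u
  /-- there are no other solutions -/
  unique : ∀ u : ℝ → K.smooth, IsSolution K H₀ V u → ∀ t s, (u t : H) = U t s (u s)

end SobolevGrowth

end

/-! The growth rate is controlled by a modified energy. For every $r>0$ there is a time dependent
operator $A(t)$ of order $2r$, equal to $K_0^{2r}$ up to a strictly smaller order, whose Heisenberg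
derivative $A'+i[H(t),A]$ has order $0$. Along a solution the derivative of
$\langle\psi,A\psi\rangle$ is the expectation of an operator bounded on $\mathcal H$, so it is at
most a constant times the conserved $\|\psi\|^2$. Since $\mathrm{Re}\langle\psi,A\psi\rangle$ is
comparable to $\|\psi\|_r^2$ modulo $\|\psi\|^2$, the square $\|\psi(t)\|_r^2$ grows at most
linearly. The resulting factor $\langle t-s\rangle^{1/2}$ is the same for every exponent $R$;
complex interpolation between the isometry on $\mathcal H$ and the bound on $\mathcal H^R$ gives the
power $r/(2R)$ on $\mathcal H^r$, and $R$ may be as large as desired (`interpolation`,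
`exists_growth_bound`).

The energy comes from a normal form (`exists_approx_invariant`, `exists_modified_energy`). If $W$ is
the part of $H(t)$ not yet commuting with functions of $K_0$, one solves $i[X,H_0]+W-Z\approx0$ with
$Z$ the average of $W$ over the flow of $K_0$. The gaps of the spectrum are integers, so $s\mapsto
e^{2\pi isK_0}We^{-2\pi isK_0}$ has period one, and both the average and the integral with weight
$s$ that inverts $[K_0,\cdot]$ stay in the class of $W$ by the Egorov property. As
$[K_0^\mu,\cdot]\approx\mu K_0^{\mu-1}[K_0,\cdot]$, the solution $X$ gains $\mu-1$ orders; the error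
is a Taylor remainder of $x^\mu$, which belongs to the calculus by axiom (v)
(`exists_mult_rpow_remainder`, `exists_homological`). Each step lowers the order of the bad part by
a fixed $\delta>0$, so finitely many suffice. Only truncated exponentials of $\mathrm{ad}\,X$ acting
on operators are used: no conjugating unitary is constructed, and $A$ need not be symmetric since
only real parts of expectations enter.

Axiom (v) yields membership without estimates. The multiplier maps are nevertheless continuous
between the Fréchet spaces $\mathcal A_m$ by the closed graph theorem (`closed_graph`,
`exists_contLin_mult`), so they can be applied to smooth functions of time.

The same energies give the propagator. The equation is truncated to the first $n$ eigenspaces. The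
energy does not commute with the truncation; a vanishing viscosity $(n+\lambda)^{-1}K_0^{\mu+1}$
absorbs the error (`energy_inequality`), so all Sobolev bounds are uniform in $n$. The
approximations are Cauchy in $\mathcal H$, hence in every norm by convexity. Time reversal supplies
negative times, and density extends the flow from $\mathcal H^\infty$ to the whole scale. -/

noncomputable section
namespace SobolevGrowth

/-! ## The closed graph theorem for families of seminorms -/

section ClosedGraph

variable {E F : Type*} [AddCommGroup E] [Module ℂ E] [AddCommGroup F] [Module ℂ F]

/-- Baire's theorem for the topology of a Fréchet space. -/
theorem IsFrechet.exists_interior {p : ℕ → Seminorm ℂ E} (hp : IsFrechet p) (A : ℕ → Set E)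
    (hA : ∀ x, ∃ n, x ∈ A n) :
    ∃ (n : ℕ) (x₀ : E) (s : Finset ℕ) (δ : ℝ), 0 < δ ∧ ∀ x, (s.sup p) (x - x₀) < δ →
      ∀ (s' : Finset ℕ) (δ' : ℝ), 0 < δ' → ∃ y ∈ A n, (s'.sup p) (y - x) < δ' := by
  let : TopologicalSpace E := (SeminormFamily.moduleFilterBasis (𝕜 := ℂ) p).topology
  have hw : WithSeminorms (𝕜 := ℂ) (E := E) p := ⟨rfl⟩
  have := hw.topologicalAddGroup
  have : FirstCountableTopology E := hw.firstCountableTopology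
  let : UniformSpace E := IsTopologicalAddGroup.rightUniformSpace E
  have : IsUniformAddGroup E := isUniformAddGroup_of_addCommGroup
  have : (uniformity E).IsCountablyGenerated := by
    exact IsUniformAddGroup.uniformity_countably_generated
  have : CompleteSpace E := by
    refine UniformSpace.complete_of_cauchySeq_tendsto fun u hu => ?_
    obtain ⟨a, ha⟩ := hp.2 u (by
      intro j ε hε
      rw [cauchySeq_iff] at hu
      have hc : Continuous (p j) := hw.continuous_seminorm j
      have hV : {z : E × E | p j (z.1 - z.2) < ε} ∈ uniformity E := by
        rw [uniformity_eq_comap_nhds_zero_swapped]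
        refine ⟨{x | p j x < ε}, ?_, fun z hz => hz⟩
        exact (isOpen_lt hc continuous_const).mem_nhds (by simpa using hε)
      obtain ⟨N, hN⟩ := hu _ hV
      exact ⟨N, fun k hk l hl => hN k hk l hl⟩)
    refine ⟨a, (hw.tendsto_nhds u a).2 fun j ε hε => ?_⟩
    exact (ha j).eventually (gt_mem_nhds hε)
  -- A countable family of seminorms gives a countably generated uniformity, so sequential
  -- completeness suffices and Baire's theorem for complete pseudometric spaces applies.
  let := UniformSpace.pseudoMetricSpace E
  have hU : (⋃ n, closure (A n)) = Set.univ := by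
    refine Set.eq_univ_of_forall fun x => ?_
    obtain ⟨n, hn⟩ := hA x
    exact Set.mem_iUnion.2 ⟨n, subset_closure hn⟩
  obtain ⟨n, x₀, hx₀⟩ := nonempty_interior_of_iUnion_of_closed (fun n => isClosed_closure) hU
  obtain ⟨s, δ, hδ, hs⟩ := (hw.mem_nhds_iff _ _).1 (mem_interior_iff_mem_nhds.1 hx₀)
  refine ⟨n, x₀, s, δ, hδ, fun x hx s' δ' hδ' => ?_⟩
  have hxc : x ∈ closure (A n) := hs (by rwa [Seminorm.mem_ball])
  obtain ⟨y, hy, hyA⟩ := mem_closure_iff_nhds.1 hxc ((s'.sup p).ball x δ')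
    ((hw.mem_nhds_iff _ _).2 ⟨s', δ', hδ', le_rfl⟩)
  exact ⟨y, hyA, by rwa [Seminorm.mem_ball] at hy⟩

/-- A linear map on a Fréchet space is almost continuous for every seminorm on the target. -/
theorem IsFrechet.almost_continuous {p : ℕ → Seminorm ℂ E} (hp : IsFrechet p)
    (Q : Seminorm ℂ E) {η : ℝ} (hη : 0 < η) :
    ∃ (s : Finset ℕ) (δ : ℝ), 0 < δ ∧ ∀ x, (s.sup p) x < δ →
      ∀ (s' : Finset ℕ) (δ' : ℝ), 0 < δ' → ∃ y, Q y ≤ η ∧ (s'.sup p) (x - y) < δ' := by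
  obtain ⟨n, x₀, s, δ, hδ, h⟩ := hp.exists_interior (fun n : ℕ => {x | Q x ≤ n})
    fun x => exists_nat_ge (Q x)
  -- Approximants $y_1$ of $x_0+c^{-1}x$ and $y_2$ of $x_0$ satisfy $Q(y_1-y_2)\le 2n$; the centre
  -- $x_0$ cancels in the difference, and scaling by $c$ brings the bound below $\eta$.
  set c : ℝ := η / (2 * n + 1) with hc
  have hc0 : 0 < c := by positivity
  have nrm : ∀ (q : Seminorm ℂ E) (a : ℝ) (x : E), 0 < a → q ((a : ℂ) • x) = a * q x := by
    intro q a x ha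
    rw [map_smul_eq_mul, Complex.norm_real, Real.norm_of_nonneg ha.le]
  refine ⟨s, c * δ, by positivity, fun x hx s' δ' hδ' => ?_⟩
  have hx' : (s.sup p) (((c⁻¹ : ℝ) : ℂ) • x) < δ := by
    rw [nrm _ _ _ (by positivity), inv_mul_lt_iff₀ hc0]
    exact hx
  have hε : 0 < c⁻¹ * δ' / 2 := by positivity
  obtain ⟨y₁, h1, h1'⟩ := h (x₀ + ((c⁻¹ : ℝ) : ℂ) • x) (by simpa using hx') s' _ hε
  obtain ⟨y₂, h2, h2'⟩ := h x₀ (by simpa using hδ) s' _ hε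
  refine ⟨(c : ℂ) • (y₁ - y₂), ?_, ?_⟩
  · rw [nrm _ _ _ hc0]
    have : Q (y₁ - y₂) ≤ n + n := (map_sub_le_add Q _ _).trans (add_le_add h1 h2)
    calc c * Q (y₁ - y₂) ≤ c * (2 * n + 1) := by gcongr; linarith
      _ = η := by rw [hc]; field_simp
  · have e : x - (c : ℂ) • (y₁ - y₂)
        = (c : ℂ) • ((y₂ - x₀) - (y₁ - (x₀ + ((c⁻¹ : ℝ) : ℂ) • x))) := by
      have hcc : (c : ℂ) * ((c⁻¹ : ℝ) : ℂ) = 1 := by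
        rw [← Complex.ofReal_mul, mul_inv_cancel₀ hc0.ne', Complex.ofReal_one]
      have : x = (c : ℂ) • (((c⁻¹ : ℝ) : ℂ) • x) := by rw [smul_smul, hcc, one_smul]
      conv_lhs => rw [this]
      rw [← smul_sub]
      congr 1
      abel
    rw [e, nrm _ _ _ hc0]
    have := (map_sub_le_add (s'.sup p) (y₂ - x₀) (y₁ - (x₀ + ((c⁻¹ : ℝ) : ℂ) • x)))
    have h3 : (s'.sup p) ((y₂ - x₀) - (y₁ - (x₀ + ((c⁻¹ : ℝ) : ℂ) • x))) < c⁻¹ * δ' := by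
      linarith
    calc _ < c * (c⁻¹ * δ') := by gcongr
      _ = δ' := by field_simp

/-- Almost continuity is iterated as in the open mapping theorem. A small $x$ is expanded as $\sum_k
y_k$, each remainder lying in the next ball and each $Ty_k$ being of size $2^{-k}$. The images of
the partial sums converge, the closed graph identifies their limit with $Tx$, and the geometric
series bounds $Tx$. The hypothesis is sequential, hence easy to check for multipliers. -/
theorem closed_graph {p : ℕ → Seminorm ℂ E} {q : ℕ → Seminorm ℂ F} (hp : IsFrechet p)
    (hq : IsFrechet q) (T : E →ₗ[ℂ] F)
    (hT : ∀ (u : ℕ → E) (a : E) (b : F), (∀ j, Tendsto (fun k => p j (u k - a)) atTop (𝓝 0)) →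
      (∀ j, Tendsto (fun k => q j (T (u k) - b)) atTop (𝓝 0)) → T a = b) (j : ℕ) :
    ∃ (s : Finset ℕ) (C : ℝ), ∀ x, q j (T x) ≤ C * (s.sup p) x := by
  -- Both finite families grow with $k$: the first so that the remainders tend to zero in every `p`,
  -- the second so that $Ty_k$ is eventually summable in every `q`. The index $j$ is included from
  -- $k=0$ on, since the final estimate is in `q j`.
  have key : ∀ k : ℕ, ∃ (s : Finset ℕ) (δ : ℝ), 0 < δ ∧ δ ≤ (1 / 2) ^ k ∧ Finset.range (k + 1) ⊆ s ∧
      ∀ x, (s.sup p) x < δ → ∀ (s' : Finset ℕ) (δ' : ℝ), 0 < δ' →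
        ∃ y, ((Finset.range (k + j + 1)).sup q) (T y) ≤ (1 / 2) ^ k ∧ (s'.sup p) (x - y) < δ' := by
    intro k
    obtain ⟨s, δ, hδ, h⟩ := hp.almost_continuous (((Finset.range (k + j + 1)).sup q).comp T)
      (show (0 : ℝ) < (1 / 2) ^ k by positivity)
    refine ⟨s ∪ Finset.range (k + 1), min δ ((1 / 2) ^ k), by positivity, min_le_right _ _,
      Finset.subset_union_right, fun x hx s' δ' hδ' => ?_⟩
    refine h x (lt_of_le_of_lt ?_ (hx.trans_le (min_le_left _ _))) s' δ' hδ'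
    exact (Finset.sup_mono (Finset.subset_union_left) : s.sup p ≤ _) x
  choose s δ hδ hδ' hs hstep using key
  have main : ∀ x, ((s 0).sup p) x < δ 0 → q j (T x) ≤ 2 := by
    intro x hx
    let Y : (k : ℕ) → {x // ((s k).sup p) x < δ k} → E := fun k x =>
      (hstep k x.1 x.2 (s (k + 1)) (δ (k + 1)) (hδ (k + 1))).choose
    have hY := fun (k : ℕ) (x : {x // ((s k).sup p) x < δ k}) =>
      (hstep k x.1 x.2 (s (k + 1)) (δ (k + 1)) (hδ (k + 1))).choose_spec
    let X : (k : ℕ) → {x // ((s k).sup p) x < δ k} := fun k =>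
      Nat.rec (motive := fun k => {x // ((s k).sup p) x < δ k}) ⟨x, hx⟩
        (fun k z => ⟨z.1 - Y k z, (hY k z).2⟩) k
    let y : ℕ → E := fun k => Y k (X k)
    have hX0 : (X 0).1 = x := rfl
    have hXs : ∀ k, (X (k + 1)).1 = (X k).1 - y k := fun k => rfl
    have hy : ∀ k i, i ≤ k + j → q i (T (y k)) ≤ (1 / 2) ^ k := fun k i hi =>
      (Seminorm.le_finset_sup_apply (Finset.mem_range.2 (by omega))).trans (hY k (X k)).1
    let u : ℕ → E := fun k => x - (X k).1
    have hu : ∀ j', Tendsto (fun k => p j' (u k - x)) atTop (𝓝 0) := by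
      intro j'
      have : ∀ k ≥ j', p j' (u k - x) ≤ (1 / 2) ^ k := by
        intro k hk
        have e : u k - x = -(X k).1 := by simp [u]
        rw [e, map_neg_eq_map]
        exact ((Seminorm.le_finset_sup_apply (hs k (Finset.mem_range.2 (by omega)))).trans
          (X k).2.le).trans (hδ' k)
      refine squeeze_zero' (Eventually.of_forall fun k => apply_nonneg _ _)
        (eventually_atTop.2 ⟨j', this⟩) ?_
      exact tendsto_pow_atTop_nhds_zero_of_lt_one (by norm_num) (by norm_num)
    have hdiff : ∀ i k l, i ≤ k + j → q i (T (u (k + l)) - T (u k)) ≤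
        2 * (1 / 2) ^ k - 2 * (1 / 2) ^ (k + l) := by
      intro i k l hi
      induction l with
      | zero => simp
      | succ l ih =>
        have e : T (u (k + (l + 1))) - T (u k) = (T (u (k + l)) - T (u k)) + T (y (k + l)) := by
          have : u (k + (l + 1)) = u (k + l) + y (k + l) := by
            simp only [u, ← add_assoc, hXs]
            abel
          rw [this, map_add]
          abel
        rw [e]
        have h1 := map_add_le_add (q i) (T (u (k + l)) - T (u k)) (T (y (k + l)))
        have h2 := hy (k + l) i (by omega)
        have e2 : (1 / 2 : ℝ) ^ (k + (l + 1)) = (1 / 2) ^ (k + l) * (1 / 2) := by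
          rw [← add_assoc, pow_succ]
        rw [e2]
        linarith
    have hdiff' : ∀ i k l, i ≤ k + j → q i (T (u (k + l)) - T (u k)) ≤ 2 * (1 / 2) ^ k :=
      fun i k l hi => (hdiff i k l hi).trans (by
        have : (0 : ℝ) ≤ (1 / 2) ^ (k + l) := by positivity
        linarith)
    obtain ⟨b, hb⟩ := hq.2 (fun k => T (u k)) (by
      intro i ε hε
      have hl : Tendsto (fun k : ℕ => 4 * (1 / 2 : ℝ) ^ k) atTop (𝓝 0) := by
        simpa using (tendsto_pow_atTop_nhds_zero_of_lt_one (r := (1 / 2 : ℝ)) (by norm_num)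
          (by norm_num)).const_mul 4
      obtain ⟨N, hN⟩ := (eventually_atTop.1 (hl.eventually (gt_mem_nhds hε)))
      refine ⟨max N i, fun k hk l hl => ?_⟩
      have e : ∀ k ≥ max N i, q i (T (u k) - T (u (max N i))) ≤ 2 * (1 / 2) ^ (max N i) := by
        intro k hk
        obtain ⟨d, rfl⟩ := Nat.exists_eq_add_of_le hk
        exact hdiff' i _ d ((le_max_right _ _).trans (Nat.le_add_right _ _))
      have := map_sub_le_add (q i) (T (u k) - T (u (max N i))) (T (u l) - T (u (max N i)))
      rw [sub_sub_sub_cancel_right] at this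
      have h1 := e k hk
      have h2 := e l hl
      have h3 := hN _ (le_max_left N i)
      linarith)
    have hb' := hT u x b hu hb
    have h3 : ∀ k, q j (T x) ≤ 2 + q j (T (u k) - b) := by
      intro k
      have e : T x = T (u k) - (T (u k) - b) := by rw [hb']; abel
      have h4 := map_sub_le_add (q j) (T (u k)) (T (u k) - b)
      rw [← e] at h4
      have h5 := hdiff' j 0 k (by omega)
      have h6 : u 0 = 0 := by simp [u, hX0]
      rw [h6, map_zero, sub_zero, zero_add, pow_zero] at h5
      linarith
    have := ge_of_tendsto' ((hb j).const_add 2) h3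
    linarith
  refine ⟨s 0, 2 / δ 0, fun x => ?_⟩
  refine le_of_forall_gt_imp_ge_of_dense fun r hr => ?_
  have hd := hδ 0
  have hr0 : 0 < r := lt_of_le_of_lt (by positivity) hr
  have hr' : ((s 0).sup p) x < r * δ 0 / 2 := by
    rw [lt_div_iff₀ two_pos]
    rw [div_mul_eq_mul_div, div_lt_iff₀ hd] at hr
    linarith
  have h1 := main (((2 / r : ℝ) : ℂ) • x) (by
    rw [map_smul_eq_mul, Complex.norm_real, Real.norm_of_nonneg (by positivity),
      div_mul_eq_mul_div, div_lt_iff₀ hr0]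
    linarith)
  rw [map_smul, map_smul_eq_mul, Complex.norm_real, Real.norm_of_nonneg (by positivity),
    div_mul_eq_mul_div, div_le_iff₀ hr0] at h1
  linarith

end ClosedGraph

end SobolevGrowth
end

noncomputable section
namespace SobolevGrowth
variable {H : Type*} [NormedAddCommGroup H] [InnerProductSpace ℂ H] [CompleteSpace H]

/-! ## Completeness of the eigenspaces of an operator with discrete spectrum -/

namespace ReferenceOperator

variable (K : ReferenceOperator H)

theorem op_symm (a b : K.op.domain) : ⟪K.op a, (b : H)⟫_ℂ = ⟪(a : H), K.op b⟫_ℂ := by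
  have hs := LinearPMap.adjoint_isFormalAdjoint K.selfAdjoint.dense_domain
  rw [LinearPMap.isSelfAdjoint_def.mp K.selfAdjoint] at hs
  exact hs a b

theorem eigenspace_eq_bot {x : ℝ} (hx : (x : ℂ) ∉ spectrumOf K.op) : K.eigenspace x = ⊥ := by
  rw [spectrumOf, Set.mem_ofPred_eq, not_not] at hx
  obtain ⟨R, -, hR⟩ := hx
  refine (Submodule.eq_bot_iff _).2 ?_
  rintro ψ ⟨h, h'⟩
  have := hR ⟨ψ, h⟩
  simpa [h'] using this.symm

theorem proj_eq_zero {x : ℝ} (hx : (x : ℂ) ∉ spectrumOf K.op) (ψ : H) : K.proj x ψ = 0 := by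
  have := K.proj_mem x ψ
  rwa [K.eigenspace_eq_bot hx, Submodule.mem_bot] at this

theorem proj_symm (x : ℝ) (φ ψ : H) : ⟪K.proj x φ, ψ⟫_ℂ = ⟪φ, K.proj x ψ⟫_ℂ :=
  Submodule.inner_starProjection_left_eq_right _ _ _

section Completeness

variable {K} {lam : ℝ} {R : H →L[ℂ] H}

theorem isSelfAdjoint_of_inverse
    (hR : ∀ φ : H, ∃ h : R φ ∈ K.op.domain, K.op ⟨R φ, h⟩ = φ) : IsSelfAdjoint R := by
  rw [ContinuousLinearMap.isSelfAdjoint_iff_isSymmetric]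
  intro φ χ
  obtain ⟨h1, h1'⟩ := hR φ
  obtain ⟨h2, h2'⟩ := hR χ
  have := K.op_symm ⟨R φ, h1⟩ ⟨R χ, h2⟩
  rw [h1', h2'] at this
  exact this.symm

/-- For $x\ne0$ with $c=x^{-1}$ outside the spectrum of $K_0$, put $S=(K_0-c)^{-1}$. The resolvent
identity $cRS=S-R$ shows that $c(1+cS)$ inverts $x-R$, where $R=K_0^{-1}$. -/
theorem spectrum_inverse_subset
    (hR : ∀ φ : H, ∃ h : R φ ∈ K.op.domain, K.op ⟨R φ, h⟩ = φ)
    (hR' : ∀ ψ : K.op.domain, R (K.op ψ) = ψ)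
    (hspec : spectrumOf K.op ⊆ Set.range fun n : ℕ => ((n : ℂ) + (lam : ℂ)))
    {x : ℝ} (hx : x ∈ spectrum ℝ R) : x = 0 ∨ ∃ n : ℕ, x = ((n : ℝ) + lam)⁻¹ := by
  by_contra hcon
  push Not at hcon
  obtain ⟨hx0, hxn⟩ := hcon
  have hz : ((x⁻¹ : ℝ) : ℂ) ∉ spectrumOf K.op := by
    intro h
    obtain ⟨n, hn⟩ := hspec h
    refine hxn n ?_
    have hn' : (((n : ℝ) + lam : ℝ) : ℂ) = ((x⁻¹ : ℝ) : ℂ) := by push_cast at hn ⊢; exact hn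
    have : (n : ℝ) + lam = x⁻¹ := by exact_mod_cast hn'
    rw [this, inv_inv]
  rw [spectrumOf, Set.mem_ofPred_eq, not_not] at hz
  obtain ⟨S, hS, hS'⟩ := hz
  set c : ℂ := ((x⁻¹ : ℝ) : ℂ) with hc
  have hxc : (x : ℂ) * c = 1 := by rw [hc, ← Complex.ofReal_mul, mul_inv_cancel₀ hx0]; simp
  have e1 : c • (R * S) = S - R := by
    ext φ
    obtain ⟨h, h'⟩ := hS φ
    have h2 := hR' ⟨S φ, h⟩
    have h3 := congrArg R h'
    rw [map_sub, map_smul, h2] at h3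
    change c • R (S φ) = S φ - R φ
    rw [← h3]
    abel
  have e2 : c • (S * R) = S - R := by
    ext φ
    obtain ⟨h, h'⟩ := hR φ
    have h2 := hS' ⟨R φ, h⟩
    rw [h', map_sub, map_smul] at h2
    change c • S (R φ) = S φ - R φ
    change S φ - c • S (R φ) = R φ at h2
    nth_rw 2 [← h2]
    abel
  have ha : algebraMap ℝ (H →L[ℂ] H) x = (x : ℂ) • 1 := by
    rw [Algebra.algebraMap_eq_smul_one, Complex.coe_smul]
  refine hx (isUnit_iff_exists.2 ⟨c • (1 + c • S), ?_, ?_⟩)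
  · have e : (algebraMap ℝ (H →L[ℂ] H) x - R) * (c • (1 + c • S)) =
        ((x : ℂ) * c) • 1 + ((x : ℂ) * c) • (c • S) - c • R - c • (c • (R * S)) := by
      rw [ha]
      simp only [mul_smul_comm, mul_add, sub_mul, mul_one, smul_mul_assoc, one_mul]
      module
    rw [e, e1, hxc]
    module
  · have e : (c • (1 + c • S)) * (algebraMap ℝ (H →L[ℂ] H) x - R) =
        ((x : ℂ) * c) • 1 + ((x : ℂ) * c) • (c • S) - c • R - c • (c • (S * R)) := by
      rw [ha]
      simp only [mul_smul_comm, add_mul, mul_sub, mul_one, smul_mul_assoc, one_mul]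
      module
    rw [e, e2, hxc]
    module

/-- The spectral theorem for $K_0$ is replaced by the continuous functional calculus of its bounded
inverse $R$, whose spectrum consists of isolated points $(n+\lambda)^{-1}$ and possibly $0$. A bump
function at one of these points, applied to $R$, has range in an eigenspace of $K_0$, so it
annihilates a vector orthogonal to all of them. Removing the first $N$ bumps leaves an operator of
norm at most $(N+\lambda)^{-1}$; hence $R\psi=0$, and $R$ is injective. -/
theorem eq_zero_of_forall_proj_eq_zero (hlam : 0 < lam)
    (hspec : spectrumOf K.op ⊆ Set.range fun n : ℕ => ((n : ℂ) + (lam : ℂ))) {ψ : H}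
    (hψ : ∀ x, K.proj x ψ = 0) : ψ = 0 := by
  have h0 : (0 : ℂ) ∉ spectrumOf K.op := by
    intro h
    obtain ⟨n, hn⟩ := hspec h
    have hn' : ((((n : ℝ) + lam : ℝ)) : ℂ) = 0 := by push_cast; exact hn
    have h1 : (n : ℝ) + lam = 0 := by exact_mod_cast hn'
    have h2 : (0 : ℝ) < n + lam := by positivity
    exact h2.ne' h1
  rw [spectrumOf, Set.mem_ofPred_eq, not_not] at h0
  obtain ⟨R, hR, hR'⟩ := h0
  simp only [zero_smul, sub_zero] at hR hR'
  have hsa := isSelfAdjoint_of_inverse hR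
  set X : ℕ → ℝ := fun n => ((n : ℝ) + lam)⁻¹ with hX
  have hXpos : ∀ n, 0 < X n := fun n => by positivity
  have hXanti : StrictAnti X := by
    refine strictAnti_nat_of_succ_lt fun n => ?_
    simp only [hX]
    gcongr
    linarith
  -- The gap on the side of $0$ is the smaller of the two neighbouring gaps and is less than $X_n$,
  -- so a tent of this half-width vanishes at $0$ and at all the other points.
  set d : ℕ → ℝ := fun n => X n - X (n + 1) with hd
  have hdpos : ∀ n, 0 < d n := fun n => sub_pos.2 (hXanti n.lt_succ_self)
  have hsp : ∀ x ∈ spectrum ℝ R, x = 0 ∨ ∃ n, x = X n :=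
    fun x hx => spectrum_inverse_subset hR hR' hspec hx
  set f : ℕ → ℝ → ℝ := fun n x => max 0 (1 - |x - X n| / d n) with hf
  have hfc : ∀ n, Continuous (f n) := fun n => by simp only [hf]; fun_prop
  have hf1 : ∀ n, f n (X n) = 1 := fun n => by simp [hf]
  have hf0 : ∀ n x, d n ≤ |x - X n| → f n x = 0 := by
    intro n x h
    refine max_eq_left ?_
    rw [sub_nonpos, one_le_div (hdpos n)]
    exact h
  have hfz : ∀ n, f n 0 = 0 := by
    intro n
    refine hf0 n 0 ?_
    rw [zero_sub, abs_neg, abs_of_pos (hXpos n)]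
    have := (hXpos (n + 1)).le
    simp only [hd]
    linarith
  have hfne : ∀ n m, n ≠ m → f n (X m) = 0 := by
    intro n m hnm
    refine hf0 n _ ?_
    rcases lt_or_gt_of_ne hnm with h | h
    · have : X m ≤ X (n + 1) := hXanti.antitone h
      refine le_trans ?_ (neg_le_abs _)
      simp only [hd]
      linarith
    · have h1 : X n ≤ X (m + 1) := hXanti.antitone h
      refine le_trans ?_ (le_abs_self _)
      have hm : (m : ℝ) + 1 ≤ n := by exact_mod_cast h
      have h2 : d n ≤ d m := by
        have e : ∀ k : ℕ, d k = 1 / (((k : ℝ) + lam) * (k + 1 + lam)) := by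
          intro k
          simp only [hd, hX]
          push_cast
          field_simp
          ring
        rw [e, e]
        gcongr
      have h3 : d m = X m - X (m + 1) := rfl
      linarith
  have hcf : ∀ n, cfc (f n) R ψ = 0 := by
    intro n
    have h1 : R * cfc (f n) R = ((X n : ℝ) : ℂ) • cfc (f n) R := by
      have e1 : R * cfc (f n) R = cfc (fun x => x * f n x) R := by
        rw [cfc_mul (fun x : ℝ => x) (f n) R (by fun_prop) (hfc n).continuousOn, cfc_id' ℝ R]
      have e2 : ((X n : ℝ) : ℂ) • cfc (f n) R = cfc (fun x => X n • f n x) R := by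
        rw [cfc_smul (X n) (f n) R (hfc n).continuousOn, Complex.coe_smul]
      rw [e1, e2]
      refine cfc_congr fun x hx => ?_
      rcases hsp x hx with rfl | ⟨m, rfl⟩
      · simp [hfz]
      · by_cases hnm : n = m
        · subst hnm; rfl
        · simp [hfne n m hnm]
    have hmem : ∀ φ, cfc (f n) R φ ∈ K.eigenspace ((n : ℝ) + lam) := by
      intro φ
      obtain ⟨h, h'⟩ := hR (cfc (f n) R φ)
      have h2 : R (cfc (f n) R φ) = ((X n : ℝ) : ℂ) • cfc (f n) R φ :=
        DFunLike.congr_fun h1 φ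
      have hne : ((X n : ℝ) : ℂ) ≠ 0 := by exact_mod_cast (hXpos n).ne'
      have h3 : R (cfc (f n) R φ) ∈ K.eigenspace ((n : ℝ) + lam) := by
        refine ⟨h, ?_⟩
        rw [h', h2, smul_smul, ← Complex.ofReal_mul]
        have : ((n : ℝ) + lam) * X n = 1 := mul_inv_cancel₀ (by positivity)
        rw [this, Complex.ofReal_one, one_smul]
      rw [h2] at h3
      have h4 := (K.eigenspace _).smul_mem (((X n : ℝ) : ℂ)⁻¹) h3
      rwa [smul_smul, inv_mul_cancel₀ hne, one_smul] at h4
    have hs : IsSelfAdjoint (cfc (f n) R) := cfc_predicate (f n) R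
    rw [ContinuousLinearMap.isSelfAdjoint_iff_isSymmetric] at hs
    rw [← inner_self_eq_zero (𝕜 := ℂ)]
    have h2 : ⟪cfc (f n) R ψ, cfc (f n) R ψ⟫_ℂ = ⟪ψ, cfc (f n) R (cfc (f n) R ψ)⟫_ℂ := hs _ _
    rw [h2]
    have h3 := hmem (cfc (f n) R ψ)
    have h4 : K.proj ((n : ℝ) + lam) (cfc (f n) R (cfc (f n) R ψ)) = cfc (f n) R (cfc (f n) R ψ) :=
      Submodule.starProjection_eq_self_iff.2 h3
    rw [← h4, ← K.proj_symm, hψ, inner_zero_left]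
  -- On the spectrum, $x-\sum_{n<N}x f_n(x)$ vanishes at $X_0,\dots,X_{N-1}$ and equals $x$ at the
  -- remaining points, which do not exceed $X_N$.
  have hRψ : ∀ N : ℕ, ‖R ψ‖ ≤ X N * ‖ψ‖ := by
    intro N
    set g : ℝ → ℝ := fun x => x - ∑ n ∈ Finset.range N, x * f n x with hg
    have e : R ψ = cfc g R ψ := by
      have : cfc g R = R - ∑ n ∈ Finset.range N, R * cfc (f n) R := by
        rw [hg, cfc_sub (fun x : ℝ => x) (fun x => ∑ n ∈ Finset.range N, x * f n x) R
          (by fun_prop) (by fun_prop), cfc_id' ℝ R]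
        congr 1
        have := cfc_sum (fun n x => x * f n x) R (Finset.range N) (fun n _ => by fun_prop)
        have e3 : (∑ n ∈ Finset.range N, fun x => x * f n x) =
          fun x => ∑ n ∈ Finset.range N, x * f n x := by ext; simp
        rw [← e3, this]
        refine Finset.sum_congr rfl fun n _ => ?_
        rw [cfc_mul (fun x : ℝ => x) (f n) R (by fun_prop) (hfc n).continuousOn, cfc_id' ℝ R]
      rw [this, sub_apply, sum_apply]
      simp [hcf]
    rw [e]
    refine (ContinuousLinearMap.le_opNorm _ _).trans ?_
    gcongr
    refine norm_cfc_le (hXpos N).le fun x hx => ?_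
    rcases hsp x hx with rfl | ⟨m, rfl⟩
    · simpa [hg] using (hXpos N).le
    · by_cases hm : m < N
      · have : g (X m) = 0 := by
          simp only [hg]
          rw [Finset.sum_eq_single_of_mem m (Finset.mem_range.2 hm)
            (fun b _ hb => by rw [hfne b m hb, mul_zero]), hf1, mul_one, sub_self]
        rw [this, norm_zero]
        exact (hXpos N).le
      · have : g (X m) = X m := by
          simp only [hg]
          rw [Finset.sum_eq_zero (fun b hb => by
            rw [hfne b m (by have := Finset.mem_range.1 hb; omega), mul_zero]), sub_zero]
        rw [this, Real.norm_of_nonneg (hXpos m).le]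
        exact hXanti.antitone (not_lt.1 hm)
  have hR0 : R ψ = 0 := by
    rw [← norm_le_zero_iff]
    have hl : Tendsto X atTop (𝓝 0) := by
      simp only [hX]
      exact tendsto_inv_atTop_zero.comp (tendsto_atTop_add_const_right _ _ tendsto_natCast_atTop_atTop)
    simpa using ge_of_tendsto' (hl.mul_const ‖ψ‖) hRψ
  obtain ⟨h, h'⟩ := hR ψ
  rw [← h']
  have : (⟨R ψ, h⟩ : K.op.domain) = 0 := Subtype.ext hR0
  rw [this, LinearPMap.map_zero]

/-- Bessel's inequality gives summability, and the difference between $\psi$ and the sum is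
annihilated by every eigenprojection. -/
theorem hasSum_proj (hlam : 0 < lam)
    (hspec : spectrumOf K.op ⊆ Set.range fun n : ℕ => ((n : ℂ) + (lam : ℂ))) (ψ : H) :
    HasSum (fun x => K.proj x ψ) ψ := by
  have hb : ∀ s : Finset ℝ, ∑ x ∈ s, ‖K.proj x ψ‖ ^ 2 ≤ ‖ψ‖ ^ 2 := by
    intro s
    have h1 : ‖∑ x ∈ s, K.proj x ψ‖ ^ 2 = ∑ x ∈ s, ‖K.proj x ψ‖ ^ 2 :=
      K.orthogonalFamily.norm_sum (fun x => ⟨K.proj x ψ, K.proj_mem x ψ⟩) s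
    have h2 : ∑ x ∈ s, ‖K.proj x ψ‖ ^ 2 = (⟪∑ x ∈ s, K.proj x ψ, ψ⟫_ℂ).re := by
      rw [sum_inner, Complex.re_sum]
      refine Finset.sum_congr rfl fun x _ => ?_
      rw [← inner_self_eq_norm_sq (𝕜 := ℂ), K.proj_symm, K.proj_proj_self, ← K.proj_symm]
      rfl
    have h3 : (⟪∑ x ∈ s, K.proj x ψ, ψ⟫_ℂ).re ≤ ‖∑ x ∈ s, K.proj x ψ‖ * ‖ψ‖ :=
      (Complex.re_le_norm _).trans (norm_inner_le_norm _ _)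
    nlinarith [sq_nonneg (‖∑ x ∈ s, K.proj x ψ‖ - ‖ψ‖)]
  have hs : Summable fun x : ℝ => (1 : ℂ) • K.proj x ψ := by
    rw [K.summable_iff (fun _ => 1)]
    simp only [one_smul]
    exact summable_of_sum_le (fun x => by positivity) hb
  have h0 : ψ - ∑' x : ℝ, (1 : ℂ) • K.proj x ψ = 0 := by
    refine eq_zero_of_forall_proj_eq_zero hlam hspec (fun x => ?_)
    rw [map_sub, K.proj_tsum (fun _ => 1) ψ hs, one_smul, sub_self]
  have := hs.hasSum
  rw [← sub_eq_zero.1 h0] at this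
  simpa using this

end Completeness
end ReferenceOperator
end SobolevGrowth
end

noncomputable section
namespace SobolevGrowth
variable {H : Type*} [NormedAddCommGroup H] [InnerProductSpace ℂ H] [CompleteSpace H]

/-! ## Spectral calculus on `H^∞` -/

theorem hasSum_of_eq {ι E : Type*} [AddCommMonoid E] [TopologicalSpace E] {f g : ι → E} {a : E}
    (h : HasSum f a) (e : ∀ i, g i = f i) : HasSum g a := by
  rwa [funext e]

namespace ReferenceOperator

/-- The spectrum of `K₀` is contained in `ℕ + lam`. -/
structure IsDiscrete (K : ReferenceOperator H) (lam : ℝ) : Prop where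
  pos : 0 < lam
  spec : spectrumOf K.op ⊆ Set.range fun n : ℕ => ((n : ℂ) + (lam : ℂ))

/-- The `n`-th spectral value. -/
def ev (lam : ℝ) (n : ℕ) : ℝ := n + lam

/-- The spectral projection onto the `n`-th eigenspace. -/
def block (K : ReferenceOperator H) (lam : ℝ) (n : ℕ) : H →L[ℂ] H := K.proj (ev lam n)

variable (K : ReferenceOperator H) {lam : ℝ}

theorem ev_injective (lam : ℝ) : Function.Injective (ev lam) := fun a b h => by
  simpa [ev] using h

theorem block_block_self (n : ℕ) (ψ : H) : K.block lam n (K.block lam n ψ) = K.block lam n ψ :=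
  K.proj_proj_self _ _

theorem block_block_ne {n m : ℕ} (h : n ≠ m) (ψ : H) : K.block lam n (K.block lam m ψ) = 0 :=
  K.proj_proj_ne (fun h' => h (ev_injective lam h')) ψ

theorem block_symm (n : ℕ) (φ ψ : H) : ⟪K.block lam n φ, ψ⟫_ℂ = ⟪φ, K.block lam n ψ⟫_ℂ :=
  K.proj_symm _ _ _

theorem norm_block_le (n : ℕ) (ψ : H) : ‖K.block lam n ψ‖ ≤ ‖ψ‖ :=
  Submodule.norm_starProjection_apply_le _ _

namespace IsDiscrete

variable {K}

theorem ev_pos (D : K.IsDiscrete lam) (n : ℕ) : 0 < ev lam n := by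
  have := D.pos
  unfold ev
  positivity

theorem proj_eq_zero (D : K.IsDiscrete lam) {x : ℝ} (hx : x ∉ Set.range (ev lam)) (ψ : H) :
    K.proj x ψ = 0 := by
  refine K.proj_eq_zero (fun h => hx ?_) ψ
  obtain ⟨n, hn⟩ := D.spec h
  refine ⟨n, ?_⟩
  have hn' : ((ev lam n : ℝ) : ℂ) = x := by unfold ev; push_cast; exact hn
  exact_mod_cast hn'

theorem hasSum_block (D : K.IsDiscrete lam) (ψ : H) : HasSum (fun n => K.block lam n ψ) ψ :=
  ((ev_injective lam).hasSum_iff fun _ hx => D.proj_eq_zero hx ψ).2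
    (hasSum_proj D.pos D.spec ψ)

theorem ext_block (D : K.IsDiscrete lam) {φ ψ : H}
    (h : ∀ n, K.block lam n φ = K.block lam n ψ) : φ = ψ :=
  (D.hasSum_block φ).unique (by simpa only [h] using D.hasSum_block ψ)

theorem hasSum_inner (D : K.IsDiscrete lam) (φ ψ : H) :
    HasSum (fun n => ⟪K.block lam n φ, K.block lam n ψ⟫_ℂ) ⟪φ, ψ⟫_ℂ := by
  have h := (D.hasSum_block ψ).mapL (innerSL ℂ φ)
  have e : (fun n => ⟪K.block lam n φ, K.block lam n ψ⟫_ℂ) =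
      fun n => innerSL ℂ φ (K.block lam n ψ) := by
    ext n
    rw [K.block_symm, K.block_block_self, innerSL_apply_apply]
  rw [e]
  exact h

theorem hasSum_norm_sq (D : K.IsDiscrete lam) (ψ : H) :
    HasSum (fun n => ‖K.block lam n ψ‖ ^ 2) (‖ψ‖ ^ 2) := by
  have h := Complex.hasSum_re (D.hasSum_inner ψ ψ)
  have e : ∀ v : H, ‖v‖ ^ 2 = (⟪v, v⟫_ℂ).re := fun v => (inner_self_eq_norm_sq (𝕜 := ℂ) v).symm
  simpa only [e] using h

theorem norm_le_of_block (D : K.IsDiscrete lam) {φ ψ : H} {C : ℝ} (hC : 0 ≤ C)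
    (h : ∀ n, ‖K.block lam n φ‖ ≤ C * ‖K.block lam n ψ‖) : ‖φ‖ ≤ C * ‖ψ‖ := by
  have h2 : ‖φ‖ ^ 2 ≤ (C * ‖ψ‖) ^ 2 := by
    rw [mul_pow]
    refine hasSum_le (fun n => ?_) (D.hasSum_norm_sq φ) ((D.hasSum_norm_sq ψ).mul_left (C ^ 2))
    rw [← mul_pow]
    exact pow_le_pow_left₀ (norm_nonneg _) (h n) 2
  exact le_of_sq_le_sq h2 (by positivity)

theorem block_func (g : ℝ → ℂ) (ψ : (K.func g).domain) (n : ℕ) :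
    K.block lam n (K.func g ψ) = g (ev lam n) • K.block lam n (ψ : H) :=
  K.proj_tsum g ψ ψ.2 _

/-- Since the eigenspaces are complete, a vector with the prescribed blocks is itself the sum of the
series defining $g(K_0)\psi$. This turns domain questions into the existence of a vector. -/
theorem mem_func_domain_iff (D : K.IsDiscrete lam) (g : ℝ → ℂ) (ψ : H) :
    ψ ∈ (K.func g).domain ↔ ∃ χ, ∀ n, K.block lam n χ = g (ev lam n) • K.block lam n ψ := by
  constructor
  · intro h
    exact ⟨_, block_func g ⟨ψ, h⟩⟩
  · rintro ⟨χ, hχ⟩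
    change Summable fun x : ℝ => g x • K.proj x ψ
    have h0 : ∀ x ∉ Set.range (ev lam), g x • K.proj x ψ = 0 := fun x hx => by
      rw [D.proj_eq_zero hx, smul_zero]
    have h1 : HasSum ((fun x : ℝ => g x • K.proj x ψ) ∘ ev lam) χ := by
      have : ((fun x : ℝ => g x • K.proj x ψ) ∘ ev lam) = fun n => K.block lam n χ :=
        funext fun n => (hχ n).symm
      rw [this]
      exact D.hasSum_block χ
    exact (((ev_injective lam).hasSum_iff h0).1 h1).summable

theorem mem_func_domain_of_le (D : K.IsDiscrete lam) {g h : ℝ → ℂ} {C : ℝ} {ψ : H}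
    (hgh : ∀ n, ‖g (ev lam n)‖ ≤ C * ‖h (ev lam n)‖) (hψ : ψ ∈ (K.func h).domain) :
    ψ ∈ (K.func g).domain := by
  have h1 : Summable fun x : ℝ => ‖h x • K.proj x ψ‖ ^ 2 := (K.summable_iff h ψ).1 hψ
  refine (K.summable_iff g ψ).2 (Summable.of_nonneg_of_le (fun x => by positivity)
    (fun x => ?_) (h1.mul_left (C ^ 2)))
  by_cases hx : x ∈ Set.range (ev lam)
  · obtain ⟨n, rfl⟩ := hx
    rw [norm_smul, norm_smul, ← mul_pow, ← mul_assoc]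
    gcongr
    exact hgh n
  · simp [D.proj_eq_zero hx]

end IsDiscrete

/-- `g` has at most polynomial growth on the spectrum. -/
def Tempered (lam : ℝ) (g : ℝ → ℂ) : Prop :=
  ∃ C m : ℝ, ∀ n, ‖g (ev lam n)‖ ≤ C * ev lam n ^ m

open Classical in
/-- The operator `g(K₀)` on `H^∞` (zero if `g(K₀)` does not preserve `H^∞`). -/
def diag (g : ℝ → ℂ) : Module.End ℂ K.smooth :=
  if h : ∀ ψ : K.smooth, ∃ hd : (ψ : H) ∈ (K.func g).domain, K.func g ⟨ψ, hd⟩ ∈ K.smooth then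
    { toFun := fun ψ => ⟨K.func g ⟨ψ, (h ψ).1⟩, (h ψ).2⟩
      map_add' := fun a b => Subtype.ext <|
        (K.func g).map_add ⟨a, (h a).1⟩ ⟨b, (h b).1⟩
      map_smul' := fun c a => Subtype.ext <| (K.func g).map_smul c ⟨a, (h a).1⟩ }
  else 0

/-- `K₀ ^ r` as an operator from `H^∞` to `H`. -/
def powS (r : ℝ) : K.smooth →ₗ[ℂ] H :=
  (K.pow r).toFun.comp (Submodule.inclusion (iInf_le (fun r : ℝ => (K.pow r).domain) r))

theorem sob_eq (r : ℝ) (ψ : K.smooth) : K.sob r ψ = ‖K.powS r ψ‖ := rfl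

theorem block_powS (r : ℝ) (ψ : K.smooth) (n : ℕ) :
    K.block lam n (K.powS r ψ) = ((ev lam n ^ r : ℝ) : ℂ) • K.block lam n (ψ : H) :=
  IsDiscrete.block_func _ ⟨(ψ : H), K.mem_pow_domain r ψ⟩ n

namespace IsDiscrete
variable {K}

theorem mem_smooth_iff (D : K.IsDiscrete lam) (ψ : H) : ψ ∈ K.smooth ↔
    ∀ r : ℝ, ∃ χ, ∀ n, K.block lam n χ = ((ev lam n ^ r : ℝ) : ℂ) • K.block lam n ψ := by
  rw [smooth, Submodule.mem_iInf]
  exact forall_congr' fun r => D.mem_func_domain_iff _ ψ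

theorem func_mem_smooth (D : K.IsDiscrete lam) {g : ℝ → ℂ} (hg : Tempered lam g) (ψ : K.smooth) :
    ∃ hd : (ψ : H) ∈ (K.func g).domain, K.func g ⟨ψ, hd⟩ ∈ K.smooth := by
  obtain ⟨C, m, hC⟩ := hg
  have h1 : ∀ r : ℝ, (ψ : H) ∈ (K.func fun x => ((x ^ r : ℝ) : ℂ) * g x).domain := by
    intro r
    refine D.mem_func_domain_of_le (C := C) (fun n => ?_) (K.mem_pow_domain (r + m) ψ)
    have hp := D.ev_pos n
    rw [norm_mul, Complex.norm_real, Complex.norm_real, Real.norm_of_nonneg (by positivity),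
      Real.norm_of_nonneg (by positivity), Real.rpow_add hp]
    calc _ ≤ ev lam n ^ r * (C * ev lam n ^ m) := by gcongr; exact hC n
      _ = _ := by ring
  have h0 : (ψ : H) ∈ (K.func g).domain :=
    D.mem_func_domain_of_le (C := 1) (fun n => by simp) (h1 0)
  refine ⟨h0, (D.mem_smooth_iff _).2 fun r =>
    ⟨K.func (fun x => ((x ^ r : ℝ) : ℂ) * g x) ⟨ψ, h1 r⟩, fun n => ?_⟩⟩
  rw [block_func, block_func, smul_smul]

theorem block_diag (D : K.IsDiscrete lam) {g : ℝ → ℂ} (hg : Tempered lam g) (ψ : K.smooth)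
    (n : ℕ) : K.block lam n (K.diag g ψ : H) = g (ev lam n) • K.block lam n (ψ : H) := by
  have h : ∀ ψ : K.smooth, ∃ hd : (ψ : H) ∈ (K.func g).domain, K.func g ⟨ψ, hd⟩ ∈ K.smooth :=
    D.func_mem_smooth hg
  have e : (K.diag g ψ : H) = K.func g ⟨ψ, (h ψ).1⟩ := by
    simp only [diag, dif_pos h]
    rfl
  rw [e, block_func]

theorem ext_smooth (D : K.IsDiscrete lam) {φ ψ : K.smooth}
    (h : ∀ n, K.block lam n (φ : H) = K.block lam n (ψ : H)) : φ = ψ :=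
  Subtype.ext (D.ext_block h)

theorem tempered_rpow (D : K.IsDiscrete lam) (r : ℝ) :
    Tempered lam fun x => ((x ^ r : ℝ) : ℂ) :=
  ⟨1, r, fun n => by
    have := D.ev_pos n
    rw [Complex.norm_real, Real.norm_of_nonneg (by positivity), one_mul]⟩

theorem tempered_of_bounded {g : ℝ → ℂ} {C : ℝ} (h : ∀ n, ‖g (ev lam n)‖ ≤ C) :
    Tempered lam g :=
  ⟨C, 0, fun n => by simpa using h n⟩

theorem tempered_mul (D : K.IsDiscrete lam) {g h : ℝ → ℂ} (hg : Tempered lam g)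
    (hh : Tempered lam h) : Tempered lam fun x => g x * h x := by
  obtain ⟨C, m, hC⟩ := hg
  obtain ⟨C', m', hC'⟩ := hh
  refine ⟨C * C', m + m', fun n => ?_⟩
  have := D.ev_pos n
  rw [norm_mul, Real.rpow_add this]
  calc _ ≤ (C * ev lam n ^ m) * (C' * ev lam n ^ m') :=
        mul_le_mul (hC n) (hC' n) (norm_nonneg _) ((norm_nonneg _).trans (hC n))
    _ = _ := by ring

theorem diag_mul (D : K.IsDiscrete lam) {g h : ℝ → ℂ} (hg : Tempered lam g)
    (hh : Tempered lam h) : K.diag g * K.diag h = K.diag fun x => g x * h x := by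
  ext1 ψ
  refine D.ext_smooth fun n => ?_
  rw [Module.End.mul_apply, D.block_diag hg, D.block_diag hh, D.block_diag (D.tempered_mul hg hh),
    smul_smul]

theorem diag_commute (D : K.IsDiscrete lam) {g h : ℝ → ℂ} (hg : Tempered lam g)
    (hh : Tempered lam h) : Commute (K.diag g) (K.diag h) := by
  rw [commute_iff_eq, D.diag_mul hg hh, D.diag_mul hh hg]
  simp only [mul_comm]

theorem coe_diag_rpow (D : K.IsDiscrete lam) (r : ℝ) (ψ : K.smooth) :
    (K.diag (fun x => ((x ^ r : ℝ) : ℂ)) ψ : H) = K.powS r ψ :=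
  D.ext_block fun n => by rw [D.block_diag (D.tempered_rpow r), block_powS]

theorem powS_zero (D : K.IsDiscrete lam) (ψ : K.smooth) : K.powS 0 ψ = ψ :=
  D.ext_block fun n => by rw [block_powS]; simp

theorem sob_zero (D : K.IsDiscrete lam) (ψ : K.smooth) : K.sob 0 ψ = ‖(ψ : H)‖ := by
  rw [sob_eq, D.powS_zero]

theorem inner_diag (D : K.IsDiscrete lam) {g : ℝ → ℂ} (hg : Tempered lam g) (φ ψ : K.smooth) :
    ⟪(K.diag g φ : H), (ψ : H)⟫_ℂ = ⟪(φ : H), (K.diag (fun x => star (g x)) ψ : H)⟫_ℂ := by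
  have hg' : Tempered lam fun x => star (g x) := by simpa only [Tempered, norm_star] using hg
  refine (D.hasSum_inner _ _).unique ?_
  refine hasSum_of_eq (D.hasSum_inner _ _) fun n => ?_
  rw [D.block_diag hg, D.block_diag hg', inner_smul_left, inner_smul_right]
  rfl

theorem isSymm_diag (D : K.IsDiscrete lam) {g : ℝ → ℝ} (hg : Tempered lam fun x => (g x : ℂ)) :
    K.IsSymm (K.diag fun x => (g x : ℂ)) := by
  intro u v
  rw [D.inner_diag hg]
  simp

theorem inner_powS (D : K.IsDiscrete lam) {a b c d : ℝ} (h : a + b = c + d) (φ ψ : K.smooth) :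
    ⟪K.powS a φ, K.powS b ψ⟫_ℂ = ⟪K.powS c φ, K.powS d ψ⟫_ℂ := by
  refine (D.hasSum_inner _ _).unique ?_
  refine hasSum_of_eq (D.hasSum_inner _ _) fun n => ?_
  have := D.ev_pos n
  simp only [block_powS, inner_smul_left, inner_smul_right, Complex.conj_ofReal, ← mul_assoc,
    ← Complex.ofReal_mul]
  rw [← Real.rpow_add this, ← Real.rpow_add this, add_comm, h, add_comm]

theorem norm_inner_le (D : K.IsDiscrete lam) (r : ℝ) (φ ψ : K.smooth) :
    ‖⟪(φ : H), (ψ : H)⟫_ℂ‖ ≤ K.sob r φ * K.sob (-r) ψ := by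
  have := D.inner_powS (a := 0) (b := 0) (c := r) (d := -r) (by ring) φ ψ
  rw [D.powS_zero, D.powS_zero] at this
  rw [this]
  exact _root_.norm_inner_le_norm _ _

theorem sob_sq_le (D : K.IsDiscrete lam) (r a : ℝ) (ψ : K.smooth) :
    K.sob r ψ ^ 2 ≤ K.sob (r - a) ψ * K.sob (r + a) ψ := by
  have h : ‖⟪K.powS r ψ, K.powS r ψ⟫_ℂ‖ = K.sob r ψ ^ 2 := by
    rw [inner_self_eq_norm_sq_to_K, sob_eq]
    simp
  rw [← h, D.inner_powS (a := r) (b := r) (c := r - a) (d := r + a) (by ring)]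
  exact _root_.norm_inner_le_norm _ _

theorem block_mem_smooth (D : K.IsDiscrete lam) (n : ℕ) (ψ : H) : K.block lam n ψ ∈ K.smooth := by
  refine (D.mem_smooth_iff _).2 fun r =>
    ⟨((ev lam n ^ r : ℝ) : ℂ) • K.block lam n ψ, fun m => ?_⟩
  by_cases h : m = n
  · subst h
    rw [map_smul]
  · rw [map_smul, K.block_block_ne h, smul_zero, smul_zero]

theorem sob_block_of_mem (D : K.IsDiscrete lam) (r : ℝ) (n : ℕ) (ψ : K.smooth)
    (h : K.block lam n (ψ : H) = ψ) : K.sob r ψ = ev lam n ^ r * ‖(ψ : H)‖ := by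
  have : K.powS r ψ = ((ev lam n ^ r : ℝ) : ℂ) • (ψ : H) := by
    refine D.ext_block fun m => ?_
    rw [block_powS, map_smul]
    by_cases hm : m = n
    · rw [hm]
    · rw [← h, K.block_block_ne hm, smul_zero, smul_zero]
  have hp := D.ev_pos n
  rw [sob_eq, this, norm_smul, Complex.norm_real, Real.norm_of_nonneg (by positivity)]

theorem sob_le_of_block (D : K.IsDiscrete lam) {r s C : ℝ} (hC : 0 ≤ C) {φ ψ : K.smooth}
    (h : ∀ n, ev lam n ^ r * ‖K.block lam n (φ : H)‖ ≤
      C * (ev lam n ^ s * ‖K.block lam n (ψ : H)‖)) : K.sob r φ ≤ C * K.sob s ψ := by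
  rw [sob_eq, sob_eq]
  refine D.norm_le_of_block hC fun n => ?_
  have hp := D.ev_pos n
  rw [block_powS, block_powS, norm_smul, norm_smul, Complex.norm_real, Complex.norm_real,
    Real.norm_of_nonneg (by positivity), Real.norm_of_nonneg (by positivity)]
  exact h n

theorem sob_diag_le (D : K.IsDiscrete lam) {g : ℝ → ℂ} {C m : ℝ}
    (hg : ∀ n, ‖g (ev lam n)‖ ≤ C * ev lam n ^ m) (s : ℝ) (ψ : K.smooth) :
    K.sob (s - m) (K.diag g ψ) ≤ C * K.sob s ψ := by
  have hC : 0 ≤ C := by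
    by_contra h
    have h1 := (norm_nonneg _).trans (hg 0)
    have := D.ev_pos 0
    have h2 : 0 < ev lam 0 ^ m := by positivity
    nlinarith
  refine D.sob_le_of_block hC fun n => ?_
  have hp := D.ev_pos n
  rw [D.block_diag ⟨C, m, hg⟩, norm_smul, Real.rpow_sub hp]
  have h2 : 0 < ev lam n ^ m := by positivity
  calc _ ≤ ev lam n ^ s / ev lam n ^ m * ((C * ev lam n ^ m) * ‖K.block lam n (ψ : H)‖) := by
        gcongr; exact hg n
    _ = _ := by field_simp

theorem sob_mono (D : K.IsDiscrete lam) {r s : ℝ} (h : r ≤ s) :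
    ∃ C : ℝ, 0 < C ∧ ∀ ψ : K.smooth, K.sob r ψ ≤ C * K.sob s ψ := by
  have hl := D.pos
  refine ⟨lam ^ (r - s), by positivity, fun ψ => ?_⟩
  refine D.sob_le_of_block (by positivity) fun n => ?_
  have hp := D.ev_pos n
  rw [← mul_assoc]
  gcongr
  have h2 : ev lam n ^ (r - s) ≤ lam ^ (r - s) := by
    refine Real.rpow_le_rpow_of_nonpos hl ?_ (by linarith)
    unfold ev
    have : (0 : ℝ) ≤ n := n.cast_nonneg
    linarith
  calc ev lam n ^ r = ev lam n ^ (r - s) * ev lam n ^ s := by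
        rw [← Real.rpow_add hp]; congr 1; ring
    _ ≤ _ := by gcongr

theorem hasSum_sob_sq (D : K.IsDiscrete lam) (r : ℝ) (ψ : K.smooth) :
    HasSum (fun n => ev lam n ^ (2 * r) * ‖K.block lam n (ψ : H)‖ ^ 2) (K.sob r ψ ^ 2) := by
  rw [sob_eq]
  convert D.hasSum_norm_sq (K.powS r ψ) using 2 with n
  have hp := D.ev_pos n
  rw [block_powS, norm_smul, Complex.norm_real, Real.norm_of_nonneg (by positivity), mul_pow,
    ← Real.rpow_natCast (ev lam n ^ r), ← Real.rpow_mul hp.le]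
  congr 2
  push_cast
  ring

/-- For large eigenvalues $x^{2r}\le\eta x^{2s}$, and the finitely many others are paid for by the
norm of $\mathcal H$. This absorbs every lower order error in the energy estimates. -/
theorem sob_interp (D : K.IsDiscrete lam) {r s : ℝ} (h : r < s) {η : ℝ} (hη : 0 < η) :
    ∃ C : ℝ, 0 < C ∧ ∀ ψ : K.smooth, K.sob r ψ ^ 2 ≤ η * K.sob s ψ ^ 2 + C * ‖(ψ : H)‖ ^ 2 := by
  have hl := D.pos
  have ht : Tendsto (fun n => ev lam n ^ (-(2 * (s - r)))) atTop (𝓝 0) := by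
    refine (tendsto_rpow_neg_atTop (by linarith)).comp ?_
    exact tendsto_atTop_add_const_right _ _ tendsto_natCast_atTop_atTop
  obtain ⟨N, hN⟩ := eventually_atTop.1 (ht.eventually (gt_mem_nhds hη))
  have hpos := fun n => D.ev_pos n
  refine ⟨1 + ∑ n ∈ Finset.range N, ev lam n ^ (2 * r), ?_, fun ψ => ?_⟩
  · have : 0 ≤ ∑ n ∈ Finset.range N, ev lam n ^ (2 * r) :=
      Finset.sum_nonneg fun n _ => (Real.rpow_pos_of_pos (hpos n) _).le
    linarith
  · set C := 1 + ∑ n ∈ Finset.range N, ev lam n ^ (2 * r)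
    refine hasSum_le (fun n => ?_) (D.hasSum_sob_sq r ψ)
      (((D.hasSum_sob_sq s ψ).mul_left η).add ((D.hasSum_norm_sq (ψ : H)).mul_left C))
    have hp := hpos n
    rw [← mul_assoc, ← add_mul]
    gcongr
    have hs : 0 < ev lam n ^ (2 * s) := by positivity
    by_cases hn : n < N
    · have h1 : ev lam n ^ (2 * r) ≤ ∑ n ∈ Finset.range N, ev lam n ^ (2 * r) :=
        Finset.single_le_sum (f := fun n => ev lam n ^ (2 * r))
          (fun n _ => (Real.rpow_pos_of_pos (hpos n) _).le) (Finset.mem_range.2 hn)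
      have : 0 ≤ η * ev lam n ^ (2 * s) := by positivity
      simp only [C]
      linarith
    · have h1 := hN n (not_lt.1 hn)
      have h2 : ev lam n ^ (2 * r) = ev lam n ^ (-(2 * (s - r))) * ev lam n ^ (2 * s) := by
        rw [← Real.rpow_add hp]; congr 1; ring
      have h3 : 0 ≤ ∑ n ∈ Finset.range N, ev lam n ^ (2 * r) :=
        Finset.sum_nonneg fun n _ => (Real.rpow_pos_of_pos (hpos n) _).le
      rw [h2]
      have h4 := mul_le_mul_of_nonneg_right h1.le hs.le
      simp only [C]
      linarith

end IsDiscrete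
end ReferenceOperator
end SobolevGrowth
end

noncomputable section
namespace SobolevGrowth

/-! ## Formal normal forms in a filtered differential algebra -/

section Formal

variable {B : Type*} [Ring B] [Algebra ℂ B]

/-- The commutator `Y ↦ X Y - Y X` as a linear map. -/
def cd (X : B) : Module.End ℂ B := LinearMap.mulLeft ℂ X - LinearMap.mulRight ℂ X

theorem cd_apply (X Y : B) : cd X Y = X * Y - Y * X := rfl

theorem cd_add (X Y : B) : cd (X + Y) = cd X + cd Y := by
  ext A; simp only [cd_apply, LinearMap.add_apply]; noncomm_ring

theorem cd_smul (c : ℂ) (X : B) : cd (c • X) = c • cd X := by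
  ext A; simp [cd_apply, smul_sub]

theorem cd_zero : cd (0 : B) = 0 := by
  ext A; simp [cd_apply]

theorem cd_sum {ι : Type*} (s : Finset ι) (f : ι → B) : cd (∑ i ∈ s, f i) = ∑ i ∈ s, cd (f i) := by
  induction s using Finset.cons_induction with
  | empty => simp [cd_zero]
  | cons a s ha ih => rw [Finset.sum_cons, Finset.sum_cons, cd_add, ih]

theorem cd_cd (X Y : B) : cd (cd X) (cd Y) = cd (cd X Y) := by
  ext A
  simp only [cd_apply, LinearMap.sub_apply, Module.End.mul_apply]
  noncomm_ring

theorem cd_of_commute {X Y : B} (h : Commute X Y) : cd X Y = 0 := by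
  rw [cd_apply, h.eq, sub_self]

/-- Noncommutative binomial formula for the right multiplication by powers. -/
theorem mul_pow_eq_sum_antidiagonal (x d : B) (n : ℕ) :
    d * x ^ n = ∑ p ∈ Finset.HasAntidiagonal.antidiagonal n, n.choose p.1 • (x ^ p.1 * ((((-1 : ℂ) • cd x) ^ p.2) d)) := by
  have hc : Commute (LinearMap.mulLeft ℂ x) ((-1 : ℂ) • cd x) := by
    rw [commute_iff_eq]
    ext A
    simp only [Module.End.mul_apply, LinearMap.smul_apply, LinearMap.mulLeft_apply, cd_apply,
      neg_one_smul]
    noncomm_ring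
  have h := congrArg (fun T : Module.End ℂ B => T d) (hc.add_pow' n)
  have e : LinearMap.mulLeft ℂ x + (-1 : ℂ) • cd x = LinearMap.mulRight ℂ x := by
    ext A
    simp [cd_apply]
  simp only [e, LinearMap.pow_mulRight, LinearMap.mulRight_apply] at h
  rw [h, LinearMap.sum_apply]
  refine Finset.sum_congr rfl fun p _ => ?_
  rw [LinearMap.smul_apply, Module.End.mul_apply, LinearMap.pow_mulLeft, LinearMap.mulLeft_apply]

/-- The coefficient `zⁿ / n!` of the exponential series. -/
def expCoeff (z : ℂ) (n : ℕ) : ℂ := z ^ n / n.factorial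

/-- The truncated exponential `∑_{n < J} zⁿ xⁿ / n!`. -/
def expTrunc (J : ℕ) (z : ℂ) (x : B) : B := ∑ n ∈ Finset.range J, expCoeff z n • x ^ n

/-- Conjugation of `d` by a truncated exponential. -/
theorem expTrunc_conj (J : ℕ) (z : ℂ) (x d : B) :
    expTrunc J (-z) x * (∑ k ∈ Finset.range J, expCoeff z k • (cd x ^ k) d) -
      d * expTrunc J (-z) x =
    ∑ p ∈ (Finset.range J ×ˢ Finset.range J).filter (fun p => ¬ p.1 + p.2 < J),
      (expCoeff (-z) p.1 * expCoeff z p.2) • (x ^ p.1 * (cd x ^ p.2) d) := by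
  set t : ℕ × ℕ → B := fun p =>
    (expCoeff (-z) p.1 * expCoeff z p.2) • (x ^ p.1 * (cd x ^ p.2) d) with ht
  have h1 : expTrunc J (-z) x * (∑ k ∈ Finset.range J, expCoeff z k • (cd x ^ k) d) =
      ∑ p ∈ Finset.range J ×ˢ Finset.range J, t p := by
    rw [expTrunc, Finset.sum_mul_sum, Finset.sum_product]
    refine Finset.sum_congr rfl fun j _ => Finset.sum_congr rfl fun k _ => ?_
    rw [smul_mul_smul_comm]
  -- The binomial formula, which moves $d$ to the right of $x^n$, reproduces exactly the products of
  -- total degree $n$; only total degree at least $J$ survives in the difference.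
  have h2 : d * expTrunc J (-z) x =
      ∑ p ∈ (Finset.range J ×ˢ Finset.range J).filter (fun p => p.1 + p.2 < J), t p := by
    rw [← Finset.sum_fiberwise_of_maps_to (t := Finset.range J) (g := fun p : ℕ × ℕ => p.1 + p.2)
      (fun p hp => Finset.mem_range.2 (Finset.mem_filter.1 hp).2), expTrunc, Finset.mul_sum]
    refine Finset.sum_congr rfl fun n hn => ?_
    have hs : ((Finset.range J ×ˢ Finset.range J).filter (fun p => p.1 + p.2 < J)).filter
        (fun p => p.1 + p.2 = n) = Finset.HasAntidiagonal.antidiagonal n := by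
      ext p
      have := Finset.mem_range.1 hn
      simp only [Finset.mem_filter, Finset.mem_product, Finset.mem_range,
        Finset.HasAntidiagonal.mem_antidiagonal]
      omega
    rw [hs, mul_smul_comm, mul_pow_eq_sum_antidiagonal, Finset.smul_sum]
    refine Finset.sum_congr rfl fun p hp => ?_
    have hpn := Finset.HasAntidiagonal.mem_antidiagonal.1 hp
    rw [smul_pow, LinearMap.smul_apply, mul_smul_comm, ← Nat.cast_smul_eq_nsmul ℂ, smul_smul, smul_smul, ht]
    congr 1
    have hf : (n.factorial : ℂ) ≠ 0 := by exact_mod_cast n.factorial_ne_zero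
    have hf1 : (p.1.factorial : ℂ) ≠ 0 := by exact_mod_cast p.1.factorial_ne_zero
    have hf2 : (p.2.factorial : ℂ) ≠ 0 := by exact_mod_cast p.2.factorial_ne_zero
    have hch : (n.choose p.1 : ℂ) * p.1.factorial * p.2.factorial = n.factorial := by
      have := Nat.choose_mul_factorial_mul_factorial (show p.1 ≤ n by omega)
      rw [show n - p.1 = p.2 by omega] at this
      exact_mod_cast this
    simp only [expCoeff]
    rw [← hch, ← hpn, pow_add, neg_pow z p.1, neg_pow z p.2]
    have h2 : ((-1 : ℂ) ^ p.2) * (-1) ^ p.2 = 1 := by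
      rw [← mul_pow]; simp
    have hc0 : (n.choose p.1 : ℂ) ≠ 0 := fun h0 => hf (by rw [← hch, h0]; simp)
    rw [hpn]
    field_simp
    linear_combination (z ^ p.1 * z ^ p.2) * h2
  rw [h1, h2, sub_eq_iff_eq_add, add_comm, Finset.sum_filter_add_sum_filter_not]

/-- A filtration by order on a differential algebra whose commutators gain one order. -/
structure IsOrderFiltration (F : ℝ → Submodule ℂ B) (der : Module.End ℂ B) : Prop where
  mono : ∀ ⦃a b : ℝ⦄, a ≤ b → F a ≤ F b
  commutator : ∀ {a b : ℝ} {X Y : B}, X ∈ F a → Y ∈ F b → cd X Y ∈ F (a + b - 1)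
  der_mem : ∀ {a : ℝ} {X : B}, X ∈ F a → der X ∈ F a
  leibniz : ∀ X Y : B, der (X * Y) = der X * Y + X * der Y

/-- The Heisenberg derivative `A ↦ ∂A + i [G, A]`. -/
def heis (der : Module.End ℂ B) (G : B) : Module.End ℂ B := der + Complex.I • cd G

namespace IsOrderFiltration

variable {F : ℝ → Submodule ℂ B} {der : Module.End ℂ B}

theorem cd_der (hF : IsOrderFiltration F der) (X : B) : cd (cd X) der = -cd (der X) := by
  ext A
  simp only [cd_apply, LinearMap.sub_apply, Module.End.mul_apply, LinearMap.neg_apply, map_sub,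
    hF.leibniz]
  noncomm_ring

/-- The commutator of an inner derivation with a Heisenberg derivation is inner again: the Leibniz
rule turns $[\mathrm{ad}\,X,\partial]$ into $-\mathrm{ad}(\partial X)$, and the Jacobi identity
treats the other term. -/
theorem cd_heis (hF : IsOrderFiltration F der) (X G : B) :
    cd (cd X) (heis der G) = Complex.I • cd (cd X G + Complex.I • der X) := by
  rw [heis, map_add, map_smul, hF.cd_der, cd_cd, cd_add, cd_smul, smul_add, smul_smul,
    Complex.I_mul_I, neg_one_smul]
  abel

theorem cd_pow_heis (hF : IsOrderFiltration F der) (X G : B) (k : ℕ) :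
    ((cd (cd X)) ^ (k + 1)) (heis der G) =
      Complex.I • cd ((cd X ^ k) (cd X G + Complex.I • der X)) := by
  induction k with
  | zero => simpa using hF.cd_heis X G
  | succ k ih => rw [pow_succ', Module.End.mul_apply, ih, map_smul, cd_cd, pow_succ' (cd X),
      Module.End.mul_apply]

/-- This is the gauge transformation law: conjugating the Heisenberg derivative by
$e^{i\,\mathrm{ad}X}$ yields the Heisenberg derivative of a new generator, $G+i[X,G]-\partial
X+\cdots$. The truncated series satisfies it exactly. -/
theorem heis_gauge (hF : IsOrderFiltration F der) (X G : B) (J : ℕ) :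
    ∑ k ∈ Finset.range (J + 1), expCoeff Complex.I k • ((cd (cd X)) ^ k) (heis der G) =
      heis der (G + ∑ i ∈ Finset.range J,
        expCoeff Complex.I (i + 1) • (cd X ^ i) (cd X G + Complex.I • der X)) := by
  rw [Finset.sum_range_succ']
  have h0 : expCoeff Complex.I 0 • ((cd (cd X)) ^ 0) (heis der G) = heis der G := by
    simp [expCoeff]
  rw [h0]
  have e : ∀ Z : B, heis der (G + Z) = Complex.I • cd Z + heis der G := fun Z => by
    rw [heis, heis, cd_add, smul_add]
    abel
  rw [e, cd_sum, Finset.smul_sum]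
  congr 1
  refine Finset.sum_congr rfl fun k _ => ?_
  rw [hF.cd_pow_heis, cd_smul, smul_comm]

theorem cd_pow_mem (hF : IsOrderFiltration F der) {X : B} {η δ : ℝ} (hX : X ∈ F η)
    (hη : η ≤ 1 - δ) {a : ℝ} {A : B} (hA : A ∈ F a) (k : ℕ) :
    (cd X ^ k) A ∈ F (a - k * δ) := by
  induction k with
  | zero => simpa using hA
  | succ k ih =>
    rw [pow_succ', Module.End.mul_apply]
    refine hF.mono ?_ (hF.commutator hX ih)
    push_cast
    linarith

/-- Averaging by successive approximate conjugations: an element commuting with `H₀` extends to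
an approximately invariant element for the perturbed dynamics. -/
theorem exists_approx_invariant (hF : IsOrderFiltration F der) {μ ρ δ p N : ℝ} {H₀ P : B}
    (hδ : 0 < δ) (hδμ : δ ≤ μ - 1) (hδρ : δ ≤ μ - ρ)
    (hH₀ : H₀ ∈ F μ) (hP : P ∈ F p) (hPH : Commute H₀ P) (hPder : der P = 0)
    (hsolve : ∀ w W, W ∈ F w → ∃ X ∈ F (w - μ + 1), ∃ Z ∈ F w, Commute Z P ∧
      Complex.I • cd X H₀ + W - Z ∈ F (w - δ)) (n : ℕ) :
    ∀ w : ℝ, w ≤ ρ → w + p - 1 ≤ N + n * δ → ∀ Z ∈ F ρ, Commute Z P → ∀ W ∈ F w,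
      ∃ A ∈ F p, A - P ∈ F (p - δ) ∧ heis der (H₀ + Z + W) A ∈ F N := by
  induction n with
  | zero =>
    intro w _ hw Z _ hZP W hW
    -- No normal form step is left: $P$ commutes with $H_0$ and $Z$ and is time independent, so only
    -- $i[W,P]$ of order $w+p-1\le N$ remains.
    refine ⟨P, hP, by rw [sub_self]; exact Submodule.zero_mem _, ?_⟩
    have : heis der (H₀ + Z + W) P = Complex.I • cd W P := by
      rw [heis, LinearMap.add_apply, hPder, zero_add, LinearMap.smul_apply, cd_add, cd_add,
        LinearMap.add_apply, LinearMap.add_apply, cd_of_commute hPH, cd_of_commute hZP, zero_add,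
        zero_add]
    rw [this]
    exact Submodule.smul_mem _ _ (hF.mono (by simpa using hw) (hF.commutator hW hP))
  | succ n ih =>
    intro w hwρ hw Z hZ hZP W hW
    obtain ⟨X, hX, Z₁, hZ₁, hZ₁P, hXZ⟩ := hsolve w W hW
    -- Because $w\le\rho\le\mu-\delta$, each commutator with $X$ lowers the order by at least
    -- $\delta$.
    have hη : w - μ + 1 ≤ 1 - δ := by linarith
    set G := H₀ + Z + W with hG
    set Y := cd X G + Complex.I • der X with hY
    have hYW : Y - cd X H₀ ∈ F (w - δ) := by
      have : Y - cd X H₀ = cd X Z + cd X W + Complex.I • der X := by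
        rw [hY, hG, map_add, map_add]; abel
      rw [this]
      refine Submodule.add_mem _ (Submodule.add_mem _ ?_ ?_) (Submodule.smul_mem _ _ ?_)
      · exact hF.mono (by linarith) (hF.commutator hX hZ)
      · exact hF.mono (by linarith) (hF.commutator hX hW)
      · exact hF.mono (by linarith) (hF.der_mem hX)
    have hY' : Y ∈ F w := by
      have h1 : cd X H₀ ∈ F w := hF.mono (by linarith) (hF.commutator hX hH₀)
      have := Submodule.add_mem _ (hF.mono (by linarith : w - δ ≤ w) hYW) h1
      rwa [sub_add_cancel] at this
    -- So many commutators with $X$ push the truncation error of the exponentials down to order $N$.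
    obtain ⟨J, hJ⟩ : ∃ J : ℕ, p + w - N ≤ J * δ := by
      obtain ⟨J, hJ⟩ := exists_nat_ge ((p + w - N) / δ)
      exact ⟨J, (div_le_iff₀ hδ).1 hJ⟩
    set G' := G + ∑ i ∈ Finset.range (J + 1), expCoeff Complex.I (i + 1) • (cd X ^ i) Y with hG'
    -- The linear term $i[X,H_0]$ cancels $W$ up to $Z_1$ and a gain of $\delta$. What else occurs
    -- is $[X,Z+W]$, $\partial X$ or an iterated commutator, all of order at most $w-\delta$.
    have hW' : G' - (H₀ + (Z + Z₁)) ∈ F (w - δ) := by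
      have : G' - (H₀ + (Z + Z₁)) = (Complex.I • cd X H₀ + W - Z₁) + Complex.I • (Y - cd X H₀) +
          ∑ i ∈ Finset.range J, expCoeff Complex.I (i + 2) • (cd X ^ (i + 1)) Y := by
        rw [hG', Finset.sum_range_succ']
        have : expCoeff Complex.I (0 + 1) • (cd X ^ 0) Y = Complex.I • Y := by
          simp [expCoeff]
        rw [this, hG, smul_sub]
        simp only [add_assoc, one_add_one_eq_two]
        abel
      rw [this]
      refine Submodule.add_mem _ (Submodule.add_mem _ hXZ (Submodule.smul_mem _ _ hYW))
        (Submodule.sum_mem _ fun i _ => Submodule.smul_mem _ _ ?_)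
      refine hF.mono ?_ (hF.cd_pow_mem hX hη hY' (i + 1))
      push_cast
      nlinarith [(i.cast_nonneg : (0 : ℝ) ≤ i)]
    obtain ⟨A', hA', hA'P, hA'N⟩ := ih (w - δ) (by linarith) (by push_cast at hw; linarith)
      (Z + Z₁) (Submodule.add_mem _ hZ (hF.mono hwρ hZ₁)) (hZP.add_left hZ₁P) _ hW'
    have eG : H₀ + (Z + Z₁) + (G' - (H₀ + (Z + Z₁))) = G' := by abel
    rw [eG] at hA'N
    -- The approximate invariant of the transformed dynamics is pulled back by
    -- $e^{-i\,\mathrm{ad}X}$.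
    refine ⟨expTrunc (J + 2) (-Complex.I) (cd X) A', ?_, ?_, ?_⟩
    · rw [expTrunc, LinearMap.sum_apply]
      refine Submodule.sum_mem _ fun k _ => Submodule.smul_mem _ _ ?_
      refine hF.mono ?_ (hF.cd_pow_mem hX hη hA' k)
      have : 0 ≤ k * δ := by positivity
      linarith
    · have : expTrunc (J + 2) (-Complex.I) (cd X) A' - P = (A' - P) +
          ∑ k ∈ Finset.range (J + 1), expCoeff (-Complex.I) (k + 1) • (cd X ^ (k + 1)) A' := by
        rw [expTrunc, LinearMap.sum_apply, Finset.sum_range_succ']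
        simp only [LinearMap.smul_apply]
        have : expCoeff (-Complex.I) 0 • (cd X ^ 0) A' = A' := by simp [expCoeff]
        rw [this]
        abel
      rw [this]
      refine Submodule.add_mem _ hA'P (Submodule.sum_mem _ fun k _ => Submodule.smul_mem _ _ ?_)
      refine hF.mono ?_ (hF.cd_pow_mem hX hη hA' (k + 1))
      push_cast
      nlinarith [(k.cast_nonneg : (0 : ℝ) ≤ k)]
    · have hconj := congrArg (fun T : Module.End ℂ B => T A')
        (expTrunc_conj (J + 2) Complex.I (cd X) (heis der G))
      rw [hF.heis_gauge X G (J + 1), ← hY, ← hG'] at hconj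
      simp only [LinearMap.sub_apply, Module.End.mul_apply, LinearMap.sum_apply,
        LinearMap.smul_apply] at hconj
      rw [sub_eq_iff_eq_add, ← sub_eq_iff_eq_add'] at hconj
      rw [← hconj]
      refine Submodule.sub_mem _ ?_ (Submodule.sum_mem _ fun q hq => Submodule.smul_mem _ _ ?_)
      · rw [expTrunc, LinearMap.sum_apply]
        refine Submodule.sum_mem _ fun k _ => Submodule.smul_mem _ _ ?_
        refine hF.mono ?_ (hF.cd_pow_mem hX hη hA'N k)
        have : 0 ≤ k * δ := by positivity
        linarith
      · simp only [Finset.mem_filter, Finset.mem_product, Finset.mem_range, not_lt] at hq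
        obtain ⟨⟨hq1, hq2⟩, hq3⟩ := hq
        -- Total degree at least $J+2$ with first exponent at most $J+1$ forces a commutator with
        -- the Heisenberg derivative itself, which is then inner. The term has order
        -- $w+p-1-(q_1+k)\delta$ with $q_1+k\ge J+1$.
        obtain ⟨k, hk⟩ : ∃ k, q.2 = k + 1 := ⟨q.2 - 1, by omega⟩
        rw [hk, hF.cd_pow_heis, LinearMap.smul_apply, map_smul]
        refine Submodule.smul_mem _ _ ?_
        refine hF.mono ?_ (hF.cd_pow_mem hX hη
          (hF.commutator (hF.cd_pow_mem hX hη hY' k) hA') q.1)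
        have h1 : (J : ℝ) + 1 ≤ q.1 + k := by
          have : J + 1 ≤ q.1 + k := by omega
          exact_mod_cast this
        nlinarith

end IsOrderFiltration

end Formal

end SobolevGrowth
end

noncomputable section
namespace SobolevGrowth

/-! ## Smooth bounded functions with values in a seminormed space -/

section SeminormCalculus

variable {E F G : Type*} [AddCommGroup E] [Module ℂ E] [AddCommGroup F] [Module ℂ F]
  [AddCommGroup G] [Module ℂ G]

/-- A linear map that is continuous for families of seminorms. -/
def IsContLin {ι : Type*} (p : ℕ → Seminorm ℂ E) (q : ι → Seminorm ℂ F) (T : E →ₗ[ℂ] F) : Prop :=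
  ∀ j, ∃ (s : Finset ℕ) (C : ℝ), 0 ≤ C ∧ ∀ a, q j (T a) ≤ C * ∑ i ∈ s, p i a

/-- A bilinear map that is continuous for families of seminorms. -/
def IsContBilin (p : ℕ → Seminorm ℂ E) (q : ℕ → Seminorm ℂ F) (r : ℕ → Seminorm ℂ G)
    (T : E →ₗ[ℂ] F →ₗ[ℂ] G) : Prop :=
  ∀ j, ∃ (s s' : Finset ℕ) (C : ℝ), 0 ≤ C ∧
    ∀ a b, r j (T a b) ≤ C * (∑ i ∈ s, p i a) * ∑ i ∈ s', q i b

theorem finset_sup_le_sum' (p : ℕ → Seminorm ℂ E) (s : Finset ℕ) (a : E) :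
    (s.sup p) a ≤ ∑ i ∈ s, p i a := by
  exact Seminorm.finset_sup_apply_le (Finset.sum_nonneg fun _ _ => apply_nonneg _ _)
    fun i hi => Finset.single_le_sum (f := fun i => p i a) (fun _ _ => apply_nonneg _ _) hi

theorem IsContLin.of_sup {p : ℕ → Seminorm ℂ E} {ι : Type*} {q : ι → Seminorm ℂ F} {T : E →ₗ[ℂ] F}
    (h : ∀ j, ∃ (s : Finset ℕ) (C : ℝ), ∀ a, q j (T a) ≤ C * (s.sup p) a) : IsContLin p q T := by
  intro j
  obtain ⟨s, C, hC⟩ := h j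
  refine ⟨s, |C|, abs_nonneg _, fun a => (hC a).trans ?_⟩
  exact mul_le_mul (le_abs_self C) (finset_sup_le_sum' p s a) (apply_nonneg _ _) (abs_nonneg _)

theorem IsContBilin.of_sup {p : ℕ → Seminorm ℂ E} {q : ℕ → Seminorm ℂ F} {r : ℕ → Seminorm ℂ G}
    {T : E →ₗ[ℂ] F →ₗ[ℂ] G}
    (h : ∀ j, ∃ (s s' : Finset ℕ) (C : ℝ), ∀ a b, r j (T a b) ≤ C * (s.sup p) a * (s'.sup q) b) :
    IsContBilin p q r T := by
  intro j
  obtain ⟨s, s', C, hC⟩ := h j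
  refine ⟨s, s', |C|, abs_nonneg _, fun a b => (hC a b).trans ?_⟩
  have h1 := finset_sup_le_sum' p s a
  have h2 := finset_sup_le_sum' q s' b
  have h3 : 0 ≤ (s.sup p) a := apply_nonneg _ _
  have h4 : 0 ≤ (s'.sup q) b := apply_nonneg _ _
  gcongr
  exact le_abs_self C

theorem tendsto_sum_zero {α : Type*} {l : Filter α} (p : ℕ → Seminorm ℂ E) {f : α → E}
    (h : ∀ i, Tendsto (fun x => p i (f x)) l (𝓝 0)) (s : Finset ℕ) :
    Tendsto (fun x => ∑ i ∈ s, p i (f x)) l (𝓝 0) := by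
  simpa using tendsto_finsetSum s fun i _ => h i

/-- `u` has `n` derivatives, all of them continuous and bounded in every seminorm. -/
def CbN (p : ℕ → Seminorm ℂ E) : ℕ → (ℝ → E) → Prop
  | 0, u => IsCb p u
  | n + 1, u => IsCb p u ∧ ∃ v, (∀ t, HasSeminormDerivAt p u (v t) t) ∧ CbN p n v

theorem CbN.isCb {p : ℕ → Seminorm ℂ E} {n : ℕ} {u : ℝ → E} (h : CbN p n u) : IsCb p u := by
  cases n with
  | zero => exact h
  | succ n => exact h.1

theorem IsCbInfty.cbN {p : ℕ → Seminorm ℂ E} {u : ℝ → E} (h : IsCbInfty p u) (n : ℕ) :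
    CbN p n u := by
  obtain ⟨D, hD, hder, hcb⟩ := h
  have : ∀ k, CbN p n (D k) := by
    induction n with
    | zero => exact fun k => hcb k
    | succ n ih => exact fun k => ⟨hcb k, D (k + 1), hder k, ih (k + 1)⟩
  exact hD ▸ this 0

theorem CbN.of_succ {p : ℕ → Seminorm ℂ E} {n : ℕ} {u : ℝ → E} (h : CbN p (n + 1) u) :
    CbN p n u := by
  induction n generalizing u with
  | zero => exact h.1
  | succ n ih =>
    obtain ⟨h1, v, h2, h3⟩ := h
    exact ⟨h1, v, h2, ih h3⟩

theorem IsCb.add {p : ℕ → Seminorm ℂ E} {u v : ℝ → E} (hu : IsCb p u) (hv : IsCb p v) :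
    IsCb p (u + v) := by
  constructor
  · intro i t
    refine squeeze_zero (fun _ => apply_nonneg _ _) (fun t' => ?_)
      (by simpa using (hu.1 i t).add (hv.1 i t))
    have : (u + v) t' - (u + v) t = (u t' - u t) + (v t' - v t) := by simp only [Pi.add_apply]; abel
    rw [this]
    exact map_add_le_add _ _ _
  · intro i
    obtain ⟨C, hC⟩ := hu.2 i
    obtain ⟨C', hC'⟩ := hv.2 i
    exact ⟨C + C', fun t => (map_add_le_add _ _ _).trans (add_le_add (hC t) (hC' t))⟩

theorem HasSeminormDerivAt.add {ι : Type*} {p : ι → Seminorm ℂ E} {u v : ℝ → E} {a b : E} {t : ℝ}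
    (hu : HasSeminormDerivAt p u a t) (hv : HasSeminormDerivAt p v b t) :
    HasSeminormDerivAt p (u + v) (a + b) t := by
  intro i
  refine squeeze_zero (fun _ => apply_nonneg _ _) (fun h => ?_)
    (by simpa using (hu i).add (hv i))
  have : ((h : ℂ)⁻¹) • ((u + v) (t + h) - (u + v) t) - (a + b) =
      (((h : ℂ)⁻¹) • (u (t + h) - u t) - a) + (((h : ℂ)⁻¹) • (v (t + h) - v t) - b) := by
    simp only [Pi.add_apply]; module
  rw [this]
  exact map_add_le_add _ _ _

theorem CbN.add {p : ℕ → Seminorm ℂ E} {n : ℕ} {u v : ℝ → E} (hu : CbN p n u) (hv : CbN p n v) :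
    CbN p n (u + v) := by
  induction n generalizing u v with
  | zero => exact IsCb.add hu hv
  | succ n ih =>
    obtain ⟨h1, u', h2, h3⟩ := hu
    obtain ⟨k1, v', k2, k3⟩ := hv
    exact ⟨h1.add k1, u' + v', fun t => (h2 t).add (k2 t), ih h3 k3⟩

theorem IsCb.map {p : ℕ → Seminorm ℂ E} {ι : Type*} {q : ι → Seminorm ℂ F} {T : E →ₗ[ℂ] F}
    (hT : IsContLin p q T) {u : ℝ → E} (hu : IsCb p u) : IsCb q (fun t => T (u t)) := by
  constructor
  · intro j t
    obtain ⟨s, C, hC, h⟩ := hT j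
    refine squeeze_zero (fun _ => apply_nonneg _ _) (fun t' => ?_)
      (by simpa using (tendsto_sum_zero p (fun i => hu.1 i t) s).const_mul C)
    rw [← map_sub]
    exact h _
  · intro j
    obtain ⟨s, C, hC, h⟩ := hT j
    choose M hM using hu.2
    exact ⟨C * ∑ i ∈ s, M i, fun t => (h _).trans (by gcongr; exact hM _ t)⟩

theorem HasSeminormDerivAt.map {p : ℕ → Seminorm ℂ E} {ι : Type*} {q : ι → Seminorm ℂ F} {T : E →ₗ[ℂ] F}
    (hT : IsContLin p q T) {u : ℝ → E} {v : E} {t : ℝ} (hu : HasSeminormDerivAt p u v t) :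
    HasSeminormDerivAt q (fun t => T (u t)) (T v) t := by
  intro j
  obtain ⟨s, C, hC, h⟩ := hT j
  refine squeeze_zero (fun _ => apply_nonneg _ _) (fun t' => ?_)
    (by simpa using (tendsto_sum_zero p hu s).const_mul C)
  rw [← map_sub, ← map_smul, ← map_sub]
  exact h _

theorem CbN.map {p : ℕ → Seminorm ℂ E} {q : ℕ → Seminorm ℂ F} {T : E →ₗ[ℂ] F}
    (hT : IsContLin p q T) {n : ℕ} {u : ℝ → E} (hu : CbN p n u) :
    CbN q n (fun t => T (u t)) := by
  induction n generalizing u with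
  | zero => exact IsCb.map hT hu
  | succ n ih =>
    obtain ⟨h1, v, h2, h3⟩ := hu
    exact ⟨h1.map hT, fun t => T (v t), fun t => (h2 t).map hT, ih h3⟩

theorem HasSeminormDerivAt.unique {p : ℕ → Seminorm ℂ E} (hp : ∀ a, (∀ j, p j a = 0) → a = 0)
    {u : ℝ → E} {v w : E} {t : ℝ} (hv : HasSeminormDerivAt p u v t)
    (hw : HasSeminormDerivAt p u w t) : v = w := by
  rw [← sub_eq_zero]
  refine hp _ fun j => le_antisymm ?_ (apply_nonneg _ _)
  have := (hw j).add (hv j)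
  rw [add_zero] at this
  refine ge_of_tendsto' this fun h => ?_
  have e : v - w = (((h : ℂ)⁻¹) • (u (t + h) - u t) - w) -
      (((h : ℂ)⁻¹) • (u (t + h) - u t) - v) := by abel
  conv_lhs => rw [e]
  exact map_sub_le_add _ _ _

theorem IsCb.bilin {p : ℕ → Seminorm ℂ E} {q : ℕ → Seminorm ℂ F} {r : ℕ → Seminorm ℂ G}
    {T : E →ₗ[ℂ] F →ₗ[ℂ] G} (hT : IsContBilin p q r T) {u : ℝ → E} {v : ℝ → F}
    (hu : IsCb p u) (hv : IsCb q v) : IsCb r (fun t => T (u t) (v t)) := by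
  choose M hM using hu.2
  choose M' hM' using hv.2
  constructor
  · intro j t
    obtain ⟨s, s', C, hC, h⟩ := hT j
    have l1 := (((tendsto_sum_zero p (fun i => hu.1 i t) s).const_mul C).mul_const
      (∑ i ∈ s', M' i))
    have l2 := ((tendsto_sum_zero q (fun i => hv.1 i t) s').const_mul (C * ∑ i ∈ s, M i))
    refine squeeze_zero (fun _ => apply_nonneg _ _) (fun t' => ?_) (by simpa using l1.add l2)
    have e : T (u t') (v t') - T (u t) (v t) =
        T (u t' - u t) (v t') + T (u t) (v t' - v t) := by
      simp only [map_sub, LinearMap.sub_apply]; abel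
    rw [e]
    refine (map_add_le_add _ _ _).trans (add_le_add ((h _ _).trans ?_) ((h _ _).trans ?_))
    · gcongr with i
      exact hM' _ _
    · gcongr with i
      exact hM _ _
  · intro j
    obtain ⟨s, s', C, hC, h⟩ := hT j
    refine ⟨C * (∑ i ∈ s, M i) * ∑ i ∈ s', M' i, fun t => (h _ _).trans ?_⟩
    have h1 : 0 ≤ ∑ i ∈ s, p i (u t) := Finset.sum_nonneg fun _ _ => apply_nonneg _ _
    have h2 : ∑ i ∈ s, p i (u t) ≤ ∑ i ∈ s, M i := Finset.sum_le_sum fun i _ => hM i t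
    have h3 : ∑ i ∈ s', q i (v t) ≤ ∑ i ∈ s', M' i := Finset.sum_le_sum fun i _ => hM' i t
    have h4 : 0 ≤ ∑ i ∈ s', q i (v t) := Finset.sum_nonneg fun _ _ => apply_nonneg _ _
    have h5 := h1.trans h2
    gcongr

theorem HasSeminormDerivAt.bilin {p : ℕ → Seminorm ℂ E} {q : ℕ → Seminorm ℂ F}
    {r : ℕ → Seminorm ℂ G} {T : E →ₗ[ℂ] F →ₗ[ℂ] G} (hT : IsContBilin p q r T) {u : ℝ → E}
    {v : ℝ → F} (hv : IsCb q v) {u' : E} {v' : F} {t : ℝ}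
    (hu' : HasSeminormDerivAt p u u' t) (hv' : HasSeminormDerivAt q v v' t) :
    HasSeminormDerivAt r (fun t => T (u t) (v t)) (T u' (v t) + T (u t) v') t := by
  intro j
  obtain ⟨s, s', C, hC, h⟩ := hT j
  choose M' hM' using hv.2
  have hcont : ∀ i, Tendsto (fun h : ℝ => q i (v (t + h) - v t)) (𝓝[≠] 0) (𝓝 0) := by
    intro i
    have := (hv.1 i t).comp (f := fun h : ℝ => t + h) (x := 𝓝[≠] 0) (by
      have : Tendsto (fun h : ℝ => t + h) (𝓝 0) (𝓝 (t + 0)) := by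
        exact (continuous_const.add continuous_id).tendsto 0
      rw [add_zero] at this
      exact this.mono_left nhdsWithin_le_nhds)
    exact this
  have l1 := (((tendsto_sum_zero p hu' s).const_mul C).mul_const (∑ i ∈ s', M' i))
  have l2 := ((tendsto_sum_zero q hcont s').const_mul (C * ∑ i ∈ s, p i u'))
  have l3 := ((tendsto_sum_zero q hv' s').const_mul (C * ∑ i ∈ s, p i (u t)))
  refine squeeze_zero (fun _ => apply_nonneg _ _) (fun k => ?_)
    (by simpa using (l1.add l2).add l3)
  have e : ((k : ℂ)⁻¹) • (T (u (t + k)) (v (t + k)) - T (u t) (v t)) -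
      (T u' (v t) + T (u t) v') =
      T (((k : ℂ)⁻¹) • (u (t + k) - u t) - u') (v (t + k)) + T u' (v (t + k) - v t) +
        T (u t) (((k : ℂ)⁻¹) • (v (t + k) - v t) - v') := by
    simp only [map_sub, map_smul, LinearMap.sub_apply, LinearMap.smul_apply]; module
  rw [e]
  refine (map_add_le_add _ _ _).trans (add_le_add ((map_add_le_add _ _ _).trans
    (add_le_add ((h _ _).trans ?_) (h _ _))) (h _ _))
  gcongr with i
  exact hM' _ _

theorem CbN.bilin {p : ℕ → Seminorm ℂ E} {q : ℕ → Seminorm ℂ F} {r : ℕ → Seminorm ℂ G}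
    {T : E →ₗ[ℂ] F →ₗ[ℂ] G} (hT : IsContBilin p q r T) {n : ℕ} {u : ℝ → E} {v : ℝ → F}
    (hu : CbN p n u) (hv : CbN q n v) : CbN r n (fun t => T (u t) (v t)) := by
  induction n generalizing u v with
  | zero => exact IsCb.bilin hT hu hv
  | succ n ih =>
    have hu0 := hu.of_succ
    have hv0 := hv.of_succ
    obtain ⟨h1, u', h2, h3⟩ := hu
    obtain ⟨k1, v', k2, k3⟩ := hv
    exact ⟨h1.bilin hT k1, fun t => T (u' t) (v t) + T (u t) (v' t),
      fun t => (h2 t).bilin hT k1 (k2 t), (ih h3 hv0).add (ih hu0 k3)⟩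

theorem CbN.const {p : ℕ → Seminorm ℂ E} (n : ℕ) (a : E) : CbN p n fun _ => a := by
  have h0 : ∀ a : E, IsCb p fun _ => a := fun a =>
    ⟨fun i t => by simp, fun i => ⟨p i a, fun _ => le_rfl⟩⟩
  induction n generalizing a with
  | zero => exact h0 a
  | succ n ih => exact ⟨h0 a, fun _ => 0, fun t i => by simp, ih 0⟩

end SeminormCalculus

end SobolevGrowth
end

noncomputable section
namespace SobolevGrowth
variable {H : Type*} [NormedAddCommGroup H] [InnerProductSpace ℂ H] [CompleteSpace H]

/-! ## The differential algebra of time dependent operators -/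

open ReferenceOperator

variable {K : ReferenceOperator H} {lam : ℝ} {𝒜 : OperatorClasses K}

theorem hasSeminormDerivAt_sob_iff {u : ℝ → K.smooth} {v : K.smooth} {t : ℝ} :
    HasSeminormDerivAt K.sob u v t ↔
      ∀ r, HasDerivAt (fun t => K.powS r (u t)) (K.powS r v) t := by
  refine forall_congr' fun r => ?_
  rw [hasDerivAt_iff_tendsto_slope_zero,
    tendsto_iff_norm_sub_tendsto_zero (b := K.powS r v)]
  have e : ∀ h : ℝ, K.sob r (((h : ℂ)⁻¹) • (u (t + h) - u t) - v) =
      ‖h⁻¹ • (K.powS r (u (t + h)) - K.powS r (u t)) - K.powS r v‖ := by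
    intro h
    rw [sob_eq, map_sub, map_smul, map_sub, ← Complex.ofReal_inv, Complex.coe_smul]
  simp only [e]

theorem hasSeminormDerivAt_sob_unique (D : K.IsDiscrete lam) {u : ℝ → K.smooth}
    {v w : K.smooth} {t : ℝ} (hv : HasSeminormDerivAt K.sob u v t)
    (hw : HasSeminormDerivAt K.sob u w t) : v = w := by
  have := ((hasSeminormDerivAt_sob_iff.1 hv) 0).unique ((hasSeminormDerivAt_sob_iff.1 hw) 0)
  rw [D.powS_zero, D.powS_zero] at this
  exact Subtype.ext this

/-- `W'` is the strong derivative of the operator valued function `W` on `H^∞`. -/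
def IsStrongDeriv (W W' : ℝ → Module.End ℂ K.smooth) : Prop :=
  ∀ ψ t, HasSeminormDerivAt K.sob (fun t => W t ψ) (W' t ψ) t

theorem IsStrongDeriv.unique (D : K.IsDiscrete lam) {W W' W'' : ℝ → Module.End ℂ K.smooth}
    (h : IsStrongDeriv W W') (h' : IsStrongDeriv W W'') : W' = W'' := by
  ext1 t
  ext1 ψ
  exact hasSeminormDerivAt_sob_unique D (h ψ t) (h' ψ t)

/-- Bounded smooth functions of time with values in `cls m`. -/
def timeClass (𝒜 : OperatorClasses K) (m : ℝ) : Submodule ℂ (ℝ → Module.End ℂ K.smooth) where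
  carrier := {W | ∃ u : ℝ → 𝒜.cls m, (∀ t, W t = u t) ∧ ∀ n, CbN (𝒜.semi m) n u}
  add_mem' := by
    rintro W W' ⟨u, hu, hu'⟩ ⟨v, hv, hv'⟩
    exact ⟨u + v, fun t => by simp [hu, hv], fun n => (hu' n).add (hv' n)⟩
  zero_mem' := ⟨fun _ => 0, fun t => rfl, fun n => CbN.const n 0⟩
  smul_mem' := by
    rintro c W ⟨u, hu, hu'⟩
    refine ⟨fun t => c • u t, fun t => by simp [hu], fun n => ?_⟩
    refine (hu' n).map (F := 𝒜.cls m) (q := 𝒜.semi m) (T := c • LinearMap.id) fun j => ⟨{j}, ‖c‖, norm_nonneg _, ?_⟩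
    intro a
    simp [map_smul_eq_mul]

/-- Evaluation of operators at a vector of `H^∞`. -/
def evalAt (𝒜 : OperatorClasses K) (m : ℝ) (ψ : K.smooth) : 𝒜.cls m →ₗ[ℂ] K.smooth :=
  (LinearMap.applyₗ ψ).comp (𝒜.cls m).subtype

namespace IsGradedAlgebra

theorem isContLin_evalAt (hI : IsGradedAlgebra 𝒜) (m : ℝ) (ψ : K.smooth) :
    IsContLin (𝒜.semi m) K.sob (evalAt 𝒜 m ψ) := by
  refine IsContLin.of_sup fun s => ?_
  obtain ⟨F, C, h⟩ := hI.embedding_continuous m (s + m)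
  refine ⟨F, C * K.sob (s + m) ψ, fun A => ?_⟩
  have := h A ψ
  rw [add_sub_cancel_right] at this
  calc _ ≤ _ := this
    _ = _ := by ring

theorem exists_strongDeriv (hI : IsGradedAlgebra 𝒜) {m : ℝ} {W : ℝ → Module.End ℂ K.smooth}
    (hW : W ∈ timeClass 𝒜 m) : ∃ W' ∈ timeClass 𝒜 m, IsStrongDeriv W W' := by
  obtain ⟨u, hu, hu'⟩ := hW
  have h1 := fun n => (hu' (n + 1)).2
  choose v hv hv' using h1
  -- The derivative is chosen separately for each number of derivatives; uniqueness of limits makes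
  -- all the choices coincide, so one function is smooth to every order.
  have e : ∀ n, v n = v 0 := fun n => funext fun t =>
    HasSeminormDerivAt.unique (hI.isFrechet m).1 (hv n t) (hv 0 t)
  refine ⟨fun t => v 0 t, ⟨v 0, fun t => rfl, fun n => e n ▸ hv' n⟩, fun ψ t => ?_⟩
  have := (hv 0 t).map (hI.isContLin_evalAt m ψ)
  simp only [hu]
  exact this

theorem continuous_apply (hI : IsGradedAlgebra 𝒜) {m : ℝ} {W : ℝ → Module.End ℂ K.smooth}
    (hW : W ∈ timeClass 𝒜 m) (r : ℝ) (ψ : K.smooth) : Continuous fun t => K.powS r (W t ψ) := by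
  obtain ⟨W', -, h⟩ := hI.exists_strongDeriv hW
  exact continuous_iff_continuousAt.2 fun t =>
    (hasSeminormDerivAt_sob_iff.1 (h ψ t) r).continuousAt

theorem exists_bound (hI : IsGradedAlgebra 𝒜) {m : ℝ} {W : ℝ → Module.End ℂ K.smooth}
    (hW : W ∈ timeClass 𝒜 m) (s : ℝ) :
    ∃ C : ℝ, 0 < C ∧ ∀ t ψ, K.sob (s - m) (W t ψ) ≤ C * K.sob s ψ := by
  obtain ⟨u, hu, hu'⟩ := hW
  obtain ⟨F, C, h⟩ := hI.embedding_continuous m s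
  choose M hM using (hu' 0).isCb.2
  refine ⟨|C| * |∑ i ∈ F, M i| + 1, by positivity, fun t ψ => ?_⟩
  rw [hu]
  refine (h (u t) ψ).trans ?_
  have h0 : 0 ≤ K.sob s ψ := apply_nonneg _ _
  refine mul_le_mul_of_nonneg_right ?_ h0
  have h1 := finset_sup_le_sum' (𝒜.semi m) F (u t)
  have h2 : ∑ i ∈ F, 𝒜.semi m i (u t) ≤ ∑ i ∈ F, M i := Finset.sum_le_sum fun i _ => hM i t
  have h3 : 0 ≤ (F.sup (𝒜.semi m)) (u t) := apply_nonneg _ _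
  calc C * (F.sup (𝒜.semi m)) (u t) ≤ |C| * |∑ i ∈ F, M i| :=
        mul_le_mul (le_abs_self _) ((h1.trans h2).trans (le_abs_self _)) h3 (abs_nonneg _)
    _ ≤ _ := by linarith

theorem timeClass_mono (hI : IsGradedAlgebra 𝒜) {a b : ℝ} (h : a ≤ b) :
    timeClass 𝒜 a ≤ timeClass 𝒜 b := by
  rintro W ⟨u, hu, hu'⟩
  refine ⟨fun t => Submodule.inclusion (hI.cls_mono h) (u t), fun t => hu t, fun n => ?_⟩
  exact (hu' n).map (IsContLin.of_sup fun j => hI.cls_mono_continuous h j)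

theorem mul_mem_timeClass (hI : IsGradedAlgebra 𝒜) {a b : ℝ} {X Y : ℝ → Module.End ℂ K.smooth}
    (hX : X ∈ timeClass 𝒜 a) (hY : Y ∈ timeClass 𝒜 b) : X * Y ∈ timeClass 𝒜 (a + b) := by
  obtain ⟨u, hu, hu'⟩ := hX
  obtain ⟨v, hv, hv'⟩ := hY
  let T : 𝒜.cls a →ₗ[ℂ] 𝒜.cls b →ₗ[ℂ] 𝒜.cls (a + b) := LinearMap.mk₂ ℂ
    (fun A B => ⟨(A : Module.End ℂ K.smooth) * B, hI.mul_mem a b A A.2 B B.2⟩)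
    (fun _ _ _ => Subtype.ext (add_mul _ _ _)) (fun _ _ _ => Subtype.ext (smul_mul_assoc _ _ _))
    (fun _ _ _ => Subtype.ext (mul_add _ _ _)) (fun _ _ _ => Subtype.ext (mul_smul_comm _ _ _))
  refine ⟨fun t => T (u t) (v t), fun t => ?_, fun n => ?_⟩
  · rw [Pi.mul_apply, hu, hv]; rfl
  · exact CbN.bilin (IsContBilin.of_sup fun j => hI.mul_continuous a b j) (hu' n) (hv' n)

theorem commutator_mem_timeClass (hI : IsGradedAlgebra 𝒜) {a b : ℝ}
    {X Y : ℝ → Module.End ℂ K.smooth} (hX : X ∈ timeClass 𝒜 a) (hY : Y ∈ timeClass 𝒜 b) :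
    X * Y - Y * X ∈ timeClass 𝒜 (a + b - 1) := by
  obtain ⟨u, hu, hu'⟩ := hX
  obtain ⟨v, hv, hv'⟩ := hY
  let T : 𝒜.cls a →ₗ[ℂ] 𝒜.cls b →ₗ[ℂ] 𝒜.cls (a + b - 1) := LinearMap.mk₂ ℂ
    (fun A B => ⟨(A : Module.End ℂ K.smooth) * B - B * A, hI.commutator_mem a b A A.2 B B.2⟩)
    (fun A A' B => Subtype.ext (by
      simp only [Submodule.coe_add, add_mul, mul_add]; abel))
    (fun c A B => Subtype.ext (by
      simp only [Submodule.coe_smul, smul_mul_assoc, mul_smul_comm, smul_sub]))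
    (fun A A' B => Subtype.ext (by
      simp only [Submodule.coe_add, add_mul, mul_add]; abel))
    (fun c A B => Subtype.ext (by
      simp only [Submodule.coe_smul, smul_mul_assoc, mul_smul_comm, smul_sub]))
  refine ⟨fun t => T (u t) (v t), fun t => ?_, fun n => ?_⟩
  · rw [Pi.sub_apply, Pi.mul_apply, Pi.mul_apply, hu, hv]; rfl
  · exact CbN.bilin (IsContBilin.of_sup fun j => hI.commutator_continuous a b j) (hu' n) (hv' n)

theorem const_mem_timeClass {m : ℝ} {A : Module.End ℂ K.smooth} (hA : A ∈ 𝒜.cls m) :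
    (fun _ : ℝ => A) ∈ timeClass 𝒜 m :=
  ⟨fun _ => ⟨A, hA⟩, fun _ => rfl, fun n => CbN.const n _⟩

theorem diag_rpow_mem (hI : IsGradedAlgebra 𝒜) (D : K.IsDiscrete lam) (m : ℝ) :
    K.diag (fun x => ((x ^ m : ℝ) : ℂ)) ∈ 𝒜.cls m := by
  obtain ⟨B, hB, hB'⟩ := hI.pow_mem m
  have : K.diag (fun x => ((x ^ m : ℝ) : ℂ)) = B := by
    ext1 ψ
    obtain ⟨h, h'⟩ := hB' ψ
    refine Subtype.ext ?_
    rw [D.coe_diag_rpow, ← h']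
    rfl
  rwa [this]

theorem one_mem (hI : IsGradedAlgebra 𝒜) (D : K.IsDiscrete lam) :
    (1 : Module.End ℂ K.smooth) ∈ 𝒜.cls 0 := by
  have := hI.diag_rpow_mem D 0
  have e : K.diag (fun x => ((x ^ (0 : ℝ) : ℝ) : ℂ)) = 1 := by
    ext1 ψ
    refine Subtype.ext ?_
    rw [D.coe_diag_rpow, D.powS_zero]
    rfl
  rwa [e] at this

/-- The algebra of bounded smooth functions of time with values in `⋃ₘ cls m`. -/
def timeAlgebra (hI : IsGradedAlgebra 𝒜) (D : K.IsDiscrete lam) :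
    Subalgebra ℂ (ℝ → Module.End ℂ K.smooth) where
  carrier := {W | ∃ m, W ∈ timeClass 𝒜 m}
  mul_mem' := by
    rintro X Y ⟨a, hX⟩ ⟨b, hY⟩
    exact ⟨a + b, hI.mul_mem_timeClass hX hY⟩
  add_mem' := by
    rintro X Y ⟨a, hX⟩ ⟨b, hY⟩
    exact ⟨max a b, Submodule.add_mem _ (hI.timeClass_mono (le_max_left _ _) hX)
      (hI.timeClass_mono (le_max_right _ _) hY)⟩
  algebraMap_mem' c := ⟨0, by
    have := Submodule.smul_mem _ c (const_mem_timeClass (hI.one_mem D))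
    exact this⟩

/-- The algebra of time dependent operators, as a type. -/
def TimeAlgebra (hI : IsGradedAlgebra 𝒜) (D : K.IsDiscrete lam) : Type _ := hI.timeAlgebra D

variable (hI : IsGradedAlgebra 𝒜) (D : K.IsDiscrete lam)

instance : Ring (hI.TimeAlgebra D) := inferInstanceAs (Ring (hI.timeAlgebra D))

instance : Algebra ℂ (hI.TimeAlgebra D) := inferInstanceAs (Algebra ℂ (hI.timeAlgebra D))

/-- The filtration of the algebra of time dependent operators by the order. -/
def timeFilt (hI : IsGradedAlgebra 𝒜) (D : K.IsDiscrete lam) (m : ℝ) :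
    Submodule ℂ (hI.TimeAlgebra D) :=
  (timeClass 𝒜 m).comap
    ((hI.timeAlgebra D).val.toLinearMap : hI.TimeAlgebra D →ₗ[ℂ] (ℝ → Module.End ℂ K.smooth))

theorem mem_timeFilt {m : ℝ} {X : hI.TimeAlgebra D} :
    X ∈ hI.timeFilt D m ↔ X.1 ∈ timeClass 𝒜 m := Iff.rfl

theorem exists_deriv (X : hI.TimeAlgebra D) :
    ∃ Y : hI.TimeAlgebra D, IsStrongDeriv X.1 Y.1 := by
  obtain ⟨m, hm⟩ := X.2
  obtain ⟨W', hW', h⟩ := hI.exists_strongDeriv hm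
  exact ⟨⟨W', m, hW'⟩, h⟩

/-- The product rule holds in the Fréchet topology because multiplication is continuous; uniqueness
of strong derivatives carries it over to the given ones. -/
theorem strongDeriv_mul (hI : IsGradedAlgebra 𝒜) (D : K.IsDiscrete lam) {a b : ℝ}
    {X Y X' Y' : ℝ → Module.End ℂ K.smooth} (hX : X ∈ timeClass 𝒜 a) (hY : Y ∈ timeClass 𝒜 b)
    (hX' : IsStrongDeriv X X') (hY' : IsStrongDeriv Y Y') :
    IsStrongDeriv (X * Y) (X' * Y + X * Y') := by
  obtain ⟨u, hu, hun⟩ := hX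
  obtain ⟨v, hv, hvn⟩ := hY
  obtain ⟨u', hu', -⟩ := (hun 1).2
  obtain ⟨v', hv', -⟩ := (hvn 1).2
  have eX : X' = fun t => (u' t : Module.End ℂ K.smooth) := by
    refine hX'.unique D fun ψ t => ?_
    have := (hu' t).map (hI.isContLin_evalAt a ψ)
    simp only [hu]
    exact this
  have eY : Y' = fun t => (v' t : Module.End ℂ K.smooth) := by
    refine hY'.unique D fun ψ t => ?_
    have := (hv' t).map (hI.isContLin_evalAt b ψ)
    simp only [hv]
    exact this
  let T : 𝒜.cls a →ₗ[ℂ] 𝒜.cls b →ₗ[ℂ] 𝒜.cls (a + b) := LinearMap.mk₂ ℂ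
    (fun A B => ⟨(A : Module.End ℂ K.smooth) * B, hI.mul_mem a b A A.2 B B.2⟩)
    (fun _ _ _ => Subtype.ext (add_mul _ _ _)) (fun _ _ _ => Subtype.ext (smul_mul_assoc _ _ _))
    (fun _ _ _ => Subtype.ext (mul_add _ _ _)) (fun _ _ _ => Subtype.ext (mul_smul_comm _ _ _))
  have hT : IsContBilin (𝒜.semi a) (𝒜.semi b) (𝒜.semi (a + b)) T :=
    IsContBilin.of_sup fun j => hI.mul_continuous a b j
  intro ψ t
  have := (HasSeminormDerivAt.bilin hT (hvn 0) (hu' t) (hv' t)).map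
    (hI.isContLin_evalAt (a + b) ψ)
  have e : (fun t => (X * Y) t ψ) = fun t => evalAt 𝒜 (a + b) ψ (T (u t) (v t)) := by
    ext1 t
    rw [Pi.mul_apply, hu, hv]
    rfl
  have e' : (X' * Y + X * Y') t ψ =
      evalAt 𝒜 (a + b) ψ (T (u' t) (v t) + T (u t) (v' t)) := by
    rw [Pi.add_apply, Pi.mul_apply, Pi.mul_apply, hu, hv, eX, eY]
    rfl
  rw [e, e']
  exact this

/-- The time derivative on the algebra of time dependent operators. -/
def timeDer (hI : IsGradedAlgebra 𝒜) (D : K.IsDiscrete lam) :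
    Module.End ℂ (hI.TimeAlgebra D) where
  toFun X := (hI.exists_deriv D X).choose
  map_add' X Y := by
    refine Subtype.ext ((hI.exists_deriv D (X + Y)).choose_spec.unique D fun ψ t => ?_)
    exact HasSeminormDerivAt.add ((hI.exists_deriv D X).choose_spec ψ t)
      ((hI.exists_deriv D Y).choose_spec ψ t)
  map_smul' c X := by
    refine Subtype.ext ((hI.exists_deriv D (c • X)).choose_spec.unique D fun ψ t => ?_)
    refine hasSeminormDerivAt_sob_iff.2 fun r => ?_
    have h1 := hasSeminormDerivAt_sob_iff.1 ((hI.exists_deriv D X).choose_spec ψ t) r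
    have h2 := h1.const_smul c
    rw [← map_smul] at h2
    refine h2.congr_deriv rfl |>.congr_of_eventuallyEq (Eventually.of_forall fun t => ?_)
    exact map_smul (K.powS r) c _

theorem timeDer_spec (X : hI.TimeAlgebra D) :
    IsStrongDeriv X.1 (hI.timeDer D X).1 :=
  (hI.exists_deriv D X).choose_spec

theorem timeDer_eq {X Y : hI.TimeAlgebra D}
    (h : IsStrongDeriv X.1 Y.1) : hI.timeDer D X = Y :=
  Subtype.ext ((hI.timeDer_spec D X).unique D h)

theorem isOrderFiltration : IsOrderFiltration (hI.timeFilt D) (hI.timeDer D) where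
  mono a b h X hX := hI.timeClass_mono h hX
  commutator hX hY := hI.commutator_mem_timeClass hX hY
  der_mem {a X} hX := by
    obtain ⟨W', hW', h⟩ := hI.exists_strongDeriv hX
    rw [hI.timeDer_eq D (Y := ⟨W', a, hW'⟩) h]
    exact hW'
  leibniz X Y := by
    obtain ⟨a, ha⟩ := X.2
    obtain ⟨b, hb⟩ := Y.2
    exact hI.timeDer_eq D (hI.strongDeriv_mul D ha hb (hI.timeDer_spec D X) (hI.timeDer_spec D Y))

/-- A time independent operator as an element of the algebra of time dependent operators. -/
def constOp {m : ℝ} {A : Module.End ℂ K.smooth} (hA : A ∈ 𝒜.cls m) : hI.TimeAlgebra D :=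
  ⟨fun _ => A, m, const_mem_timeClass hA⟩

theorem timeDer_constOp {m : ℝ} {A : Module.End ℂ K.smooth} (hA : A ∈ 𝒜.cls m) :
    hI.timeDer D (hI.constOp D hA) = 0 :=
  hI.timeDer_eq D fun ψ t => hasSeminormDerivAt_sob_iff.2 fun r => by
    change HasDerivAt _ (K.powS r (0 : K.smooth)) t
    rw [map_zero]
    exact hasDerivAt_const t (K.powS r (A ψ))

end IsGradedAlgebra
end SobolevGrowth
end

noncomputable section
namespace SobolevGrowth
variable {H : Type*} [NormedAddCommGroup H] [InnerProductSpace ℂ H] [CompleteSpace H]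

/-! ## Schur multipliers with respect to the spectral decomposition -/

open ReferenceOperator

variable {K : ReferenceOperator H} {lam : ℝ} {𝒜 : OperatorClasses K}

namespace ReferenceOperator.IsDiscrete

/-- The spectral projection onto the `n`-th eigenspace, as a map into `H^∞`. -/
def blk (D : K.IsDiscrete lam) (n : ℕ) : H →ₗ[ℂ] K.smooth :=
  (K.block lam n).toLinearMap.codRestrict K.smooth fun ψ => D.block_mem_smooth n ψ

theorem coe_blk (D : K.IsDiscrete lam) (n : ℕ) (ψ : H) : (D.blk n ψ : H) = K.block lam n ψ := rfl

theorem sob_blk (D : K.IsDiscrete lam) (r : ℝ) (n : ℕ) (ψ : H) :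
    K.sob r (D.blk n ψ) = ev lam n ^ r * ‖K.block lam n ψ‖ :=
  D.sob_block_of_mem r n _ (K.block_block_self n ψ)

theorem diag_blk (D : K.IsDiscrete lam) {g : ℝ → ℂ} (hg : Tempered lam g) (n : ℕ) (ψ : H) :
    K.diag g (D.blk n ψ) = g (ev lam n) • D.blk n ψ := by
  refine D.ext_smooth fun m => ?_
  rw [D.block_diag hg, Submodule.coe_smul, map_smul, coe_blk]
  by_cases h : m = n
  · rw [h]
  · rw [K.block_block_ne h, smul_zero, smul_zero]

theorem norm_block_le_sob (D : K.IsDiscrete lam) (r : ℝ) (n : ℕ) (ψ : K.smooth) :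
    ev lam n ^ r * ‖K.block lam n (ψ : H)‖ ≤ K.sob r ψ := by
  have hp := D.ev_pos n
  have h := K.norm_block_le (lam := lam) n (K.powS r ψ)
  rwa [block_powS, norm_smul, Complex.norm_real, Real.norm_of_nonneg (by positivity)] at h

theorem tendsto_sob_sum_blk (D : K.IsDiscrete lam) (r : ℝ) (ψ : K.smooth) :
    Tendsto (fun N => K.sob r (∑ k ∈ Finset.range N, D.blk k (ψ : H) - ψ)) atTop (𝓝 0) := by
  have h := (D.hasSum_block (K.powS r ψ)).tendsto_sum_nat
  rw [tendsto_iff_norm_sub_tendsto_zero] at h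
  refine h.congr fun N => ?_
  rw [sob_eq, map_sub, map_sum]
  congr 2
  refine Finset.sum_congr rfl fun k _ => ?_
  refine D.ext_block fun m => ?_
  rw [block_powS, block_powS, coe_blk, map_smul]
  by_cases hm : m = k
  · rw [hm]
  · rw [K.block_block_ne hm, smul_zero, smul_zero]

/-- Matrix expansion of an operator of finite order. -/
theorem hasSum_block_apply (D : K.IsDiscrete lam) {m : ℝ} {A : Module.End ℂ K.smooth}
    (hA : K.IsOfOrder m A) (ψ : K.smooth) (n : ℕ)
    (hs : Summable fun k => K.block lam n (A (D.blk k (ψ : H)) : H)) :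
    HasSum (fun k => K.block lam n (A (D.blk k (ψ : H)) : H)) (K.block lam n (A ψ : H)) := by
  obtain ⟨C, hC⟩ := hA m
  rw [sub_self] at hC
  have h1 : Tendsto (fun N => K.block lam n (A (∑ k ∈ Finset.range N, D.blk k (ψ : H)) : H))
      atTop (𝓝 (K.block lam n (A ψ : H))) := by
    rw [tendsto_iff_norm_sub_tendsto_zero]
    refine squeeze_zero (fun _ => norm_nonneg _) (fun N => ?_)
      (by simpa using (D.tendsto_sob_sum_blk m ψ).const_mul C)
    rw [← map_sub, ← Submodule.coe_sub, ← map_sub]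
    refine (K.norm_block_le _ _).trans ?_
    rw [← D.sob_zero]
    exact hC _
  have h2 := hs.hasSum.tendsto_sum_nat
  have h3 : (fun N => K.block lam n (A (∑ k ∈ Finset.range N, D.blk k (ψ : H)) : H)) =
      fun N => ∑ k ∈ Finset.range N, K.block lam n (A (D.blk k (ψ : H)) : H) := by
    ext1 N
    rw [map_sum, Submodule.coe_sum, map_sum]
  rw [h3] at h1
  have := hs.hasSum
  rwa [tendsto_nhds_unique h2 h1] at this

/-- An operator of finite order is continuous from some $\mathcal H^s$ to $\mathcal H$, and finite
sums of eigenvectors are dense in $\mathcal H^\infty$ for that norm. Hence operator identities can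
be checked entry by entry. -/
theorem ext_matrix (D : K.IsDiscrete lam) {a b : ℝ} {A B : Module.End ℂ K.smooth}
    (hA : K.IsOfOrder a A) (hB : K.IsOfOrder b B)
    (h : ∀ n k (ψ : H), K.block lam n (A (D.blk k ψ) : H) = K.block lam n (B (D.blk k ψ) : H)) :
    A = B := by
  have e : ∀ k (ψ : H), A (D.blk k ψ) = B (D.blk k ψ) := fun k ψ =>
    D.ext_smooth fun n => h n k ψ
  have lim : ∀ {c : ℝ} {C : Module.End ℂ K.smooth}, K.IsOfOrder c C → ∀ ψ : K.smooth,
      Tendsto (fun N => (C (∑ k ∈ Finset.range N, D.blk k (ψ : H)) : H)) atTop (𝓝 (C ψ : H)) := by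
    intro c C hC ψ
    obtain ⟨M, hM⟩ := hC c
    rw [sub_self] at hM
    rw [tendsto_iff_norm_sub_tendsto_zero]
    refine squeeze_zero (fun _ => norm_nonneg _) (fun N => ?_)
      (by simpa using (D.tendsto_sob_sum_blk c ψ).const_mul M)
    rw [← Submodule.coe_sub, ← map_sub, ← D.sob_zero]
    exact hM _
  ext1 ψ
  refine Subtype.ext (tendsto_nhds_unique (lim hA ψ) ?_)
  have := lim hB ψ
  simpa only [map_sum, e] using this

/-- `B` is obtained from `A` by multiplying its matrix elements by `c`. -/
def IsMult (D : K.IsDiscrete lam) (c : ℕ → ℕ → ℂ) (A B : Module.End ℂ K.smooth) : Prop :=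
  ∀ n k (ψ : H), K.block lam n (B (D.blk k ψ) : H) = c n k • K.block lam n (A (D.blk k ψ) : H)

variable {D : K.IsDiscrete lam}

theorem IsMult.one (A : Module.End ℂ K.smooth) : D.IsMult (fun _ _ => 1) A A :=
  fun _ _ _ => (one_smul _ _).symm

theorem IsMult.add {c d : ℕ → ℕ → ℂ} {A B C : Module.End ℂ K.smooth} (h : D.IsMult c A B)
    (h' : D.IsMult d A C) : D.IsMult (fun n k => c n k + d n k) A (B + C) := fun n k ψ => by
  rw [LinearMap.add_apply, Submodule.coe_add, map_add, h, h', add_smul]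

theorem IsMult.sub {c d : ℕ → ℕ → ℂ} {A B C : Module.End ℂ K.smooth} (h : D.IsMult c A B)
    (h' : D.IsMult d A C) : D.IsMult (fun n k => c n k - d n k) A (B - C) := fun n k ψ => by
  rw [LinearMap.sub_apply, Submodule.coe_sub, map_sub, h, h', sub_smul]

theorem IsMult.smul {c : ℕ → ℕ → ℂ} {A B : Module.End ℂ K.smooth} (z : ℂ) (h : D.IsMult c A B) :
    D.IsMult (fun n k => z * c n k) A (z • B) := fun n k ψ => by
  rw [LinearMap.smul_apply, Submodule.coe_smul, map_smul, h, smul_smul]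

theorem IsMult.sum {ι : Type*} {s : Finset ι} {c : ι → ℕ → ℕ → ℂ} {A : Module.End ℂ K.smooth}
    {B : ι → Module.End ℂ K.smooth} (h : ∀ i ∈ s, D.IsMult (c i) A (B i)) :
    D.IsMult (fun n k => ∑ i ∈ s, c i n k) A (∑ i ∈ s, B i) := fun n k ψ => by
  rw [LinearMap.sum_apply, Submodule.coe_sum, map_sum, Finset.sum_smul]
  exact Finset.sum_congr rfl fun i hi => h i hi n k ψ

theorem IsMult.congr {c d : ℕ → ℕ → ℂ} {A B : Module.End ℂ K.smooth} (h : D.IsMult c A B)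
    (e : ∀ n k, c n k = d n k) : D.IsMult d A B := fun n k ψ => by rw [h, e]

theorem IsMult.diag_mul {c : ℕ → ℕ → ℂ} {A B : Module.End ℂ K.smooth} (h : D.IsMult c A B)
    {g : ℝ → ℂ} (hg : Tempered lam g) :
    D.IsMult (fun n k => g (ev lam n) * c n k) A (K.diag g * B) := fun n k ψ => by
  rw [Module.End.mul_apply, D.block_diag hg, h, smul_smul]

theorem IsMult.mul_diag {c : ℕ → ℕ → ℂ} {A B : Module.End ℂ K.smooth} (h : D.IsMult c A B)
    {g : ℝ → ℂ} (hg : Tempered lam g) :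
    D.IsMult (fun n k => c n k * g (ev lam k)) A (B * K.diag g) := fun n k ψ => by
  rw [Module.End.mul_apply, D.diag_blk hg, map_smul, Submodule.coe_smul, map_smul, h, smul_smul,
    mul_comm]

theorem IsMult.unique {c : ℕ → ℕ → ℂ} {a b : ℝ} {A B B' : Module.End ℂ K.smooth}
    (hB : K.IsOfOrder a B) (hB' : K.IsOfOrder b B') (h : D.IsMult c A B) (h' : D.IsMult c A B') :
    B = B' :=
  D.ext_matrix hB hB' fun n k ψ => by rw [h, h']

end ReferenceOperator.IsDiscrete

namespace IsGradedAlgebra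

open ReferenceOperator.IsDiscrete

theorem tendsto_block_apply (hI : IsGradedAlgebra 𝒜) (D : K.IsDiscrete lam) {m : ℝ}
    {u : ℕ → 𝒜.cls m} {A : 𝒜.cls m}
    (hu : ∀ j, Tendsto (fun k => 𝒜.semi m j (u k - A)) atTop (𝓝 0)) (n : ℕ) (ψ : K.smooth) :
    Tendsto (fun k => K.block lam n ((u k : Module.End ℂ K.smooth) ψ : H)) atTop
      (𝓝 (K.block lam n ((A : Module.End ℂ K.smooth) ψ : H))) := by
  obtain ⟨s, C, hC, h⟩ := hI.isContLin_evalAt m ψ 0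
  rw [tendsto_iff_norm_sub_tendsto_zero]
  refine squeeze_zero (fun _ => norm_nonneg _) (fun k => ?_)
    (by simpa using (tendsto_sum_zero (𝒜.semi m) hu s).const_mul C)
  rw [← map_sub]
  refine (K.norm_block_le _ _).trans (le_trans (le_of_eq ?_) (h (u k - A)))
  rw [D.sob_zero]
  rfl

/-- Automatic continuity of Schur multipliers between operator classes. -/
theorem exists_contLin_mult (hI : IsGradedAlgebra 𝒜) (D : K.IsDiscrete lam) {a b : ℝ}
    {c : ℕ → ℕ → ℂ} (h : ∀ A ∈ 𝒜.cls a, ∃ B ∈ 𝒜.cls b, D.IsMult c A B) :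
    ∃ T : 𝒜.cls a →ₗ[ℂ] 𝒜.cls b, IsContLin (𝒜.semi a) (𝒜.semi b) T ∧
      ∀ A : 𝒜.cls a, D.IsMult c (A : Module.End ℂ K.smooth) (T A) := by
  choose f hf hfm using h
  have uniq : ∀ {A B B' : Module.End ℂ K.smooth}, B ∈ 𝒜.cls b → B' ∈ 𝒜.cls b →
      D.IsMult c A B → D.IsMult c A B' → B = B' := fun hB hB' =>
    IsMult.unique (hI.isOfOrder _ _ hB) (hI.isOfOrder _ _ hB')
  let T : 𝒜.cls a →ₗ[ℂ] 𝒜.cls b :=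
    { toFun := fun A => ⟨f A A.2, hf A A.2⟩
      map_add' := fun A A' => Subtype.ext <| uniq (hf _ _)
        (Submodule.add_mem _ (hf A A.2) (hf A' A'.2)) (hfm _ _) fun n k ψ => by
          simp only [Submodule.coe_add, LinearMap.add_apply, map_add, smul_add, hfm _ _ n k ψ]
      map_smul' := fun z A => Subtype.ext <| uniq (hf _ _)
        (Submodule.smul_mem _ z (hf A A.2)) (hfm _ _) fun n k ψ => by
          simp only [Submodule.coe_smul, LinearMap.smul_apply, map_smul, hfm _ _ n k ψ]
          exact smul_comm _ _ _ }
  refine ⟨T, IsContLin.of_sup (closed_graph (hI.isFrechet a) (hI.isFrechet b) T ?_),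
    fun A => hfm A A.2⟩
  -- Convergence in a class implies convergence of each matrix entry, and entries of the image are
  -- fixed multiples of entries of the argument; so the graph is closed.
  intro u A B hu hT
  refine Subtype.ext (uniq (T A).2 B.2 (hfm A A.2) fun n k ψ => ?_)
  refine tendsto_nhds_unique (hI.tendsto_block_apply D hT n (D.blk k ψ)) ?_
  have := (hI.tendsto_block_apply D hu n (D.blk k ψ)).const_smul (c n k)
  refine this.congr fun i => ?_
  exact (hfm (u i) (u i).2 n k ψ).symm

/-- A continuous linear map commutes with time derivatives and preserves bounds, so a statement
about single operators passes to smooth bounded families. -/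
theorem exists_timeClass_mult (hI : IsGradedAlgebra 𝒜) (D : K.IsDiscrete lam) {a b : ℝ}
    {c : ℕ → ℕ → ℂ} (h : ∀ A ∈ 𝒜.cls a, ∃ B ∈ 𝒜.cls b, D.IsMult c A B)
    {W : ℝ → Module.End ℂ K.smooth} (hW : W ∈ timeClass 𝒜 a) :
    ∃ W' ∈ timeClass 𝒜 b, ∀ t, D.IsMult c (W t) (W' t) := by
  obtain ⟨T, hT, hTm⟩ := hI.exists_contLin_mult D h
  obtain ⟨u, hu, hun⟩ := hW
  exact ⟨fun t => T (u t), ⟨fun t => T (u t), fun _ => rfl, fun n => (hun n).map hT⟩,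
    fun t => by rw [hu]; exact hTm (u t)⟩

end IsGradedAlgebra

/-! ### Riemann sums in a Fréchet space -/

section Riemann

variable {E : Type*} [AddCommGroup E] [Module ℂ E]

/-- This is the Heine–Cantor theorem on $[0,1]$ for the topology of one seminorm. -/
theorem Seminorm.exists_uniform_modulus (p : Seminorm ℂ E) {G : ℝ → E}
    (hG : ∀ t, Tendsto (fun t' => p (G t' - G t)) (𝓝 t) (𝓝 0)) {ε : ℝ} (hε : 0 < ε) :
    ∃ δ > 0, ∀ s ∈ Set.Icc (0 : ℝ) 1, ∀ t ∈ Set.Icc (0 : ℝ) 1, |s - t| < δ → p (G s - G t) < ε := by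
  let _ : SeminormedAddCommGroup E := p.toAddGroupSeminorm.toSeminormedAddCommGroup
  have hd : ∀ x y : E, dist x y = p (x - y) := fun x y => by rw [dist_eq_norm]; rfl
  have hc : Continuous G := continuous_iff_continuousAt.2 fun t => by
    rw [ContinuousAt, tendsto_iff_dist_tendsto_zero]
    simpa only [hd] using hG t
  have hu := isCompact_Icc.uniformContinuousOn_of_continuous
    (hc.continuousOn (s := Set.Icc (0 : ℝ) 1))
  obtain ⟨δ, hδ, h⟩ := Metric.uniformContinuousOn_iff.1 hu ε hε
  exact ⟨δ, hδ, fun s hs t ht hst => by rw [← hd]; exact h s hs t ht (by rwa [Real.dist_eq])⟩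

/-- The `N`-th Riemann sum of `G` over `[0, 1]`. -/
def riemannSum (G : ℝ → E) (N : ℕ) : E :=
  ((N : ℂ)⁻¹) • ∑ j ∈ Finset.range N, G ((j : ℝ) / N)

theorem sum_range_mul_eq {M : Type*} [AddCommMonoid M] (f : ℕ → M) (a b : ℕ) :
    ∑ l ∈ Finset.range (a * b), f l =
      ∑ j ∈ Finset.range a, ∑ i ∈ Finset.range b, f (j * b + i) := by
  induction a with
  | zero => simp
  | succ a ih => rw [Nat.succ_mul, Finset.sum_range_add, ih, Finset.sum_range_succ]

theorem riemannSum_sub_le (p : Seminorm ℂ E) {G : ℝ → E} {ε δ : ℝ}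
    (h : ∀ s ∈ Set.Icc (0 : ℝ) 1, ∀ t ∈ Set.Icc (0 : ℝ) 1, |s - t| < δ → p (G s - G t) < ε)
    {a b : ℕ} (hb : 0 < b) (ha : 0 < a) (haδ : (a : ℝ)⁻¹ < δ) :
    p (riemannSum G a - riemannSum G (a * b)) ≤ ε := by
  have ha' : (0 : ℝ) < a := by exact_mod_cast ha
  have hb' : (0 : ℝ) < b := by exact_mod_cast hb
  have e : riemannSum G a - riemannSum G (a * b) = (((a * b : ℕ) : ℂ)⁻¹) •
      ∑ j ∈ Finset.range a, ∑ i ∈ Finset.range b,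
        (G ((j : ℝ) / a) - G (((j * b + i : ℕ) : ℝ) / (a * b : ℕ))) := by
    have hac : (a : ℂ) ≠ 0 := by exact_mod_cast ha.ne'
    have hbc : (b : ℂ) ≠ 0 := by exact_mod_cast hb.ne'
    simp only [Finset.sum_sub_distrib, Finset.sum_const, Finset.card_range]
    rw [smul_sub, riemannSum, riemannSum, sum_range_mul_eq]
    congr 1
    rw [← Finset.smul_sum, ← Nat.cast_smul_eq_nsmul ℂ, smul_smul]
    congr 1
    push_cast
    field_simp
  rw [e, map_smul_eq_mul]
  have hs : p (∑ j ∈ Finset.range a, ∑ i ∈ Finset.range b,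
        (G ((j : ℝ) / a) - G (((j * b + i : ℕ) : ℝ) / (a * b : ℕ)))) ≤ a * b * ε := by
    have h1 : ∀ j ∈ Finset.range a, ∀ i ∈ Finset.range b,
        p (G ((j : ℝ) / a) - G (((j * b + i : ℕ) : ℝ) / (a * b : ℕ))) ≤ ε := by
      intro j hj i hi
      have hj' : (j : ℝ) + 1 ≤ a := by exact_mod_cast Finset.mem_range.1 hj
      have hi' : (i : ℝ) + 1 ≤ b := by exact_mod_cast Finset.mem_range.1 hi
      have hi0 : (0 : ℝ) ≤ i := i.cast_nonneg
      have hj0 : (0 : ℝ) ≤ j := j.cast_nonneg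
      refine (h _ ⟨by positivity, ?_⟩ _ ⟨by positivity, ?_⟩ ?_).le
      · rw [div_le_one ha']; linarith
      · rw [div_le_one (by push_cast; positivity)]
        push_cast
        nlinarith
      · have : (j : ℝ) / a - ((j * b + i : ℕ) : ℝ) / (a * b : ℕ) = -(i / b / a) := by
          push_cast
          field_simp
          ring
        rw [this, abs_neg, abs_of_nonneg (by positivity)]
        refine lt_of_le_of_lt ?_ haδ
        rw [div_le_iff₀ ha', inv_mul_cancel₀ ha'.ne', div_le_one hb']
        linarith
    have h2 : ∀ (s : Finset ℕ) (f : ℕ → E), p (∑ j ∈ s, f j) ≤ ∑ j ∈ s, p (f j) := fun s f =>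
      Finset.le_sum_of_subadditive p (map_zero p).le (map_add_le_add p) s f
    refine (h2 _ _).trans ((Finset.sum_le_sum fun j hj =>
      (h2 _ _).trans (Finset.sum_le_sum fun i hi => h1 j hj i hi)).trans (le_of_eq ?_))
    simp [mul_assoc]
  have hn : ‖(((a * b : ℕ) : ℂ)⁻¹)‖ = ((a : ℝ) * b)⁻¹ := by
    rw [norm_inv, Complex.norm_natCast]; push_cast; rfl
  rw [hn]
  calc _ ≤ ((a : ℝ) * b)⁻¹ * (a * b * ε) := by gcongr
    _ = ε := by field_simp

/-- Any two Riemann sums are compared with the sum over their common refinement, so uniform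
continuity makes the sequence Cauchy in each seminorm. The limit serves as the integral over
$[0,1]$. -/
theorem IsFrechet.exists_riemann_limit {p : ℕ → Seminorm ℂ E} (hp : IsFrechet p) {G : ℝ → E}
    (hG : ∀ i t, Tendsto (fun t' => p i (G t' - G t)) (𝓝 t) (𝓝 0)) :
    ∃ a, ∀ i, Tendsto (fun N => p i (riemannSum G (N + 1) - a)) atTop (𝓝 0) := by
  refine hp.2 _ fun j ε hε => ?_
  obtain ⟨δ, hδ, h⟩ := Seminorm.exists_uniform_modulus (p j) (hG j) (show 0 < ε / 3 by positivity)
  obtain ⟨N, hN⟩ := exists_nat_gt δ⁻¹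
  have hlt : ∀ k ≥ N, (((k + 1 : ℕ) : ℝ))⁻¹ < δ := by
    intro k hk
    rw [inv_lt_comm₀ (by positivity) hδ]
    refine hN.trans_le ?_
    exact_mod_cast Nat.le_succ_of_le hk
  refine ⟨N, fun k hk l hl => ?_⟩
  have h1 := riemannSum_sub_le (p j) h (a := k + 1) (b := l + 1) (by omega) (by omega) (hlt k hk)
  have h2 := riemannSum_sub_le (p j) h (a := l + 1) (b := k + 1) (by omega) (by omega) (hlt l hl)
  rw [mul_comm (l + 1)] at h2
  have h3 := map_sub_le_add (p j) (riemannSum G (k + 1) - riemannSum G ((k + 1) * (l + 1)))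
    (riemannSum G (l + 1) - riemannSum G ((k + 1) * (l + 1)))
  rw [sub_sub_sub_cancel_right] at h3
  linarith

end Riemann

end SobolevGrowth
end

noncomputable section
namespace SobolevGrowth
variable {H : Type*} [NormedAddCommGroup H] [InnerProductSpace ℂ H] [CompleteSpace H]

/-! ## Averaging along the flow of `K₀` -/

open ReferenceOperator ReferenceOperator.IsDiscrete

variable {K : ReferenceOperator H} {lam : ℝ} {𝒜 : OperatorClasses K}

/-- The phase `e^{2πi(n-k)s}`. -/
def phase (n k : ℕ) (s : ℝ) : ℂ := Complex.exp (2 * Real.pi * Complex.I * ((n : ℂ) - k) * s)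

theorem ReferenceOperator.IsDiscrete.tempered_exp (lam τ : ℝ) :
    Tempered lam fun x => Complex.exp (Complex.I * τ * x) :=
  tempered_of_bounded (C := 1) fun n => ReferenceOperator.norm_exp_le τ (ev lam n)

theorem ReferenceOperator.IsDiscrete.expOp_eq_diag (D : K.IsDiscrete lam) (τ : ℝ) :
    K.expOp τ = K.diag fun x => Complex.exp (Complex.I * τ * x) := by
  ext1 ψ
  refine D.ext_smooth fun n => ?_
  have e : (K.expOp τ ψ : H) = K.func (fun x => Complex.exp (Complex.I * τ * x))
    ⟨ψ, (K.func_mem_smooth _ (norm_exp_le τ) ψ).1⟩ := rfl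
  rw [D.block_diag (tempered_exp lam τ), e, block_func]

/-- The shift $\lambda$ cancels between the two exponentials, so the phases depend only on the
integer $n-k$. -/
theorem isMult_conj_expOp (D : K.IsDiscrete lam) (A : Module.End ℂ K.smooth) (s : ℝ) :
    D.IsMult (fun n k => phase n k s) A
      (K.expOp (2 * Real.pi * s) * A * K.expOp (-(2 * Real.pi * s))) := by
  rw [D.expOp_eq_diag, D.expOp_eq_diag]
  refine (((IsMult.one A).diag_mul (tempered_exp lam _)).mul_diag (tempered_exp lam _)).congr
    fun n k => ?_
  rw [mul_one, ← Complex.exp_add, phase]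
  congr 1
  simp only [ev]
  push_cast
  ring

/-- The operator is $\int_0^1w(s)\,e^{2\pi isK_0}Ae^{-2\pi isK_0}\,ds$. The Egorov property makes
the integrand continuous in $\mathcal A_m$, completeness keeps the integral there, and its
multiplier consists of the Fourier coefficients $\int_0^1w(s)e^{2\pi i(n-k)s}ds$. -/
theorem IsGradedAlgebra.exists_mult_of_weight (hI : IsGradedAlgebra 𝒜) (D : K.IsDiscrete lam)
    (hII : HasEgorovProperty 𝒜) {w : ℝ → ℂ} (hw : Continuous w) {c : ℕ → ℕ → ℂ}
    (hc : ∀ n k, Tendsto (fun N => riemannSum (fun s => w s * phase n k s) (N + 1)) atTop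
      (𝓝 (c n k))) {m : ℝ} {A : Module.End ℂ K.smooth} (hA : A ∈ 𝒜.cls m) :
    ∃ B ∈ 𝒜.cls m, D.IsMult c A B := by
  obtain ⟨F, hF, hFc, -⟩ := hII m A hA
  set G : ℝ → 𝒜.cls m := fun s => w s • F (2 * Real.pi * s) with hG
  have hGc : ∀ i t, Tendsto (fun t' => 𝒜.semi m i (G t' - G t)) (𝓝 t) (𝓝 0) := by
    intro i t
    have l1 : Tendsto (fun t' : ℝ => 𝒜.semi m i (F (2 * Real.pi * t') - F (2 * Real.pi * t)))
        (𝓝 t) (𝓝 0) :=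
      (hFc i (2 * Real.pi * t)).comp ((continuous_const.mul continuous_id).tendsto t)
    have l2 : Tendsto (fun t' : ℝ => ‖w t' - w t‖) (𝓝 t) (𝓝 0) :=
      tendsto_iff_norm_sub_tendsto_zero.1 (hw.tendsto t)
    have l3 := (((hw.tendsto t).norm).mul l1).add
      (l2.mul_const (𝒜.semi m i (F (2 * Real.pi * t))))
    refine squeeze_zero (fun _ => apply_nonneg _ _) (fun t' => ?_) (by simpa using l3)
    have e : G t' - G t = w t' • (F (2 * Real.pi * t') - F (2 * Real.pi * t)) +
        (w t' - w t) • F (2 * Real.pi * t) := by simp only [hG]; module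
    rw [e, ← map_smul_eq_mul, ← map_smul_eq_mul]
    exact map_add_le_add _ _ _
  obtain ⟨B, hB⟩ := (hI.isFrechet m).exists_riemann_limit hGc
  refine ⟨B, B.2, fun n k ψ => ?_⟩
  have h1 := hI.tendsto_block_apply D hB n (D.blk k ψ)
  refine tendsto_nhds_unique h1 ?_
  refine ((hc n k).smul_const (K.block lam n (A (D.blk k ψ) : H))).congr fun N => ?_
  have hm : ∀ s, K.block lam n ((G s : Module.End ℂ K.smooth) (D.blk k ψ) : H) =
      (w s * phase n k s) • K.block lam n (A (D.blk k ψ) : H) := by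
    intro s
    have := isMult_conj_expOp D A s n k ψ
    rw [← hF] at this
    simp only [hG, Submodule.coe_smul, LinearMap.smul_apply, map_smul, this, smul_smul]
  simp only [riemannSum, Submodule.coe_smul, Submodule.coe_sum, LinearMap.smul_apply,
    LinearMap.sum_apply, map_smul, map_sum, hm]
  rw [← Finset.sum_smul, smul_smul, smul_eq_mul]

theorem phase_eq_pow (n k N j : ℕ) : phase n k ((j : ℝ) / (N + 1 : ℕ)) =
    Complex.exp (2 * Real.pi * Complex.I * ((n : ℂ) - k) / (N + 1 : ℕ)) ^ j := by
  rw [← Complex.exp_nat_mul, phase]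
  congr 1
  push_cast
  field_simp

theorem exp_phase_pow (n k N : ℕ) :
    Complex.exp (2 * Real.pi * Complex.I * ((n : ℂ) - k) / (N + 1 : ℕ)) ^ (N + 1) = 1 := by
  rw [← Complex.exp_nat_mul, Complex.exp_eq_one_iff]
  refine ⟨(n : ℤ) - k, ?_⟩
  have : ((N + 1 : ℕ) : ℂ) ≠ 0 := by exact_mod_cast N.succ_ne_zero
  push_cast at this ⊢
  field_simp

theorem exp_phase_ne_one {n k N : ℕ} (hnk : n ≠ k) (hN : n + k ≤ N) :
    Complex.exp (2 * Real.pi * Complex.I * ((n : ℂ) - k) / (N + 1 : ℕ)) ≠ 1 := by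
  intro h
  obtain ⟨d, hd⟩ := Complex.exp_eq_one_iff.1 h
  have h0 : ((N + 1 : ℕ) : ℂ) ≠ 0 := by exact_mod_cast N.succ_ne_zero
  have hpi : (2 * Real.pi * Complex.I : ℂ) ≠ 0 := Complex.two_pi_I_ne_zero
  have h1 : (n : ℂ) - k = d * (N + 1 : ℕ) := by
    rw [div_eq_iff h0] at hd
    have : (2 * Real.pi * Complex.I : ℂ) * ((n : ℂ) - k) =
        (2 * Real.pi * Complex.I) * (d * (N + 1 : ℕ)) := by rw [hd]; ring
    exact mul_left_cancel₀ hpi this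
  have h2 : (n : ℤ) - k = d * (N + 1 : ℕ) := by exact_mod_cast h1
  have h3 : |(n : ℤ) - k| < (N + 1 : ℕ) := by rw [abs_lt]; constructor <;> push_cast <;> omega
  have h4 : (n : ℤ) - k = 0 := Int.eq_zero_of_abs_lt_dvd ⟨d, by rw [h2, mul_comm]⟩ h3
  omega

/-- The powers of a nontrivial $(N+1)$-st root of unity sum to zero. The condition on $N$ excludes
$N+1$ dividing $n-k$, so each off-diagonal Riemann sum is eventually exactly zero. -/
theorem geom_phase_eq_zero {n k N : ℕ} (hnk : n ≠ k) (hN : n + k ≤ N) :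
    ∑ j ∈ Finset.range (N + 1),
      Complex.exp (2 * Real.pi * Complex.I * ((n : ℂ) - k) / (N + 1 : ℕ)) ^ j = 0 := by
  rw [geom_sum_eq (exp_phase_ne_one hnk hN), exp_phase_pow, sub_self, zero_div]

theorem sum_mul_pow_mul_sub_one (z : ℂ) (N : ℕ) :
    (∑ j ∈ Finset.range N, (j : ℂ) * z ^ j) * (z - 1) =
      N * z ^ N - z * ∑ j ∈ Finset.range N, z ^ j := by
  induction N with
  | zero => simp
  | succ N ih =>
    rw [Finset.sum_range_succ, Finset.sum_range_succ, add_mul, ih]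
    push_cast
    ring

/-- Averaging over the flow of `K₀` preserves the operator classes. -/
theorem IsGradedAlgebra.exists_average (hI : IsGradedAlgebra 𝒜) (D : K.IsDiscrete lam)
    (hII : HasEgorovProperty 𝒜) {m : ℝ} {A : Module.End ℂ K.smooth} (hA : A ∈ 𝒜.cls m) :
    ∃ B ∈ 𝒜.cls m, D.IsMult (fun n k => if n = k then 1 else 0) A B := by
  refine hI.exists_mult_of_weight D hII (w := fun _ => 1) continuous_const (fun n k => ?_) hA
  refine tendsto_const_nhds.congr' (eventually_atTop.2 ⟨n + k, fun N hN => ?_⟩)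
  simp only [riemannSum, one_mul, phase_eq_pow]
  by_cases h : n = k
  · subst h
    have : ((N + 1 : ℕ) : ℂ) ≠ 0 := by exact_mod_cast N.succ_ne_zero
    simp only [sub_self, mul_zero, zero_div, Complex.exp_zero, one_pow, Finset.sum_const,
      Finset.card_range, if_true, nsmul_eq_mul, mul_one, smul_eq_mul]
    rw [inv_mul_cancel₀ this]
  · rw [if_neg h, geom_phase_eq_zero h hN, smul_zero]

/-- The multiplier solving the equation `[K₀, Y] = A - ⟨A⟩` up to a factor `2πi`. -/
def solveMult (n k : ℕ) : ℂ :=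
  if n = k then 1 / 2 else (2 * Real.pi * Complex.I * ((n : ℂ) - k))⁻¹

/-- The weight $w(s)=s$ has Fourier coefficients $(2\pi i(n-k))^{-1}$ off the diagonal, which invert
the commutator with $K_0$. Its mean $1/2$ on the diagonal is harmless, as commutators with functions
of $K_0$ do not see the diagonal. -/
theorem IsGradedAlgebra.exists_solve (hI : IsGradedAlgebra 𝒜) (D : K.IsDiscrete lam)
    (hII : HasEgorovProperty 𝒜) {m : ℝ} {A : Module.End ℂ K.smooth} (hA : A ∈ 𝒜.cls m) :
    ∃ B ∈ 𝒜.cls m, D.IsMult solveMult A B := by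
  refine hI.exists_mult_of_weight D hII (w := fun s => (s : ℂ)) Complex.continuous_ofReal
    (fun n k => ?_) hA
  have hN0 : ∀ N : ℕ, ((N + 1 : ℕ) : ℂ) ≠ 0 := fun N => by exact_mod_cast N.succ_ne_zero
  have hinv : Tendsto (fun N : ℕ => ((N + 1 : ℕ) : ℂ)⁻¹) atTop (𝓝 0) :=
    (tendsto_inv_atTop_nhds_zero_nat (𝕜 := ℂ)).comp (tendsto_add_atTop_nat 1)
  by_cases h : n = k
  · subst h
    have e : ∀ N : ℕ, 1 / 2 - 1 / 2 * ((N + 1 : ℕ) : ℂ)⁻¹ =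
        riemannSum (fun s => (s : ℂ) * phase n n s) (N + 1) := by
      intro N
      have hs : (∑ j ∈ Finset.range (N + 1), (j : ℂ)) * 2 = (N + 1 : ℕ) * N := by
        have := congrArg (Nat.cast : ℕ → ℂ) (Finset.sum_range_id_mul_two (N + 1))
        rw [Nat.add_sub_cancel] at this
        rwa [Nat.cast_mul, Nat.cast_mul, Nat.cast_sum] at this
      have hs' : ∑ j ∈ Finset.range (N + 1), (j : ℂ) = (N + 1 : ℕ) * N / 2 := by
        rw [← hs]; ring
      simp only [riemannSum, phase, sub_self, mul_zero, zero_mul, Complex.exp_zero, mul_one]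
      push_cast
      rw [← Finset.sum_div, hs', smul_eq_mul]
      have := hN0 N
      push_cast at this ⊢
      field_simp
      ring
    have l := (hinv.const_mul (1 / 2)).const_sub (1 / 2)
    rw [mul_zero, sub_zero] at l
    rw [solveMult, if_pos rfl]
    exact l.congr e
  · rw [solveMult, if_neg h]
    set z : ℂ := 2 * Real.pi * Complex.I * ((n : ℂ) - k) with hz
    have hz0 : z ≠ 0 := by
      refine mul_ne_zero Complex.two_pi_I_ne_zero (sub_ne_zero.2 ?_)
      exact_mod_cast h
    -- Summation by parts shows that the Riemann sum is eventually the reciprocal of this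
    -- expression; its limit is the derivative of $x\mapsto e^{zx}$ at $0$.
    have l : Tendsto (fun N : ℕ => ((N + 1 : ℕ) : ℂ) * (Complex.exp (z / (N + 1 : ℕ)) - 1)) atTop
        (𝓝 z) := by
      have hd : HasDerivAt (fun x : ℂ => Complex.exp (z * x)) z 0 := by
        have := ((hasDerivAt_id (0 : ℂ)).const_mul z).cexp
        simpa using this
      rw [hasDerivAt_iff_tendsto_slope_zero] at hd
      have := hd.comp (tendsto_nhdsWithin_iff.2
        ⟨hinv, Eventually.of_forall fun N => inv_ne_zero (hN0 N)⟩)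
      refine this.congr fun N => ?_
      simp [div_eq_mul_inv]
    refine (l.inv₀ hz0).congr' (eventually_atTop.2 ⟨n + k, fun N hN => ?_⟩)
    simp only [riemannSum, phase_eq_pow, ← hz]
    set ζ := Complex.exp (z / (N + 1 : ℕ)) with hζ
    have hζ1 : ζ - 1 ≠ 0 := sub_ne_zero.2 (exp_phase_ne_one h hN)
    have hs := sum_mul_pow_mul_sub_one ζ (N + 1)
    rw [exp_phase_pow n k N, geom_phase_eq_zero h hN, mul_zero, sub_zero, mul_one] at hs
    have hs' : ∑ j ∈ Finset.range (N + 1), (j : ℂ) * ζ ^ j = (N + 1 : ℕ) / (ζ - 1) := by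
      rw [eq_div_iff hζ1, hs]
    have e : ∑ j ∈ Finset.range (N + 1), (((j : ℝ) / (N + 1 : ℕ) : ℝ) : ℂ) * ζ ^ j =
        ((N + 1 : ℕ) : ℂ)⁻¹ * ∑ j ∈ Finset.range (N + 1), (j : ℂ) * ζ ^ j := by
      rw [Finset.mul_sum]
      refine Finset.sum_congr rfl fun j _ => ?_
      push_cast
      ring
    rw [e, hs', smul_eq_mul]
    have := hN0 N
    field_simp

end SobolevGrowth
end

noncomputable section
namespace SobolevGrowth

/-! ## Taylor remainders of powers -/

/-- The generalized binomial coefficient. -/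
def binCoeff (μ : ℝ) : ℕ → ℝ
  | 0 => 1
  | j + 1 => μ / (j + 1) * binCoeff (μ - 1) j

/-- The Taylor polynomial at `x` of `y ↦ y ^ μ`. -/
def powTaylor (μ : ℝ) (N : ℕ) (x y : ℝ) : ℝ :=
  ∑ j ∈ Finset.range N, binCoeff μ j * x ^ (μ - j) * (y - x) ^ j

theorem powTaylor_self (μ : ℝ) (N : ℕ) (x : ℝ) : powTaylor μ (N + 1) x x = x ^ μ := by
  rw [powTaylor, Finset.sum_range_succ']
  simp [binCoeff]

theorem hasDerivAt_powTaylor (μ : ℝ) (N : ℕ) (x y : ℝ) :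
    HasDerivAt (powTaylor μ (N + 1) x) (μ * powTaylor (μ - 1) N x y) y := by
  have e : powTaylor μ (N + 1) x = fun y => ∑ j ∈ Finset.range N,
      binCoeff μ (j + 1) * x ^ (μ - (j + 1 : ℕ)) * (y - x) ^ (j + 1) + x ^ μ := by
    ext1 y
    rw [powTaylor, Finset.sum_range_succ']
    simp [binCoeff]
  rw [e, powTaylor, Finset.mul_sum]
  refine HasDerivAt.add_const _ (HasDerivAt.fun_sum fun j _ => ?_)
  have h := (((hasDerivAt_id y).sub_const x).pow (j + 1)).const_mul
    (binCoeff μ (j + 1) * x ^ (μ - (j + 1 : ℕ)))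
  refine h.congr_deriv ?_
  have : ((j : ℝ) + 1) ≠ 0 := by positivity
  have e2 : μ - ((j + 1 : ℕ) : ℝ) = μ - 1 - j := by push_cast; ring
  rw [e2, binCoeff]
  simp only [Nat.add_sub_cancel, id]
  push_cast
  field_simp

theorem rpow_le_add_of_mem_uIcc {x y z : ℝ} (hx : 0 < x) (hy : 0 < y) (hz : z ∈ Set.uIcc x y)
    (p : ℝ) : z ^ p ≤ x ^ p + y ^ p := by
  have hx' : 0 < x ^ p := Real.rpow_pos_of_pos hx p
  have hy' : 0 < y ^ p := Real.rpow_pos_of_pos hy p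
  have hz0 : 0 < z := (lt_min hx hy).trans_le hz.1
  rcases le_total 0 p with hp | hp
  · rcases le_total x y with h | h
    · rw [Set.uIcc_of_le h] at hz
      linarith [Real.rpow_le_rpow hz0.le hz.2 hp]
    · rw [Set.uIcc_of_ge h] at hz
      linarith [Real.rpow_le_rpow hz0.le hz.2 hp]
  · rcases le_total x y with h | h
    · rw [Set.uIcc_of_le h] at hz
      linarith [Real.rpow_le_rpow_of_nonpos hx hz.1 hp]
    · rw [Set.uIcc_of_ge h] at hz
      linarith [Real.rpow_le_rpow_of_nonpos hy hz.1 hp]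

/-- The derivative in $y$ of the remainder for $\mu$ is $\mu$ times the shorter remainder for
$\mu-1$, so the mean value inequality gives an induction. The two endpoint powers are added because
$x$ and $y$ need not be comparable in size. -/
theorem abs_rpow_sub_powTaylor_le (N : ℕ) : ∀ μ : ℝ, ∃ C : ℝ, 0 ≤ C ∧ ∀ x y : ℝ, 0 < x → 0 < y →
    |y ^ μ - powTaylor μ N x y| ≤ C * |y - x| ^ N * (x ^ (μ - N) + y ^ (μ - N)) := by
  induction N with
  | zero =>
    intro μ
    refine ⟨1, zero_le_one, fun x y hx hy => ?_⟩
    have hx' : 0 < x ^ μ := Real.rpow_pos_of_pos hx μ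
    have hy' : 0 < y ^ μ := Real.rpow_pos_of_pos hy μ
    simp [powTaylor, abs_of_pos hy', hx'.le]
  | succ N ih =>
    intro μ
    obtain ⟨C, hC0, hC⟩ := ih (μ - 1)
    refine ⟨|μ| * (C * 2), by positivity, fun x y hx hy => ?_⟩
    set q : ℝ := μ - (N + 1 : ℕ) with hq
    have hx' : 0 < x ^ q := Real.rpow_pos_of_pos hx q
    have hy' : 0 < y ^ q := Real.rpow_pos_of_pos hy q
    have hd : ∀ z ∈ Set.uIcc x y, HasDerivWithinAt (fun z => z ^ μ - powTaylor μ (N + 1) x z)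
        (μ * (z ^ (μ - 1) - powTaylor (μ - 1) N x z)) (Set.uIcc x y) z := by
      intro z hz
      have hz0 : 0 < z := (lt_min hx hy).trans_le hz.1
      refine (((Real.hasDerivAt_rpow_const (p := μ) (Or.inl hz0.ne')).sub
        (hasDerivAt_powTaylor μ N x z)).congr_deriv (by ring)).hasDerivWithinAt
    have hb : ∀ z ∈ Set.uIcc x y, ‖μ * (z ^ (μ - 1) - powTaylor (μ - 1) N x z)‖ ≤
        |μ| * (C * |y - x| ^ N * (2 * (x ^ q + y ^ q))) := by
      intro z hz
      have hz0 : 0 < z := (lt_min hx hy).trans_le hz.1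
      have h1 := hC x z hx hz0
      have e : μ - 1 - N = q := by rw [hq]; push_cast; ring
      rw [e] at h1
      have h2 := rpow_le_add_of_mem_uIcc hx hy hz q
      have h3 : |z - x| ≤ |y - x| := by
        rw [Set.mem_uIcc] at hz
        rcases hz with h | h
        · rw [abs_of_nonneg (by linarith), abs_of_nonneg (by linarith)]; linarith
        · rw [abs_of_nonpos (by linarith), abs_of_nonpos (by linarith)]; linarith
      have hz' : 0 < z ^ q := Real.rpow_pos_of_pos hz0 q
      rw [norm_mul, Real.norm_eq_abs, Real.norm_eq_abs]
      refine mul_le_mul_of_nonneg_left (h1.trans ?_) (abs_nonneg _)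
      gcongr
      linarith
    have := (convex_uIcc x y).norm_image_sub_le_of_norm_hasDerivWithin_le hd hb
      Set.left_mem_uIcc Set.right_mem_uIcc
    rw [powTaylor_self, sub_self, sub_zero, Real.norm_eq_abs, Real.norm_eq_abs] at this
    refine this.trans (le_of_eq ?_)
    rw [pow_succ]
    ring

/-! ## Symbols -/

/-- A function whose derivative decays is asymptotically constant. -/
theorem exists_abs_sub_const_le {g g' : ℝ → ℝ} {p C : ℝ} (hp : 0 < p)
    (hg : ∀ x, 1 ≤ x → HasDerivAt g (g' x) x) (hb : ∀ x, 1 ≤ x → |g' x| ≤ C * x ^ (-p - 1)) :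
    ∃ a C', 0 ≤ C' ∧ ∀ x, 1 ≤ x → |g x - a| ≤ C' * x ^ (-p) := by
  have hC0 : 0 ≤ C := by simpa using (abs_nonneg _).trans (hb 1 le_rfl)
  have hpd : ∀ x : ℝ, 1 ≤ x → HasDerivAt (fun x : ℝ => C / p * x ^ (-p)) (-(C * x ^ (-p - 1))) x := by
    intro x hx
    have := (Real.hasDerivAt_rpow_const (x := x) (p := -p) (Or.inl (by linarith))).const_mul (C / p)
    refine this.congr_deriv ?_
    field_simp
  -- With either sign of $g$, subtracting $(C/p)x^{-p}$ gives a monotone function; the two together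
  -- bracket a limit of $g$ within $(C/p)x^{-p}$.
  have hmono : ∀ σ : ℝ, |σ| = 1 → MonotoneOn (fun x => σ * g x - C / p * x ^ (-p)) (Set.Ici 1) := by
    intro σ hσ
    have hd : ∀ x, 1 ≤ x → HasDerivAt (fun x => σ * g x - C / p * x ^ (-p))
        (σ * g' x - -(C * x ^ (-p - 1))) x := fun x hx => ((hg x hx).const_mul σ).sub (hpd x hx)
    refine monotoneOn_of_deriv_nonneg (convex_Ici 1)
      (fun x hx => (hd x hx).continuousAt.continuousWithinAt)
      (fun x hx => (hd x (interior_subset hx)).differentiableAt.differentiableWithinAt)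
      fun x hx => ?_
    have hx1 : 1 ≤ x := interior_subset hx
    rw [(hd x hx1).deriv]
    have h1 := neg_abs_le (σ * g' x)
    rw [abs_mul, hσ, one_mul] at h1
    linarith [hb x hx1]
  have h1 := hmono 1 (by simp)
  have h2 := hmono (-1) (by simp)
  set S : Set ℝ := (fun x => 1 * g x - C / p * x ^ (-p)) '' Set.Ici 1 with hS
  have ub : ∀ y, 1 ≤ y → ∀ x, 1 ≤ x → 1 * g x - C / p * x ^ (-p) ≤ g y + C / p * y ^ (-p) := by
    intro y hy x hx
    have hz : 1 ≤ max x y := le_max_of_le_left hx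
    have a1 := h1 (show x ∈ Set.Ici 1 from hx) (show max x y ∈ Set.Ici 1 from hz) (le_max_left _ _)
    have a2 := h2 (show y ∈ Set.Ici 1 from hy) (show max x y ∈ Set.Ici 1 from hz) (le_max_right _ _)
    have a3 : 0 ≤ C / p * max x y ^ (-p) := by positivity
    simp only at a1 a2
    linarith
  refine ⟨sSup S, C / p, by positivity, fun x hx => ?_⟩
  have u1 : sSup S ≤ g x + C / p * x ^ (-p) := csSup_le ⟨_, 1, le_refl (1 : ℝ), rfl⟩ (by
    rintro _ ⟨z, hz, rfl⟩
    exact ub x hx z hz)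
  have u2 : 1 * g x - C / p * x ^ (-p) ≤ sSup S := le_csSup ⟨_, by
    rintro _ ⟨z, hz, rfl⟩
    exact ub 1 le_rfl z hz⟩ ⟨x, hx, rfl⟩
  rw [abs_le]
  constructor <;> linarith

/-- The symbol estimates concern only derivatives of order $k\ge1$, so $f$ is recovered by
integrating the estimate for $k=1$, up to a constant $a$ depending on $N$. The decay needed for this
is $N>\mu$. -/
theorem IsEllipticSymbol.exists_expansion {f : ℝ → ℝ} {μ : ℝ} (hf : IsEllipticSymbol f μ) :
    ∃ c : ℕ → ℝ, 0 < c 0 ∧ ∀ N : ℕ, 1 ≤ N → μ < N → ∃ a C : ℝ, 0 ≤ C ∧ ∀ x, 1 ≤ x →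
      |f x - ∑ j ∈ Finset.range N, c j * x ^ (μ - j) - a| ≤ C * x ^ (μ - N) := by
  obtain ⟨hs, c, hc0, hc⟩ := hf
  refine ⟨c, hc0, fun N hN hμN => ?_⟩
  obtain ⟨C, hC⟩ := hc 1 le_rfl N hN
  have hd : ∀ x : ℝ, 1 ≤ x → DifferentiableAt ℝ
      (fun y => f y - ∑ j ∈ Finset.range N, c j * y ^ (μ - j)) x := by
    intro x hx
    refine (hs.differentiable (by simp) x).sub (DifferentiableAt.fun_sum fun j _ => ?_)
    exact ((Real.differentiableAt_rpow_const_of_ne _ (by linarith)).const_mul _)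
  have := exists_abs_sub_const_le (p := N - μ) (C := C) (by linarith)
    (fun x hx => (hd x hx).hasDerivAt) (fun x hx => by
      have h := hC x hx
      rw [iteratedDeriv_one] at h
      rw [abs_of_nonneg (a := x ^ _) (by positivity)] at h
      have e : -((N : ℝ) - μ) - 1 = μ - N - (1 : ℕ) := by push_cast; ring
      rwa [e])
  obtain ⟨a, C', hC', h⟩ := this
  refine ⟨a, C', hC', fun x hx => ?_⟩
  have := h x hx
  rwa [neg_sub] at this

end SobolevGrowth
end

noncomputable section
namespace SobolevGrowth
variable {H : Type*} [NormedAddCommGroup H] [InnerProductSpace ℂ H] [CompleteSpace H]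

/-! ## Multipliers built from powers and symbols of `K₀` -/

open ReferenceOperator ReferenceOperator.IsDiscrete

variable {K : ReferenceOperator H} {lam : ℝ} {𝒜 : OperatorClasses K}

namespace ReferenceOperator.IsDiscrete

theorem ev_rpow_le (D : K.IsDiscrete lam) {a b : ℝ} (h : a ≤ b) (n : ℕ) :
    ev lam n ^ a ≤ lam ^ (a - b) * ev lam n ^ b := by
  have hp := D.ev_pos n
  have h2 : ev lam n ^ (a - b) ≤ lam ^ (a - b) := by
    refine Real.rpow_le_rpow_of_nonpos D.pos ?_ (by linarith)
    unfold ev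
    linarith [(n.cast_nonneg : (0 : ℝ) ≤ n)]
  calc ev lam n ^ a = ev lam n ^ (a - b) * ev lam n ^ b := by
        rw [← Real.rpow_add hp]; congr 1; ring
    _ ≤ _ := by gcongr

theorem summable_ev_rpow (D : K.IsDiscrete lam) : Summable fun n => ev lam n ^ (-2 : ℝ) := by
  have := (Real.summable_one_div_nat_add_rpow lam 2).2 (by norm_num)
  refine this.congr fun n => ?_
  have hp := D.ev_pos n
  change 1 / |ev lam n| ^ (2 : ℝ) = _
  rw [abs_of_pos hp, Real.rpow_neg hp.le, one_div]

/-- Operators with rapidly decaying matrix elements are smoothing. -/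
theorem isSmoothing_of_block (D : K.IsDiscrete lam) {N m : ℝ} {S : Module.End ℂ K.smooth}
    (hS : K.IsOfOrder m S)
    (h : ∀ κ : ℝ, ∃ C, ∀ n k (ψ : H), ‖K.block lam n (S (D.blk k ψ) : H)‖ ≤
      C * ev lam n ^ (-(κ + N + 1)) * ev lam k ^ (κ - 2) * ‖K.block lam k ψ‖) :
    K.IsSmoothing N S := by
  intro κ
  obtain ⟨C', hC'⟩ := h κ
  obtain ⟨C, hC0, hC⟩ : ∃ C, 0 ≤ C ∧ ∀ n k (ψ : H), ‖K.block lam n (S (D.blk k ψ) : H)‖ ≤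
      C * ev lam n ^ (-(κ + N + 1)) * ev lam k ^ (κ - 2) * ‖K.block lam k ψ‖ := by
    refine ⟨|C'|, abs_nonneg _, fun n k ψ => (hC' n k ψ).trans ?_⟩
    have := D.ev_pos n
    have := D.ev_pos k
    gcongr
    exact le_abs_self _
  set Q := ∑' n, ev lam n ^ (-2 : ℝ) with hQ
  have hQs := D.summable_ev_rpow
  have hQ0 : 0 ≤ Q := tsum_nonneg fun n => (Real.rpow_pos_of_pos (D.ev_pos n) _).le
  -- One factor $Q$ comes from summing $(k+\lambda)^{-2}$ over columns. The square sum over rows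
  -- contributes $\sqrt Q$, replaced by the larger $1+Q$.
  refine ⟨C * Q * (1 + Q), fun ψ => ?_⟩
  set M := K.sob κ ψ with hM
  have hM0 : 0 ≤ M := apply_nonneg _ _
  have hb : ∀ n, ‖K.block lam n (S ψ : H)‖ ≤ C * Q * M * ev lam n ^ (-(κ + N + 1)) := by
    intro n
    have hn := Real.rpow_pos_of_pos (D.ev_pos n) (-(κ + N + 1))
    have h1 : ∀ k, ‖K.block lam n (S (D.blk k (ψ : H)) : H)‖ ≤
        C * ev lam n ^ (-(κ + N + 1)) * M * ev lam k ^ (-2 : ℝ) := by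
      intro k
      have hk := D.ev_pos k
      refine (hC n k ψ).trans ?_
      have h2 := D.norm_block_le_sob κ k ψ
      rw [sub_eq_add_neg, Real.rpow_add hk]
      calc _ = C * ev lam n ^ (-(κ + N + 1)) * (ev lam k ^ κ * ‖K.block lam k (ψ : H)‖) *
            ev lam k ^ (-2 : ℝ) := by ring
        _ ≤ _ := by gcongr
    have hs := hQs.mul_left (C * ev lam n ^ (-(κ + N + 1)) * M)
    have hsum := Summable.of_norm_bounded hs h1
    have h3 := D.hasSum_block_apply hS ψ n hsum
    rw [← h3.tsum_eq]
    refine (tsum_of_norm_bounded hs.hasSum h1).trans (le_of_eq ?_)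
    rw [tsum_mul_left]
    ring
  rw [sub_neg_eq_add]
  have hsq := D.hasSum_sob_sq (κ + N) (S ψ)
  have h4 : K.sob (κ + N) (S ψ) ^ 2 ≤ (C * Q * M) ^ 2 * Q := by
    refine hasSum_le (fun n => ?_) hsq (hQs.hasSum.mul_left ((C * Q * M) ^ 2))
    have hn := D.ev_pos n
    calc ev lam n ^ (2 * (κ + N)) * ‖K.block lam n (S ψ : H)‖ ^ 2
        ≤ ev lam n ^ (2 * (κ + N)) * (C * Q * M * ev lam n ^ (-(κ + N + 1))) ^ 2 := by
          gcongr; exact hb n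
      _ = (C * Q * M) ^ 2 * (ev lam n ^ (2 * (κ + N)) * (ev lam n ^ (-(κ + N + 1)) *
            ev lam n ^ (-(κ + N + 1)))) := by ring
      _ = _ := by
          rw [← Real.rpow_add hn, ← Real.rpow_add hn]
          congr 2
          ring
  refine abs_le_of_sq_le_sq' ?_ (by positivity) |>.2
  refine h4.trans ?_
  have : (C * Q * (1 + Q) * M) ^ 2 = (C * Q * M) ^ 2 * (1 + Q) ^ 2 := by ring
  rw [this]
  gcongr
  nlinarith

/-- Boundedness on all the spaces $\mathcal H^s$ leaves $s$ free, which allows decay to be moved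
between the row and the column. -/
theorem norm_block_apply_blk_le (D : K.IsDiscrete lam) {m : ℝ} {B : Module.End ℂ K.smooth}
    (hB : K.IsOfOrder m B) (s : ℝ) : ∃ C, 0 ≤ C ∧ ∀ n k (ψ : H),
      ‖K.block lam n (B (D.blk k ψ) : H)‖ ≤
        C * ev lam n ^ (m - s) * ev lam k ^ s * ‖K.block lam k ψ‖ := by
  obtain ⟨C, hC⟩ := hB s
  refine ⟨|C|, abs_nonneg _, fun n k ψ => ?_⟩
  have h1 := (D.norm_block_le_sob (s - m) n (B (D.blk k ψ))).trans (hC _)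
  rw [D.sob_blk] at h1
  have hn := D.ev_pos n
  have hk := D.ev_pos k
  have hn' := Real.rpow_pos_of_pos hn (m - s)
  calc ‖K.block lam n (B (D.blk k ψ) : H)‖
      = ev lam n ^ (m - s) * (ev lam n ^ (s - m) * ‖K.block lam n (B (D.blk k ψ) : H)‖) := by
        rw [← mul_assoc, ← Real.rpow_add hn]; simp
    _ ≤ ev lam n ^ (m - s) * (|C| * (ev lam k ^ s * ‖K.block lam k ψ‖)) := by
        refine mul_le_mul_of_nonneg_left (h1.trans ?_) hn'.le
        gcongr
        exact le_abs_self _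
    _ = _ := by ring

theorem diag_eq (D : K.IsDiscrete lam) {g : ℝ → ℂ} (hg : Tempered lam g)
    {A : Module.End ℂ K.smooth}
    (h : ∀ n (ψ : K.smooth), K.block lam n (A ψ : H) = g (ev lam n) • K.block lam n (ψ : H)) :
    K.diag g = A := by
  ext1 ψ
  exact D.ext_smooth fun n => by rw [D.block_diag hg, h]

end ReferenceOperator.IsDiscrete

namespace IsGradedAlgebra

/-- Each factor is one commutator with $K_0$, and commutators with an operator of order one preserve
the class. The off-diagonal entries thus decay to every order in $n-k$ without loss of order. -/
theorem exists_mult_sub_pow (hI : IsGradedAlgebra 𝒜) (D : K.IsDiscrete lam) {m : ℝ}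
    {A : Module.End ℂ K.smooth} (hA : A ∈ 𝒜.cls m) (N : ℕ) :
    ∃ B ∈ 𝒜.cls m, D.IsMult (fun n k => (((ev lam k - ev lam n) ^ N : ℝ) : ℂ)) A B := by
  induction N with
  | zero => exact ⟨A, hA, (IsMult.one A).congr fun n k => by simp⟩
  | succ N ih =>
    obtain ⟨B, hB, hBm⟩ := ih
    have ht := D.tempered_rpow 1
    have h1 := hI.commutator_mem m 1 B hB _ (hI.diag_rpow_mem D 1)
    rw [add_sub_cancel_right] at h1
    refine ⟨_, h1, ((hBm.mul_diag ht).sub (hBm.diag_mul ht)).congr fun n k => ?_⟩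
    rw [Real.rpow_one, Real.rpow_one]
    push_cast
    ring

/-- The first order Taylor remainder of `x ^ μ`, as a multiplier, gains two orders. -/
theorem exists_mult_rpow_remainder (hI : IsGradedAlgebra 𝒜) (D : K.IsDiscrete lam) (μ : ℝ) {m : ℝ}
    {A : Module.End ℂ K.smooth} (hA : A ∈ 𝒜.cls m) :
    ∃ B ∈ 𝒜.cls (m + μ - 2),
      D.IsMult (fun n k => ((ev lam k ^ μ - powTaylor μ 2 (ev lam n) (ev lam k) : ℝ) : ℂ)) A B := by
  choose B hB hBm using hI.exists_mult_sub_pow D hA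
  -- These are the Taylor terms realized as operators of order $m+\mu-j$. Terms with $2\le j<N$ lie
  -- in the claimed class; the remainder after $N$ terms is smoothing, to a degree that grows with
  -- $N$, so axiom (v) applies.
  let T : ℕ → Module.End ℂ K.smooth := fun j =>
    (binCoeff μ j : ℂ) • (K.diag (fun x => ((x ^ (μ - j) : ℝ) : ℂ)) * B j)
  have hTc : ∀ j : ℕ, T j ∈ 𝒜.cls (μ - j + m) := fun j =>
    Submodule.smul_mem _ _ (hI.mul_mem _ _ _ (hI.diag_rpow_mem D _) _ (hB j))
  have hTm : ∀ N, D.IsMult (fun n k => (powTaylor μ N (ev lam n) (ev lam k) : ℂ)) A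
      (∑ j ∈ Finset.range N, T j) := fun N =>
    (IsMult.sum fun j _ => ((hBm j).diag_mul (D.tempered_rpow (μ - j))).smul (binCoeff μ j)).congr
      fun n k => by
        rw [powTaylor]
        push_cast
        exact Finset.sum_congr rfl fun j _ => by ring
  have hA0 : D.IsMult (fun n k => ((ev lam k ^ μ : ℝ) : ℂ)) A
      (A * K.diag fun x => ((x ^ μ : ℝ) : ℂ)) :=
    ((IsMult.one A).mul_diag (D.tempered_rpow μ)).congr fun n k => one_mul _
  have hRm : ∀ N, D.IsMult
      (fun n k => ((ev lam k ^ μ - powTaylor μ N (ev lam n) (ev lam k) : ℝ) : ℂ)) A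
      ((A * K.diag fun x => ((x ^ μ : ℝ) : ℂ)) - ∑ j ∈ Finset.range N, T j) := fun N =>
    (hA0.sub (hTm N)).congr fun n k => by push_cast; rfl
  refine ⟨_, ?_, hRm 2⟩
  refine hI.smoothing_perturbation _ _ fun N' hN' => ?_
  -- Degree $N'$ requires row decay $-(\kappa+N'+1)$ and column weight $\kappa-2$; the excess
  -- $1+2=3$ is the price of summability.
  obtain ⟨N, hN⟩ := exists_nat_ge (max 2 (μ + m + N' + 3))
  have hN2 : 2 ≤ N := by exact_mod_cast (le_max_left _ _).trans hN
  have hN3 : μ + m + N' + 3 ≤ N := (le_max_right _ _).trans hN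
  refine ⟨∑ j ∈ Finset.Ico 2 N, T j, ?_, _, ?_,
    (?_ : _ = _ + ((A * K.diag fun x => ((x ^ μ : ℝ) : ℂ)) - ∑ j ∈ Finset.range N, T j))⟩
  · refine Submodule.sum_mem _ fun j hj => hI.cls_mono ?_ (hTc j)
    have : (2 : ℝ) ≤ j := by exact_mod_cast (Finset.mem_Ico.1 hj).1
    linarith
  · have hord : ((A * K.diag fun x => ((x ^ μ : ℝ) : ℂ)) - ∑ j ∈ Finset.range N, T j) ∈
        𝒜.cls (m + μ) := by
      refine Submodule.sub_mem _ (hI.mul_mem _ _ _ hA _ (hI.diag_rpow_mem D μ)) ?_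
      refine Submodule.sum_mem _ fun j hj => hI.cls_mono ?_ (hTc j)
      linarith [(j.cast_nonneg : (0 : ℝ) ≤ j)]
    refine D.isSmoothing_of_block (hI.isOfOrder _ _ hord) fun κ => ?_
    obtain ⟨C, hC0, hC⟩ := abs_rpow_sub_powTaylor_le N μ
    -- The two choices of the Sobolev exponent serve the two endpoint powers. For $x^{\mu-N}$ the
    -- column weight is already right and the surplus decay is in the row; for $y^{\mu-N}$ the roles
    -- are exchanged.
    obtain ⟨C₁, h10, h1⟩ := D.norm_block_apply_blk_le (hI.isOfOrder _ _ (hB N)) (κ - 2)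
    obtain ⟨C₂, h20, h2⟩ := D.norm_block_apply_blk_le (hI.isOfOrder _ _ (hB N)) (κ + N' + 1 + m)
    refine ⟨C * (C₁ * lam ^ ((μ - N + (m - (κ - 2))) - (-(κ + N' + 1))) +
      C₂ * lam ^ ((μ - N + (κ + N' + 1 + m)) - (κ - 2))), fun n k ψ => ?_⟩
    have hn := D.ev_pos n
    have hk := D.ev_pos k
    have e1 := h1 n k ψ
    have e2 := h2 n k ψ
    set x := ev lam n with hx
    set y := ev lam k with hy
    set b := ‖K.block lam n (B N (D.blk k ψ) : H)‖ with hb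
    have hbA : |y - x| ^ N * ‖K.block lam n (A (D.blk k ψ) : H)‖ = b := by
      rw [hb, hBm, norm_smul, Complex.norm_real, Real.norm_eq_abs, abs_pow]
    have f1 : x ^ (μ - N) * b ≤ C₁ * lam ^ ((μ - N + (m - (κ - 2))) - (-(κ + N' + 1))) *
        x ^ (-(κ + N' + 1)) * y ^ (κ - 2) * ‖K.block lam k ψ‖ := by
      have := D.ev_rpow_le (a := μ - N + (m - (κ - 2))) (b := -(κ + N' + 1)) (by linarith) n
      rw [← hx] at this
      calc x ^ (μ - N) * b ≤ x ^ (μ - N) *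
            (C₁ * x ^ (m - (κ - 2)) * y ^ (κ - 2) * ‖K.block lam k ψ‖) := by gcongr
        _ = C₁ * x ^ (μ - N + (m - (κ - 2))) * y ^ (κ - 2) * ‖K.block lam k ψ‖ := by
            rw [Real.rpow_add hn (μ - N)]; ring
        _ ≤ C₁ * (lam ^ ((μ - N + (m - (κ - 2))) - (-(κ + N' + 1))) * x ^ (-(κ + N' + 1))) *
            y ^ (κ - 2) * ‖K.block lam k ψ‖ := by gcongr
        _ = _ := by ring
    have f2 : y ^ (μ - N) * b ≤ C₂ * lam ^ ((μ - N + (κ + N' + 1 + m)) - (κ - 2)) *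
        x ^ (-(κ + N' + 1)) * y ^ (κ - 2) * ‖K.block lam k ψ‖ := by
      have := D.ev_rpow_le (a := μ - N + (κ + N' + 1 + m)) (b := κ - 2) (by linarith) k
      rw [← hy] at this
      have e3 : m - (κ + N' + 1 + m) = -(κ + N' + 1) := by ring
      rw [e3] at e2
      calc y ^ (μ - N) * b ≤ y ^ (μ - N) *
            (C₂ * x ^ (-(κ + N' + 1)) * y ^ (κ + N' + 1 + m) * ‖K.block lam k ψ‖) := by gcongr
        _ = C₂ * x ^ (-(κ + N' + 1)) * y ^ (μ - N + (κ + N' + 1 + m)) * ‖K.block lam k ψ‖ := by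
            rw [Real.rpow_add hk (μ - N)]; ring
        _ ≤ C₂ * x ^ (-(κ + N' + 1)) * (lam ^ ((μ - N + (κ + N' + 1 + m)) - (κ - 2)) *
            y ^ (κ - 2)) * ‖K.block lam k ψ‖ := by gcongr
        _ = _ := by ring
    rw [hRm N n k ψ, norm_smul, Complex.norm_real, Real.norm_eq_abs]
    calc |y ^ μ - powTaylor μ N x y| * ‖K.block lam n (A (D.blk k ψ) : H)‖
        ≤ C * |y - x| ^ N * (x ^ (μ - N) + y ^ (μ - N)) * ‖K.block lam n (A (D.blk k ψ) : H)‖ := by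
          gcongr; exact hC x y hn hk
      _ = C * (x ^ (μ - N) * b + y ^ (μ - N) * b) := by rw [← hbA]; ring
      _ ≤ C * (C₁ * lam ^ ((μ - N + (m - (κ - 2))) - (-(κ + N' + 1))) *
            x ^ (-(κ + N' + 1)) * y ^ (κ - 2) * ‖K.block lam k ψ‖ +
            C₂ * lam ^ ((μ - N + (κ + N' + 1 + m)) - (κ - 2)) *
            x ^ (-(κ + N' + 1)) * y ^ (κ - 2) * ‖K.block lam k ψ‖) := by gcongr
      _ = _ := by ring
  · rw [Finset.sum_Ico_eq_sub _ hN2]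
    abel

/-- Terms of the expansion beyond the leading one have order at most $\mu-1$, and so does the
integration constant, because $\mu>1$. The remainder is a decaying function of $K_0$, hence
smoothing. The constant may vary with $N$, since axiom (v) allows a different decomposition for each
degree. -/
theorem exists_diag_symbol (hI : IsGradedAlgebra 𝒜) (D : K.IsDiscrete lam) {f : ℝ → ℝ} {μ : ℝ}
    (hμ : 1 < μ) (hf : IsEllipticSymbol f μ) : ∃ c₀ : ℝ, 0 < c₀ ∧
      (Tempered lam fun x => (f x : ℂ)) ∧
      K.diag (fun x => (f x : ℂ)) - (c₀ : ℂ) • K.diag (fun x => ((x ^ μ : ℝ) : ℂ)) ∈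
        𝒜.cls (μ - 1) := by
  obtain ⟨c, hc0, hc⟩ := hf.exists_expansion
  have key : ∀ N : ℕ, 1 ≤ N → μ < N → ∃ a C : ℝ, ∀ n,
      ‖((f (ev lam n) - ∑ j ∈ Finset.range N, c j * ev lam n ^ (μ - j) - a : ℝ) : ℂ)‖ ≤
        C * ev lam n ^ (μ - N) := by
    intro N hN hμN
    obtain ⟨a, C, hC0, hC⟩ := hc N hN hμN
    refine ⟨a, C + |f (ev lam 0) - ∑ j ∈ Finset.range N, c j * ev lam 0 ^ (μ - j) - a| /
      ev lam 0 ^ (μ - N), fun n => ?_⟩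
    rw [Complex.norm_real, Real.norm_eq_abs]
    have hp0 := Real.rpow_pos_of_pos (D.ev_pos 0) (μ - N)
    -- The lowest value $\lambda$ may be less than $1$, outside the range of the symbol estimates;
    -- its contribution has been added to the constant.
    rcases Nat.eq_zero_or_pos n with rfl | hn
    · rw [add_mul, div_mul_cancel₀ _ hp0.ne']
      have : 0 ≤ C * ev lam 0 ^ (μ - N) := by positivity
      linarith
    · have h1 : 1 ≤ ev lam n := by
        have : (1 : ℝ) ≤ n := by exact_mod_cast hn
        unfold ev
        linarith [D.pos]
      have hp := D.ev_pos n
      refine (hC _ h1).trans ?_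
      gcongr
      linarith [div_nonneg (abs_nonneg (f (ev lam 0) -
        ∑ j ∈ Finset.range N, c j * ev lam 0 ^ (μ - j) - a)) hp0.le]
  have tsum' : ∀ (N : ℕ) (a : ℝ), ∃ B, B ∈ 𝒜.cls (μ - 1) ∧ ∀ n (ψ : K.smooth),
      K.block lam n (B ψ : H) = ((∑ j ∈ Finset.range N, c (j + 1) * ev lam n ^ (μ - (j + 1 : ℕ)) + a : ℝ)
        : ℂ) • K.block lam n (ψ : H) := by
    intro N a
    refine ⟨∑ j ∈ Finset.range N, (c (j + 1) : ℂ) •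
      K.diag (fun x => ((x ^ (μ - (j + 1 : ℕ)) : ℝ) : ℂ)) + (a : ℂ) • 1, ?_, fun n ψ => ?_⟩
    · refine Submodule.add_mem _ (Submodule.sum_mem _ fun j _ => Submodule.smul_mem _ _ ?_)
        (Submodule.smul_mem _ _ (hI.cls_mono (by linarith) (hI.one_mem D)))
      refine hI.cls_mono ?_ (hI.diag_rpow_mem D _)
      push_cast
      linarith [(j.cast_nonneg : (0 : ℝ) ≤ j)]
    · simp only [LinearMap.add_apply, LinearMap.sum_apply, LinearMap.smul_apply, Module.End.one_apply,
        Submodule.coe_add, Submodule.coe_sum, Submodule.coe_smul, map_add, map_sum, map_smul,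
        D.block_diag (D.tempered_rpow _), smul_smul]
      rw [← Finset.sum_smul, ← add_smul]
      push_cast
      rfl
  have htf : Tempered lam fun x => (f x : ℂ) := by
    obtain ⟨N, hN⟩ := exists_nat_gt μ
    obtain ⟨a, C, hC⟩ := key N (by exact_mod_cast (hμ.trans hN).le) hN
    refine ⟨|C| * lam ^ ((μ - N) - μ) + (∑ j ∈ Finset.range N, |c j| * lam ^ ((μ - j) - μ)) +
      |a| * lam ^ (0 - μ), μ, fun n => ?_⟩
    have hn := D.ev_pos n
    have h1 : |f (ev lam n) - ∑ j ∈ Finset.range N, c j * ev lam n ^ (μ - j) - a| ≤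
        |C| * (lam ^ ((μ - N) - μ) * ev lam n ^ μ) := by
      rw [← Real.norm_eq_abs, ← Complex.norm_real]
      refine (hC n).trans (mul_le_mul (le_abs_self _)
        (D.ev_rpow_le (by linarith [(N.cast_nonneg : (0 : ℝ) ≤ N)]) n) (by positivity) (by positivity))
    have h2 : |∑ j ∈ Finset.range N, c j * ev lam n ^ (μ - j)| ≤
        ∑ j ∈ Finset.range N, |c j| * lam ^ ((μ - j) - μ) * ev lam n ^ μ := by
      refine (Finset.abs_sum_le_sum_abs _ _).trans (Finset.sum_le_sum fun j _ => ?_)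
      rw [abs_mul, abs_of_pos (Real.rpow_pos_of_pos hn _), mul_assoc]
      exact mul_le_mul_of_nonneg_left
        (D.ev_rpow_le (by linarith [(j.cast_nonneg : (0 : ℝ) ≤ j)]) n) (abs_nonneg _)
    have h3 : |a| ≤ |a| * (lam ^ (0 - μ) * ev lam n ^ μ) := by
      have := D.ev_rpow_le (a := 0) (b := μ) (by linarith) n
      rw [Real.rpow_zero] at this
      nlinarith [abs_nonneg a]
    rw [Complex.norm_real, Real.norm_eq_abs, add_mul, add_mul, Finset.sum_mul]
    calc |f (ev lam n)| = |(f (ev lam n) - ∑ j ∈ Finset.range N, c j * ev lam n ^ (μ - j) - a) +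
          ∑ j ∈ Finset.range N, c j * ev lam n ^ (μ - j) + a| := by congr 1; ring
      _ ≤ _ := abs_add_three _ _ _
      _ ≤ _ := by linarith
  refine ⟨c 0, hc0, htf, hI.smoothing_perturbation _ _ fun N' hN' => ?_⟩
  obtain ⟨N, hN⟩ := exists_nat_gt (μ + N')
  have hNμ : μ < (N + 1 : ℕ) := by push_cast; linarith
  obtain ⟨a, C, hC⟩ := key (N + 1) (by omega) hNμ
  obtain ⟨B, hB, hBb⟩ := tsum' N a
  set g : ℝ → ℂ := fun x =>
    ((f x - ∑ j ∈ Finset.range (N + 1), c j * x ^ (μ - j) - a : ℝ) : ℂ) with hg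
  have hgt : Tempered lam g := ⟨C, _, hC⟩
  refine ⟨B, hB, K.diag g, fun s => ?_, ?_⟩
  · obtain ⟨C', -, hC'⟩ := D.sob_mono (r := s - -N') (s := s - (μ - (N + 1 : ℕ)))
      (by push_cast; linarith)
    refine ⟨|C'| * C, fun ψ => (hC' _).trans ?_⟩
    rw [mul_assoc]
    exact mul_le_mul (le_abs_self _) (D.sob_diag_le hC s ψ) (apply_nonneg _ _) (abs_nonneg _)
  · rw [sub_eq_iff_eq_add]
    refine D.diag_eq htf fun n ψ => ?_
    simp only [LinearMap.add_apply, LinearMap.smul_apply, Submodule.coe_add, Submodule.coe_smul,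
      map_add, map_smul, hBb, D.block_diag hgt, D.block_diag (D.tempered_rpow μ), smul_smul]
    rw [← add_smul, ← add_smul]
    congr 1
    simp only [hg]
    rw [Finset.sum_range_succ']
    push_cast
    simp only [sub_zero]
    ring

end IsGradedAlgebra

end SobolevGrowth
end

noncomputable section
namespace SobolevGrowth
variable {H : Type*} [NormedAddCommGroup H] [InnerProductSpace ℂ H] [CompleteSpace H]

/-! ## Modified energies -/

open ReferenceOperator ReferenceOperator.IsDiscrete

variable {K : ReferenceOperator H} {lam : ℝ} {𝒜 : OperatorClasses K}

namespace IsGradedAlgebra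

theorem isOfOrder_of_mem_timeClass (hI : IsGradedAlgebra 𝒜) {m : ℝ} {W : ℝ → Module.End ℂ K.smooth}
    (hW : W ∈ timeClass 𝒜 m) (t : ℝ) : K.IsOfOrder m (W t) := fun s => by
  obtain ⟨C, -, h⟩ := hI.exists_bound hW s
  exact ⟨C, h t⟩

theorem solveMult_mul (n k : ℕ) : solveMult n k * ((k : ℂ) - n) =
    (if n = k then 0 else -(2 * Real.pi * Complex.I)⁻¹) := by
  rw [solveMult]
  split_ifs with h
  · rw [h, sub_self, mul_zero]
  · have h1 : (n : ℂ) - k ≠ 0 := sub_ne_zero.2 (by exact_mod_cast h)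
    have h2 : (k : ℂ) - n = -((n : ℂ) - k) := by ring
    have h3 : (2 * Real.pi * Complex.I : ℂ) ≠ 0 := Complex.two_pi_I_ne_zero
    rw [h2, mul_inv, mul_assoc, mul_neg, inv_mul_cancel₀ h1, mul_neg, mul_one]

/-- Solution of the homological equation up to a gain of one order. -/
theorem exists_homological (hI : IsGradedAlgebra 𝒜) (D : K.IsDiscrete lam)
    (hII : HasEgorovProperty 𝒜) {c₀ μ : ℝ} (hc₀ : 0 < c₀) (hμ : 1 < μ) {w : ℝ}
    {W : ℝ → Module.End ℂ K.smooth} (hW : W ∈ timeClass 𝒜 w) :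
    ∃ X ∈ timeClass 𝒜 (w - μ + 1), ∃ Z ∈ timeClass 𝒜 w,
      (∀ t (g : ℝ → ℂ), Tempered lam g → Commute (Z t) (K.diag g)) ∧
      ∃ R ∈ timeClass 𝒜 (w - 1), ∀ t, Complex.I • (X t * ((c₀ : ℂ) • K.diag fun x => ((x ^ μ : ℝ) : ℂ)) -
        ((c₀ : ℂ) • K.diag fun x => ((x ^ μ : ℝ) : ℂ)) * X t) + W t - Z t = R t := by
  -- The entry of $[X,c_0K_0^\mu]$ is $c_0(y^\mu-x^\mu)X_{nk}$, with leading part $c_0\mu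
  -- x^{\mu-1}(k-n)X_{nk}$. The factor $x^{1-\mu}$ in $X$ removes the power, `solveMult` removes
  -- $k-n$, and $\alpha$ normalizes the off-diagonal result to $-1$ after multiplication by $i$.
  set α : ℂ := 2 * Real.pi / (c₀ * μ) with hα
  have hXc : ∀ A ∈ 𝒜.cls w, ∃ B ∈ 𝒜.cls (w - μ + 1),
      D.IsMult (fun n k => α * (((ev lam n ^ (1 - μ) : ℝ) : ℂ) * solveMult n k)) A B := by
    intro A hA
    obtain ⟨Y, hY, hYm⟩ := hI.exists_solve D hII hA
    refine ⟨_, ?_, (hYm.diag_mul (D.tempered_rpow (1 - μ))).smul α⟩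
    refine Submodule.smul_mem _ _ (hI.cls_mono (le_of_eq ?_)
      (hI.mul_mem _ _ _ (hI.diag_rpow_mem D (1 - μ)) _ hY))
    ring
  have hRc : ∀ A ∈ 𝒜.cls w, ∃ B ∈ 𝒜.cls (w - 1), D.IsMult (fun n k =>
      (Complex.I * c₀ * α) * (((ev lam n ^ (1 - μ) : ℝ) : ℂ) *
        (((ev lam k ^ μ - powTaylor μ 2 (ev lam n) (ev lam k) : ℝ) : ℂ) * solveMult n k))) A B := by
    intro A hA
    obtain ⟨Y, hY, hYm⟩ := hI.exists_solve D hII hA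
    obtain ⟨B, hB, hBm⟩ := hI.exists_mult_rpow_remainder D μ hY
    have hBm' : D.IsMult (fun n k =>
        ((ev lam k ^ μ - powTaylor μ 2 (ev lam n) (ev lam k) : ℝ) : ℂ) * solveMult n k) A B :=
      fun n k ψ => by rw [hBm, hYm, smul_smul]
    refine ⟨_, ?_, (hBm'.diag_mul (D.tempered_rpow (1 - μ))).smul _⟩
    refine Submodule.smul_mem _ _ (hI.cls_mono (le_of_eq ?_)
      (hI.mul_mem _ _ _ (hI.diag_rpow_mem D (1 - μ)) _ hB))
    ring
  obtain ⟨X, hX, hXm⟩ := hI.exists_timeClass_mult D hXc hW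
  obtain ⟨Z, hZ, hZm⟩ := hI.exists_timeClass_mult D (fun A hA => hI.exists_average D hII hA) hW
  obtain ⟨R, hR, hRm⟩ := hI.exists_timeClass_mult D hRc hW
  refine ⟨X, hX, Z, hZ, fun t g hg => ?_, R, hR, fun t => ?_⟩
  · refine LinearMap.ext fun ψ => D.ext_smooth fun n => ?_
    rw [Module.End.mul_apply, Module.End.mul_apply, D.block_diag hg]
    -- The average is block diagonal, so its $n$-th output block sees only the $n$-th input block.
    have key : ∀ φ : K.smooth, K.block lam n (Z t φ : H) = K.block lam n (Z t (D.blk n (φ : H)) : H) := by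
      intro φ
      have h0 : ∀ k, k ≠ n → K.block lam n (Z t (D.blk k (φ : H)) : H) = 0 := fun k hk => by
        simp only [hZm t n k, if_neg hk.symm, zero_smul]
      have hs := hasSum_single (f := fun k => K.block lam n (Z t (D.blk k (φ : H)) : H)) n h0
      exact (D.hasSum_block_apply (hI.isOfOrder_of_mem_timeClass hZ t) φ n hs.summable).unique hs
    have e : D.blk n (K.diag g ψ : H) = g (ev lam n) • D.blk n (ψ : H) :=
      Subtype.ext (D.block_diag hg ψ n)
    rw [key (K.diag g ψ), key ψ, e, map_smul, Submodule.coe_smul, map_smul]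
  · have ht := D.tempered_rpow μ
    have hm : D.IsMult (fun n k => Complex.I * (c₀ * (α * (((ev lam n ^ (1 - μ) : ℝ) : ℂ) * solveMult n k) *
        ((ev lam k ^ μ : ℝ) : ℂ)) - c₀ * (((ev lam n ^ μ : ℝ) : ℂ) *
          (α * (((ev lam n ^ (1 - μ) : ℝ) : ℂ) * solveMult n k)))) + 1 - (if n = k then 1 else 0)) (W t)
        (Complex.I • (X t * ((c₀ : ℂ) • K.diag fun x => ((x ^ μ : ℝ) : ℂ)) -
        ((c₀ : ℂ) • K.diag fun x => ((x ^ μ : ℝ) : ℂ)) * X t) + W t - Z t) := by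
      rw [mul_smul_comm, smul_mul_assoc]
      exact ((((((hXm t).mul_diag ht).smul _).sub (((hXm t).diag_mul ht).smul _)).smul _).add
        (IsMult.one _)).sub (hZm t)
    -- A crude finite order is enough: the equality of the two sides is then decided by their matrix
    -- entries.
    have ho : K.IsOfOrder (w + 1) (Complex.I • (X t * ((c₀ : ℂ) • K.diag fun x => ((x ^ μ : ℝ) : ℂ)) -
        ((c₀ : ℂ) • K.diag fun x => ((x ^ μ : ℝ) : ℂ)) * X t) + W t - Z t) := by
      have hK := const_mem_timeClass (hI.diag_rpow_mem D μ)
      have h1 := hI.mul_mem_timeClass hX (Submodule.smul_mem _ (c₀ : ℂ) hK)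
      have h2 := hI.mul_mem_timeClass (Submodule.smul_mem _ (c₀ : ℂ) hK) hX
      have h3 := Submodule.sub_mem _ (hI.timeClass_mono (by linarith : w - μ + 1 + μ ≤ w + 1) h1)
        (hI.timeClass_mono (by linarith : μ + (w - μ + 1) ≤ w + 1) h2)
      exact hI.isOfOrder_of_mem_timeClass (Submodule.sub_mem _ (Submodule.add_mem _
        (Submodule.smul_mem _ Complex.I h3) (hI.timeClass_mono (by linarith) hW))
        (hI.timeClass_mono (by linarith) hZ)) t
    refine IsMult.unique ho (hI.isOfOrder_of_mem_timeClass hR t) hm ((hRm t).congr fun n k => ?_)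
    have hx := D.ev_pos n
    have e1 : powTaylor μ 2 (ev lam n) (ev lam k) =
        ev lam n ^ μ + μ * ev lam n ^ (μ - 1) * ((k : ℝ) - n) := by
      simp [powTaylor, Finset.sum_range_succ, binCoeff, ev]
    have e2 : ((ev lam n ^ (1 - μ) : ℝ) : ℂ) * ((ev lam n ^ (μ - 1) : ℝ) : ℂ) = 1 := by
      rw [← Complex.ofReal_mul, ← Real.rpow_add hx]
      simp
    have e3 := solveMult_mul n k
    have hc : (c₀ : ℂ) ≠ 0 := by exact_mod_cast hc₀.ne'
    have hμ' : (μ : ℂ) ≠ 0 := by exact_mod_cast (by linarith : μ ≠ 0)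
    have hpi : (Real.pi : ℂ) ≠ 0 := by exact_mod_cast Real.pi_ne_zero
    have e4 : Complex.I * c₀ * α * μ * (solveMult n k * ((k : ℂ) - n)) =
        (if n = k then 1 else 0) - 1 := by
      rw [e3]
      split_ifs
      · simp
      · rw [hα]
        field_simp
        simp
    rw [e1]
    push_cast at e2 ⊢
    linear_combination (-Complex.I * c₀ * α * μ * (solveMult n k * ((k : ℂ) - n))) * e2 - e4

/-- The abstract normal form is applied to $P=K_0^p$ in the algebra of time dependent operators. The
order of the Heisenberg derivative can be made as low as desired, while the correction to $K_0^p$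
keeps a fixed gain. -/
theorem exists_modified_energy (hI : IsGradedAlgebra 𝒜) (D : K.IsDiscrete lam)
    (hII : HasEgorovProperty 𝒜) {f : ℝ → ℝ} {μ ρ : ℝ} (hμ : 1 < μ) (hf : IsEllipticSymbol f μ)
    (hρ : ρ < μ) {V : ℝ → Module.End ℂ K.smooth} (hV : V ∈ timeClass 𝒜 ρ) (p M : ℝ) :
    ∃ q < p, ∃ A ∈ timeClass 𝒜 p, ∃ A', IsStrongDeriv A A' ∧
      (A - fun _ => K.diag fun x => ((x ^ p : ℝ) : ℂ)) ∈ timeClass 𝒜 q ∧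
      (A' + Complex.I • (((fun _ => K.diag fun x => (f x : ℂ)) + V) * A -
        A * ((fun _ => K.diag fun x => (f x : ℂ)) + V))) ∈ timeClass 𝒜 M := by
  obtain ⟨c₀, hc₀, htf, hE⟩ := hI.exists_diag_symbol D hμ hf
  set F₀ := K.diag fun x => (f x : ℂ) with hF₀
  set Kμ := K.diag fun x => ((x ^ μ : ℝ) : ℂ) with hKμ
  have hKμc := hI.diag_rpow_mem D μ
  have hF₀c : F₀ ∈ 𝒜.cls μ := by
    have := Submodule.add_mem _ (hI.cls_mono (by linarith : μ - 1 ≤ μ) hE)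
      (Submodule.smul_mem _ (c₀ : ℂ) hKμc)
    rwa [sub_add_cancel] at this
  -- The three bounds reflect the error of the homological equation, the term $\partial X$, and the
  -- commutators of $X$ with the perturbation.
  set δ : ℝ := min 1 (min (μ - 1) (μ - ρ)) with hδ
  have hδ0 : 0 < δ := lt_min one_pos (lt_min (by linarith) (by linarith))
  have hδ1 : δ ≤ 1 := min_le_left _ _
  have hδμ : δ ≤ μ - 1 := (min_le_right _ _).trans (min_le_left _ _)
  have hδρ : δ ≤ μ - ρ := (min_le_right _ _).trans (min_le_right _ _)
  have hP := hI.diag_rpow_mem D p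
  have hcomm : Commute (hI.constOp D hF₀c) (hI.constOp D hP) :=
    Subtype.ext (funext fun _ => D.diag_commute htf (D.tempered_rpow p))
  have hsolve : ∀ w W, W ∈ hI.timeFilt D w → ∃ X ∈ hI.timeFilt D (w - μ + 1),
      ∃ Z ∈ hI.timeFilt D w, Commute Z (hI.constOp D hP) ∧
      Complex.I • cd X (hI.constOp D hF₀c) + W - Z ∈ hI.timeFilt D (w - δ) := by
    intro w W hW
    obtain ⟨X, hX, Z, hZ, hZc, R, hR, hR'⟩ := hI.exists_homological D hII hc₀ hμ hW
    refine ⟨⟨X, _, hX⟩, hX, ⟨Z, _, hZ⟩, hZ,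
      Subtype.ext (funext fun t => hZc t _ (D.tempered_rpow p)), ?_⟩
    -- Replacing $c_0K_0^\mu$ by $f(K_0)$ costs the commutator of $X$ with an operator of order
    -- $\mu-1$, which has order $w-1$.
    have h1 := Submodule.smul_mem _ Complex.I (hI.commutator_mem_timeClass hX (const_mem_timeClass hE))
    have h2 := Submodule.add_mem _ (hI.timeClass_mono (by linarith : w - 1 ≤ w - δ) hR)
      (hI.timeClass_mono (by linarith : w - μ + 1 + (μ - 1) - 1 ≤ w - δ) h1)
    rw [mem_timeFilt]
    convert h2 using 1
    ext1 t
    change Complex.I • (X t * F₀ - F₀ * X t) + W.1 t - Z t = R t + Complex.I •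
      (X t * (F₀ - (c₀ : ℂ) • Kμ) - (F₀ - (c₀ : ℂ) • Kμ) * X t)
    have hr : Complex.I • (X t * ((c₀ : ℂ) • Kμ) - ((c₀ : ℂ) • Kμ) * X t) + W.1 t - Z t = R t :=
      hR' t
    rw [← hr, mul_sub, sub_mul]
    module
  obtain ⟨n, hn⟩ := exists_nat_ge ((ρ + p - 1 - M) / δ)
  have hn' : ρ + p - 1 ≤ M + n * δ := by
    rw [div_le_iff₀ hδ0] at hn
    linarith
  obtain ⟨A, hA, hAP, hAM⟩ := (hI.isOrderFiltration D).exists_approx_invariant (ρ := ρ) hδ0 hδμ hδρ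
    (const_mem_timeClass hF₀c : hI.constOp D hF₀c ∈ hI.timeFilt D μ)
    (const_mem_timeClass hP : hI.constOp D hP ∈ hI.timeFilt D p) hcomm (hI.timeDer_constOp D hP)
    hsolve n ρ le_rfl hn' 0 (Submodule.zero_mem _) (Commute.zero_left _) ⟨V, ρ, hV⟩ hV
  rw [add_zero] at hAM
  exact ⟨p - δ, by linarith, A.1, hA, (hI.timeDer D A).1, hI.timeDer_spec D A, hAP, hAM⟩

end IsGradedAlgebra

end SobolevGrowth
end

noncomputable section
namespace SobolevGrowth

/-! ## Linear differential equations with bounded coefficients -/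

section LinearODE

variable {E : Type*} [NormedAddCommGroup E] [NormedSpace ℝ E]

theorem HasDerivWithinAt.piecewise_Icc {u v : ℝ → E} {u' v' : ℝ → E} {a b c : ℝ} (hab : a ≤ b)
    (hbc : b ≤ c) (hu : ∀ t ∈ Set.Icc a b, HasDerivWithinAt u (u' t) (Set.Icc a b) t)
    (hv : ∀ t ∈ Set.Icc b c, HasDerivWithinAt v (v' t) (Set.Icc b c) t) (h : u b = v b)
    (h' : u' b = v' b) : ∀ t ∈ Set.Icc a c,
      HasDerivWithinAt (fun t => if t ≤ b then u t else v t) (if t ≤ b then u' t else v' t)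
        (Set.Icc a c) t := by
  intro t _
  set w : ℝ → E := fun t => if t ≤ b then u t else v t with hw
  set d : E := if t ≤ b then u' t else v' t with hd
  have wu : ∀ t ∈ Set.Icc a b, w t = u t := fun t ht => if_pos ht.2
  have wv : ∀ t ∈ Set.Icc b c, w t = v t := fun t ht => by
    rcases ht.1.eq_or_lt with rfl | h1
    · simp [hw, h]
    · exact if_neg h1.not_ge
  have l : HasDerivWithinAt w d (Set.Icc a b) t := by
    by_cases ht : t ∈ Set.Icc a b
    · rw [hd, if_pos ht.2]
      exact (hu t ht).congr wu (wu t ht)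
    · exact HasFDerivWithinAt.of_notMem_closure (by rwa [closure_Icc])
  have r : HasDerivWithinAt w d (Set.Icc b c) t := by
    by_cases ht : t ∈ Set.Icc b c
    · have : d = v' t := by
        rcases ht.1.eq_or_lt with rfl | h1
        · simp [hd, h']
        · exact if_neg h1.not_ge
      rw [this]
      exact (hv t ht).congr wv (wv t ht)
    · exact HasFDerivWithinAt.of_notMem_closure (by rwa [closure_Icc])
  have := l.union r
  rwa [Set.Icc_union_Icc_eq_Icc hab hbc] at this

variable {L : ℝ → E →ₗ[ℝ] E} {M : ℝ}

/-- On the ball of radius $\|x_0\|$ around $x_0$ the field is at most $2M\|x_0\|$, so the time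
$1/(2M)$ is admissible. It does not depend on $x_0$, and the steps can be repeated indefinitely. -/
theorem linear_ode_step [CompleteSpace E] (hM : 0 < M) (hL : ∀ t x, ‖L t x‖ ≤ M * ‖x‖)
    (hc : ∀ x, Continuous fun t => L t x) (a : ℝ) (x₀ : E) :
    ∃ u : ℝ → E, u a = x₀ ∧ ∀ t ∈ Set.Icc a (a + 1 / (2 * M)),
      HasDerivWithinAt u (L t (u t)) (Set.Icc a (a + 1 / (2 * M))) t := by
  have hh : 0 < 1 / (2 * M) := by positivity
  have hP : IsPicardLindelof (fun t x => L t x)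
      (⟨a, le_rfl, by linarith⟩ : Set.Icc a (a + 1 / (2 * M))) x₀ ‖x₀‖₊ 0
      ⟨M * (2 * ‖x₀‖), by positivity⟩ ⟨M, hM.le⟩ := by
    refine ⟨fun t _ => LipschitzWith.lipschitzOnWith (LipschitzWith.of_dist_le_mul fun x y => ?_),
      fun x _ => (hc x).continuousOn, fun t _ x hx => ?_, ?_⟩
    · rw [dist_eq_norm, dist_eq_norm, ← map_sub]
      exact hL t _
    · refine (hL t x).trans ?_
      have : ‖x‖ ≤ 2 * ‖x₀‖ := by
        have h1 := mem_closedBall_iff_norm.1 hx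
        have h2 := norm_le_norm_add_norm_sub' x x₀
        rw [coe_nnnorm] at h1
        linarith
      exact mul_le_mul_of_nonneg_left this hM.le
    · simp only [add_sub_cancel_left, sub_self, coe_nnnorm, NNReal.coe_zero, sub_zero]
      rw [max_eq_left hh.le]
      exact le_of_eq (by field_simp; rfl)
  exact hP.exists_eq_forall_mem_Icc_hasDerivWithinAt₀

theorem linear_ode_unique (hL : ∀ t x, ‖L t x‖ ≤ M * ‖x‖) {a b : ℝ} {u v : ℝ → E} (h : u a = v a)
    (hu : ∀ t ∈ Set.Icc a b, HasDerivWithinAt u (L t (u t)) (Set.Icc a b) t)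
    (hv : ∀ t ∈ Set.Icc a b, HasDerivWithinAt v (L t (v t)) (Set.Icc a b) t) :
    Set.EqOn u v (Set.Icc a b) := by
  have hM : 0 ≤ max M 0 := le_max_right _ _
  refine ODE_solution_unique_of_mem_Icc_right (v := fun t x => L t x) (s := fun _ => Set.univ)
    (K := ⟨max M 0, hM⟩) (fun t _ => LipschitzWith.lipschitzOnWith
      (LipschitzWith.of_dist_le_mul fun x y => ?_))
    (fun t ht => (hu t ht).continuousWithinAt) (fun t ht => ?_) (fun _ _ => trivial)
    (fun t ht => (hv t ht).continuousWithinAt) (fun t ht => ?_) (fun _ _ => trivial) h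
  · rw [dist_eq_norm, dist_eq_norm, ← map_sub]
    exact (hL t _).trans (mul_le_mul_of_nonneg_right (le_max_left _ _) (norm_nonneg _))
  · exact (hu t ⟨ht.1, ht.2.le⟩).mono_of_mem_nhdsWithin (Icc_mem_nhdsGE_of_mem ht)
  · exact (hv t ⟨ht.1, ht.2.le⟩).mono_of_mem_nhdsWithin (Icc_mem_nhdsGE_of_mem ht)

theorem linear_ode_steps [CompleteSpace E] (hM : 0 < M) (hL : ∀ t x, ‖L t x‖ ≤ M * ‖x‖)
    (hc : ∀ x, Continuous fun t => L t x) (a : ℝ) (x₀ : E) (n : ℕ) :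
    ∃ u : ℝ → E, u a = x₀ ∧ ∀ t ∈ Set.Icc a (a + n * (1 / (2 * M))),
      HasDerivWithinAt u (L t (u t)) (Set.Icc a (a + n * (1 / (2 * M)))) t := by
  have hh : 0 < 1 / (2 * M) := by positivity
  induction n with
  | zero =>
    refine ⟨fun _ => x₀, rfl, fun t ht => ?_⟩
    have e : Set.Icc a (a + (0 : ℕ) * (1 / (2 * M))) = {a} := by simp
    rw [e, Set.mem_singleton_iff] at ht
    rw [e, ht, hasDerivWithinAt_iff_hasFDerivWithinAt]
    exact .of_subsingleton Set.subsingleton_singleton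
  | succ n ih =>
    obtain ⟨u, hu0, hu⟩ := ih
    set b := a + n * (1 / (2 * M)) with hb
    obtain ⟨v, hv0, hv⟩ := linear_ode_step hM hL hc b (u b)
    have hab : a ≤ b := by
      have : 0 ≤ n * (1 / (2 * M)) := by positivity
      linarith
    have e : a + (n + 1 : ℕ) * (1 / (2 * M)) = b + 1 / (2 * M) := by rw [hb]; push_cast; ring
    rw [e]
    refine ⟨fun t => if t ≤ b then u t else v t, (if_pos hab).trans hu0, fun t ht => ?_⟩
    have := HasDerivWithinAt.piecewise_Icc hab (by linarith) hu hv hv0.symm (by rw [hv0]) t ht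
    convert this using 1
    beta_reduce
    split_ifs <;> rfl

theorem exists_linear_ode [CompleteSpace E] (hL : ∀ t x, ‖L t x‖ ≤ M * ‖x‖)
    (hc : ∀ x, Continuous fun t => L t x) (a : ℝ) (x₀ : E) :
    ∃ u : ℝ → E, u a = x₀ ∧ ∀ t, a ≤ t → HasDerivWithinAt u (L t (u t)) (Set.Ici a) t := by
  obtain ⟨M, hM, hL⟩ : ∃ M : ℝ, 0 < M ∧ ∀ t x, ‖L t x‖ ≤ M * ‖x‖ := by
    refine ⟨max M 1, by positivity, fun t x => (hL t x).trans ?_⟩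
    gcongr
    exact le_max_left _ _
  set h := 1 / (2 * M) with hh'
  have hh : 0 < h := by positivity
  choose u hu0 hu using linear_ode_steps hM hL hc a x₀
  have huniq : ∀ {m n : ℕ} {t : ℝ}, m ≤ n → t ∈ Set.Icc a (a + m * h) → u n t = u m t := by
    intro m n t hmn ht
    have hsub : Set.Icc a (a + m * h) ⊆ Set.Icc a (a + n * h) := by
      refine Set.Icc_subset_Icc_right ?_
      have : (m : ℝ) ≤ n := by exact_mod_cast hmn
      gcongr
    exact linear_ode_unique hL ((hu0 n).trans (hu0 m).symm) (fun t ht => (hu n t (hsub ht)).mono hsub)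
      (hu m) ht
  set w : ℝ → E := fun t => u ⌈(t - a) / h⌉₊ t with hw
  have hmem : ∀ t, a ≤ t → ∀ n : ℕ, (t - a) / h ≤ n → t ∈ Set.Icc a (a + n * h) := by
    intro t ht n hn
    rw [div_le_iff₀ hh] at hn
    exact ⟨ht, by linarith⟩
  have hwu : ∀ t, a ≤ t → ∀ n : ℕ, (t - a) / h ≤ n → w t = u n t := fun t ht n hn =>
    (huniq (Nat.ceil_le.2 hn) (hmem t ht _ (Nat.le_ceil _))).symm
  refine ⟨w, by simp [hw, hu0], fun t ht => ?_⟩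
  -- One step more than the index defining the glued solution at $t$ puts $t$ strictly before the
  -- right endpoint, so the derivative is also one within the half-line.
  set n := ⌈(t - a) / h⌉₊ + 1 with hn
  have h1 : (t - a) / h < n := by
    rw [hn]
    push_cast
    linarith [Nat.le_ceil ((t - a) / h)]
  have h2 : t < a + n * h := by rw [div_lt_iff₀ hh] at h1; linarith
  have h3 := hu n t ⟨ht, h2.le⟩
  rw [hwu t ht n h1.le]
  refine (h3.congr (f₁ := w) (fun s hs => hwu s hs.1 n ?_) (hwu t ht n h1.le)).mono_of_mem_nhdsWithin
    (inter_mem_nhdsWithin _ (Iic_mem_nhds h2))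
  rw [div_le_iff₀ hh]
  linarith [hs.2]

end LinearODE

end SobolevGrowth
end

noncomputable section
namespace SobolevGrowth
variable {H : Type*} [NormedAddCommGroup H] [InnerProductSpace ℂ H] [CompleteSpace H]

/-! ## Time dependent Hamiltonians on the scale of spaces -/

open ReferenceOperator ReferenceOperator.IsDiscrete

variable {K : ReferenceOperator H} {lam : ℝ}

/-- `W(t)` has order `m`, uniformly in `t`. -/
def IsUnifOrder (K : ReferenceOperator H) (m : ℝ) (W : ℝ → Module.End ℂ K.smooth) : Prop :=
  ∀ s : ℝ, ∃ C : ℝ, 0 < C ∧ ∀ t ψ, K.sob (s - m) (W t ψ) ≤ C * K.sob s ψ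

/-- `t ↦ W(t) ψ` is continuous in every `‖·‖_r`. -/
def IsStrongCont (K : ReferenceOperator H) (W : ℝ → Module.End ℂ K.smooth) : Prop :=
  ∀ (r : ℝ) (ψ : K.smooth), Continuous fun t => K.powS r (W t ψ)

theorem IsUnifOrder.sob_le {m : ℝ} {W : ℝ → Module.End ℂ K.smooth} (h : IsUnifOrder K m W)
    {a s : ℝ} (e : a = s - m) : ∃ C : ℝ, 0 < C ∧ ∀ t ψ, K.sob a (W t ψ) ≤ C * K.sob s ψ :=
  e ▸ h s

/-- The derivative of `u` at `t` within `S` is `v`, in every norm `‖·‖_r`. -/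
def HasSobDerivWithin (u : ℝ → K.smooth) (v : K.smooth) (S : Set ℝ) (t : ℝ) : Prop :=
  ∀ r : ℝ, HasDerivWithinAt (fun t => K.powS r (u t)) (K.powS r v) S t

theorem powS_smul_real (r x : ℝ) (ψ : K.smooth) : K.powS r ((x : ℂ) • ψ) = x • K.powS r ψ := by
  rw [map_smul]
  exact Complex.coe_smul _ _

/-- This is the product rule with only strong differentiability of $A$. The increment of $u$ is
split into its linear part and a remainder $o(\tau-t)$ in every norm; uniform order of $A(\tau)$
keeps the remainder small, and strong continuity handles the linear part. -/
theorem HasSobDerivWithin.apply {p : ℝ} {A A' : ℝ → Module.End ℂ K.smooth}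
    (hA : IsUnifOrder K p A) (hc : IsStrongCont K A) (hd : IsStrongDeriv A A')
    {u : ℝ → K.smooth} {v : K.smooth} {S : Set ℝ} {t : ℝ} (hu : HasSobDerivWithin u v S t) :
    HasSobDerivWithin (fun τ => A τ (u τ)) (A' t (u t) + A t v) S t := by
  intro r
  have e : (fun τ => K.powS r (A τ (u τ))) = fun τ =>
      K.powS r (A τ (u τ - u t - ((τ - t : ℝ) : ℂ) • v)) + K.powS r (A τ (u t)) +
        (τ - t) • K.powS r (A τ v) := by
    ext1 τ
    rw [← powS_smul_real, ← map_smul, ← map_add, ← map_add, ← map_add, ← map_add]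
    congr 2
    abel
  have h2 : HasDerivWithinAt (fun τ => K.powS r (A τ (u t))) (K.powS r (A' t (u t))) S t :=
    (hasSeminormDerivAt_sob_iff.1 (hd (u t) t) r).hasDerivWithinAt
  have h1 : HasDerivWithinAt (fun τ => K.powS r (A τ (u τ - u t - ((τ - t : ℝ) : ℂ) • v)))
      (0 : H) S t := by
    obtain ⟨C, hC0, hC⟩ := hA.sob_le (a := r) (s := r + p) (by ring)
    have h := hasDerivWithinAt_iff_isLittleO.1 (hu (r + p))
    refine hasDerivWithinAt_iff_isLittleO.2 (Asymptotics.IsBigO.trans_isLittleO ?_ h)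
    refine Asymptotics.IsBigO.of_bound C (Eventually.of_forall fun τ => ?_)
    have e1 : K.powS (r + p) (u τ) - K.powS (r + p) (u t) - (τ - t) • K.powS (r + p) v =
        K.powS (r + p) (u τ - u t - ((τ - t : ℝ) : ℂ) • v) := by
      rw [map_sub, map_sub, powS_smul_real]
    rw [e1]
    simp only [sub_self, Complex.ofReal_zero, zero_smul, map_zero, sub_zero, smul_zero]
    exact hC τ _
  have h3 : HasDerivWithinAt (fun τ => (τ - t) • K.powS r (A τ v)) (K.powS r (A t v)) S t := by
    refine hasDerivWithinAt_iff_isLittleO.2 ?_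
    have hz : Tendsto (fun τ => K.powS r (A τ v) - K.powS r (A t v)) (𝓝[S] t) (𝓝 0) := by
      have := ((hc r v).tendsto t).sub_const (K.powS r (A t v))
      rw [sub_self] at this
      exact this.mono_left nhdsWithin_le_nhds
    have := (Asymptotics.isBigO_refl (fun τ : ℝ => τ - t) (𝓝[S] t)).smul_isLittleO
      ((Asymptotics.isLittleO_one_iff ℝ).2 hz)
    simp only [smul_eq_mul, mul_one] at this
    refine this.congr_left fun τ => ?_
    rw [sub_self, zero_smul, sub_zero, smul_sub]
  rw [e, map_add]
  refine ((h1.add h2).add h3).congr_deriv (by rw [zero_add])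

theorem HasSobDerivWithin.re_inner (D : K.IsDiscrete lam) {u w : ℝ → K.smooth} {u' w' : K.smooth}
    {S : Set ℝ} {t : ℝ} (hu : HasSobDerivWithin u u' S t) (hw : HasSobDerivWithin w w' S t) :
    HasDerivWithinAt (fun τ => (⟪(u τ : H), (w τ : H)⟫_ℂ).re)
      ((⟪(u' : H), (w t : H)⟫_ℂ).re + (⟪(u t : H), (w' : H)⟫_ℂ).re) S t := by
  have h1 := hu 0
  have h2 := hw 0
  simp only [D.powS_zero] at h1 h2
  have h3 := Complex.reCLM.hasFDerivAt.comp_hasDerivWithinAt t (h1.inner ℂ h2)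
  refine h3.congr_deriv ?_
  simp [add_comm]

/-- A time dependent symmetric operator admitting modified energies of every order. -/
structure IsHamiltonian (K : ReferenceOperator H) (m : ℝ) (G : ℝ → Module.End ℂ K.smooth) :
    Prop where
  symm : ∀ t, K.IsSymm (G t)
  order : IsUnifOrder K m G
  cont : IsStrongCont K G
  energy : ∀ r : ℝ, 0 < r → ∃ q < 2 * r, ∃ A A' : ℝ → Module.End ℂ K.smooth,
    IsUnifOrder K (2 * r) A ∧ IsStrongCont K A ∧ IsStrongDeriv A A' ∧
    IsUnifOrder K q (A - fun _ => K.diag fun x => ((x ^ (2 * r) : ℝ) : ℂ)) ∧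
    IsUnifOrder K 0 (A' + Complex.I • (G * A - A * G))

/-! ### Spectral truncations -/

namespace ReferenceOperator.IsDiscrete

/-- The spectral projection onto the first `n` eigenspaces. -/
def trunc (D : K.IsDiscrete lam) (n : ℕ) : H →ₗ[ℂ] K.smooth := ∑ k ∈ Finset.range n, D.blk k

theorem block_trunc (D : K.IsDiscrete lam) (n j : ℕ) (x : H) :
    K.block lam j (D.trunc n x : H) = if j < n then K.block lam j x else 0 := by
  rw [trunc, LinearMap.sum_apply, Submodule.coe_sum, map_sum]
  simp only [coe_blk]
  split_ifs with h
  · rw [Finset.sum_eq_single_of_mem j (Finset.mem_range.2 h)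
      fun k _ hk => K.block_block_ne hk.symm x, block_block_self]
  · exact Finset.sum_eq_zero fun k hk => K.block_block_ne
      (fun e : j = k => h (by rw [e]; exact Finset.mem_range.1 hk)) x

theorem trunc_trunc (D : K.IsDiscrete lam) (n : ℕ) (x : H) :
    D.trunc n (D.trunc n x) = D.trunc n x :=
  D.ext_smooth fun j => by
    rw [block_trunc, block_trunc]
    split_ifs <;> rfl

theorem inner_trunc (D : K.IsDiscrete lam) (n : ℕ) (x y : H) :
    ⟪(D.trunc n x : H), y⟫_ℂ = ⟪x, (D.trunc n y : H)⟫_ℂ := by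
  rw [trunc, LinearMap.sum_apply, LinearMap.sum_apply, Submodule.coe_sum, Submodule.coe_sum,
    sum_inner, inner_sum]
  exact Finset.sum_congr rfl fun k _ => K.block_symm k x y

theorem sob_trunc_le (D : K.IsDiscrete lam) (r : ℝ) (n : ℕ) (ψ : K.smooth) :
    K.sob r (D.trunc n ψ) ≤ K.sob r ψ := by
  have := D.sob_le_of_block (r := r) (s := r) zero_le_one (φ := D.trunc n ψ) (ψ := ψ) fun j => by
    have hp := D.ev_pos j
    rw [one_mul, block_trunc]
    gcongr
    split_ifs
    · rfl
    · rw [norm_zero]; positivity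
  rwa [one_mul] at this

theorem ev_le_ev {n j : ℕ} (h : n ≤ j) : ev lam n ≤ ev lam j := by
  have : (n : ℝ) ≤ j := by exact_mod_cast h
  unfold ev
  linarith

theorem sob_sub_trunc_le (D : K.IsDiscrete lam) (r : ℝ) (n : ℕ) (ψ : K.smooth) :
    K.sob r (ψ - D.trunc n ψ) ≤ (ev lam n)⁻¹ * K.sob (r + 1) ψ := by
  have hn := D.ev_pos n
  refine D.sob_le_of_block (by positivity) fun j => ?_
  have hp := D.ev_pos j
  rw [Submodule.coe_sub, map_sub, block_trunc]
  split_ifs with h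
  · rw [sub_self, norm_zero, mul_zero]; positivity
  · rw [sub_zero, Real.rpow_add hp, Real.rpow_one]
    have h1 := ev_le_ev (lam := lam) (not_lt.1 h)
    calc ev lam j ^ r * ‖K.block lam j (ψ : H)‖ =
          (ev lam n)⁻¹ * (ev lam j ^ r * ev lam n * ‖K.block lam j (ψ : H)‖) := by field_simp
      _ ≤ _ := by gcongr

theorem norm_powS_trunc_le (D : K.IsDiscrete lam) (r : ℝ) (n : ℕ) (x : H) :
    ‖K.powS r (D.trunc n x)‖ ≤ (∑ k ∈ Finset.range n, ev lam k ^ r) * ‖x‖ := by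
  rw [trunc, LinearMap.sum_apply, map_sum, Finset.sum_mul]
  refine (norm_sum_le _ _).trans (Finset.sum_le_sum fun k _ => ?_)
  rw [← sob_eq, D.sob_blk]
  have := D.ev_pos k
  gcongr
  exact K.norm_block_le k x

/-- `K₀ ^ r` composed with a spectral truncation, as a bounded operator. -/
def powTrunc (D : K.IsDiscrete lam) (r : ℝ) (n : ℕ) : H →L[ℂ] H :=
  ((K.powS r).comp (D.trunc n)).mkContinuous _ (D.norm_powS_trunc_le r n)

theorem powTrunc_apply (D : K.IsDiscrete lam) (r : ℝ) (n : ℕ) (x : H) :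
    D.powTrunc r n x = K.powS r (D.trunc n x) := rfl

theorem diag_trunc (D : K.IsDiscrete lam) {g : ℝ → ℂ} (hg : Tempered lam g) (n : ℕ)
    (ψ : K.smooth) : D.trunc n (K.diag g ψ : H) = K.diag g (D.trunc n ψ) :=
  D.ext_smooth fun j => by
    rw [block_trunc, D.block_diag hg, D.block_diag hg, block_trunc]
    split_ifs
    · rfl
    · rw [smul_zero]

theorem sob_diag_rpow_le (D : K.IsDiscrete lam) {a b s : ℝ} (e : a = s - b) (ψ : K.smooth) :
    K.sob a (K.diag (fun x => ((x ^ b : ℝ) : ℂ)) ψ) ≤ K.sob s ψ := by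
  subst e
  have := D.sob_diag_le (g := fun x => ((x ^ b : ℝ) : ℂ)) (C := 1) (m := b) (fun n => by
    have := D.ev_pos n
    rw [Complex.norm_real, Real.norm_of_nonneg (by positivity), one_mul]) s ψ
  rwa [one_mul] at this

theorem re_inner_diag_rpow (D : K.IsDiscrete lam) {a b r : ℝ} (h : a + b = 2 * r) (ψ : K.smooth) :
    (⟪(K.diag (fun x => ((x ^ a : ℝ) : ℂ)) ψ : H), (K.diag (fun x => ((x ^ b : ℝ) : ℂ)) ψ : H)⟫_ℂ).re
      = K.sob r ψ ^ 2 := by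
  rw [D.coe_diag_rpow, D.coe_diag_rpow, D.inner_powS (c := r) (d := r) (by linarith), sob_eq,
    ← inner_self_eq_norm_sq (𝕜 := ℂ)]
  rfl

end ReferenceOperator.IsDiscrete

end SobolevGrowth
end

noncomputable section
namespace SobolevGrowth
variable {H : Type*} [NormedAddCommGroup H] [InnerProductSpace ℂ H] [CompleteSpace H]

/-! ## Galerkin approximation with vanishing viscosity -/

open ReferenceOperator ReferenceOperator.IsDiscrete

variable {K : ReferenceOperator H} {lam : ℝ} {m : ℝ} {G : ℝ → Module.End ℂ K.smooth}

namespace IsHamiltonian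

/-- The vector field of the truncated and regularized equation. -/
def galerkin (D : K.IsDiscrete lam) (m : ℝ) (G : ℝ → Module.End ℂ K.smooth) (n : ℕ) (t : ℝ) :
    Module.End ℂ K.smooth :=
  -(Complex.I • ((D.trunc n).comp K.smooth.subtype * G t)) -
    ((ev lam n : ℂ)⁻¹) • K.diag fun x => ((x ^ (m + 1) : ℝ) : ℂ)

theorem galerkin_apply (D : K.IsDiscrete lam) (n : ℕ) (t : ℝ) (φ : K.smooth) :
    galerkin D m G n t φ = -(Complex.I • D.trunc n (G t φ)) -
      ((ev lam n : ℂ)⁻¹) • K.diag (fun x => ((x ^ (m + 1) : ℝ) : ℂ)) φ := rfl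

theorem trunc_galerkin (D : K.IsDiscrete lam) {n : ℕ} (t : ℝ) {φ : K.smooth}
    (hφ : D.trunc n φ = φ) : D.trunc n (galerkin D m G n t φ) = galerkin D m G n t φ := by
  rw [galerkin_apply, Submodule.coe_sub, map_sub, Submodule.coe_neg, map_neg, Submodule.coe_smul,
    map_smul, trunc_trunc, Submodule.coe_smul, map_smul, D.diag_trunc (D.tempered_rpow _), hφ]

theorem norm_galerkin_le (D : K.IsDiscrete lam) (hG : IsHamiltonian K m G) (n : ℕ) :
    ∃ M, ∀ t (x : H), ‖(galerkin D m G n t (D.trunc n x) : H)‖ ≤ M * ‖x‖ := by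
  obtain ⟨C, hC0, hC⟩ := hG.order.sob_le (a := 0) (s := m) (by ring)
  have hn := D.ev_pos n
  refine ⟨C * (∑ k ∈ Finset.range n, ev lam k ^ m) +
    (ev lam n)⁻¹ * (∑ k ∈ Finset.range n, ev lam k ^ (m + 1)), fun t x => ?_⟩
  rw [galerkin_apply, ← D.sob_zero, add_mul]
  refine (map_sub_le_add _ _ _).trans (add_le_add ?_ ?_)
  · rw [map_neg_eq_map, map_smul_eq_mul, Complex.norm_I, one_mul, mul_assoc]
    exact (D.sob_trunc_le 0 n _).trans ((hC t _).trans
      (mul_le_mul_of_nonneg_left (D.norm_powS_trunc_le m n x) hC0.le))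
  · rw [map_smul_eq_mul, norm_inv, Complex.norm_real, Real.norm_of_nonneg hn.le, mul_assoc]
    exact mul_le_mul_of_nonneg_left ((D.sob_diag_rpow_le (s := m + 1) (by ring) _).trans
      (D.norm_powS_trunc_le (m + 1) n x)) (by positivity)

/-- Existence of solutions of the truncated equation. -/
theorem exists_galerkin (D : K.IsDiscrete lam) (hG : IsHamiltonian K m G) (n : ℕ) (s : ℝ)
    (ψ : K.smooth) : ∃ u : ℝ → K.smooth, u s = D.trunc n ψ ∧ ∀ t, s ≤ t → D.trunc n (u t) = u t ∧
      HasSobDerivWithin u (galerkin D m G n t (u t)) (Set.Ici s) t := by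
  obtain ⟨M, hM⟩ := norm_galerkin_le D hG n
  let L : ℝ → H →ₗ[ℝ] H := fun t =>
    (K.smooth.subtype ∘ₗ galerkin D m G n t ∘ₗ D.trunc n).restrictScalars ℝ
  have hLe : ∀ t x, L t x = (galerkin D m G n t (D.trunc n x) : H) := fun _ _ => rfl
  have hc : ∀ x, Continuous fun t => L t x := by
    intro x
    simp only [hLe, galerkin_apply, Submodule.coe_sub, Submodule.coe_neg, Submodule.coe_smul]
    refine Continuous.sub (Continuous.neg (Continuous.const_smul ?_ _)) continuous_const
    have h1 := (D.powTrunc 0 n).continuous.comp (hG.cont 0 (D.trunc n x))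
    refine h1.congr fun t => ?_
    rw [Function.comp_apply, powTrunc_apply, D.powS_zero, D.powS_zero]
  obtain ⟨x, hx0, hx⟩ := exists_linear_ode (L := L) hM hc s (D.trunc n ψ : H)
  refine ⟨fun t => D.trunc n (x t), by simp only [hx0, trunc_trunc], fun t ht => ⟨trunc_trunc D n _,
    fun r => ?_⟩⟩
  have h1 := ((D.powTrunc r n).restrictScalars ℝ).hasFDerivAt.comp_hasDerivWithinAt t (hx t ht)
  refine h1.congr_deriv ?_
  change D.powTrunc r n (L t (x t)) = _
  rw [powTrunc_apply, hLe, trunc_galerkin D t (trunc_trunc D n _)]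

/-- On the range of the truncation the Hamiltonian part is skew, and the viscosity is dissipative.
-/
theorem re_inner_galerkin_le (D : K.IsDiscrete lam) (hG : IsHamiltonian K m G) {n : ℕ} (t : ℝ)
    {φ : K.smooth} (hφ : D.trunc n φ = φ) :
    (⟪(φ : H), (galerkin D m G n t φ : H)⟫_ℂ).re ≤ 0 := by
  have hn := D.ev_pos n
  have h1 : (⟪(φ : H), (G t φ : H)⟫_ℂ).im = 0 := by
    have h2 := hG.symm t φ φ
    rw [← inner_conj_symm] at h2
    have := congrArg Complex.im h2
    rw [Complex.conj_im] at this
    rw [← inner_conj_symm, Complex.conj_im]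
    linarith
  have h2 := D.re_inner_diag_rpow (a := 0) (b := m + 1) (r := (m + 1) / 2) (by ring) φ
  rw [D.coe_diag_rpow 0, D.powS_zero] at h2
  rw [galerkin_apply, Submodule.coe_sub, Submodule.coe_neg, Submodule.coe_smul, Submodule.coe_smul,
    inner_sub_right, inner_neg_right, inner_smul_right, inner_smul_right, ← inner_trunc, hφ,
    ← Complex.ofReal_inv, Complex.sub_re, Complex.re_ofReal_mul, h2, Complex.neg_re, Complex.I_mul_re,
    h1]
  have : 0 ≤ (ev lam n)⁻¹ * K.sob ((m + 1) / 2) φ ^ 2 := by positivity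
  linarith

theorem abs_re_inner_le (D : K.IsDiscrete lam) {a b x y s : ℝ} {φ ψ : K.smooth}
    (hab : b = -a) (h1 : K.sob a φ ≤ x * s) (h2 : K.sob b ψ ≤ y * s) (hx : 0 ≤ x) (hs : 0 ≤ s) :
    ‖⟪(φ : H), (ψ : H)⟫_ℂ‖ ≤ x * y * s ^ 2 := by
  subst hab
  calc _ ≤ K.sob a φ * K.sob (-a) ψ := D.norm_inner_le a φ ψ
    _ ≤ (x * s) * (y * s) := mul_le_mul h1 h2 (apply_nonneg _ _) (by positivity)
    _ = _ := by ring

set_option maxHeartbeats 1000000 in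
/-- The energy inequality for the truncated equation. -/
theorem energy_inequality (D : K.IsDiscrete lam) (hG : IsHamiltonian K m G) {r q : ℝ} (hq : q < 2 * r)
    {A A' : ℝ → Module.End ℂ K.smooth}
    (hAq : IsUnifOrder K q (A - fun _ => K.diag fun x => ((x ^ (2 * r) : ℝ) : ℂ)))
    (hR : IsUnifOrder K 0 (A' + Complex.I • (G * A - A * G))) :
    ∃ C : ℝ, 0 < C ∧ ∀ n t (φ : K.smooth), D.trunc n φ = φ →
      (⟪(galerkin D m G n t φ : H), (A t φ : H)⟫_ℂ).re +
        (⟪(φ : H), (A' t φ + A t (galerkin D m G n t φ) : K.smooth)⟫_ℂ).re ≤ C * ‖(φ : H)‖ ^ 2 := by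
  set P := K.diag fun x => ((x ^ (2 * r) : ℝ) : ℂ) with hP
  set B : ℝ → Module.End ℂ K.smooth := A - fun _ => P with hB
  set T := K.diag fun x => ((x ^ (m + 1) : ℝ) : ℂ) with hT
  -- With $B=A-K_0^{2r}$ of order $q$, the errors pair $B\varphi$ with $d$ or with the viscous term
  -- $T\varphi$. Measured against $\|\varphi\|_\sigma$, $d$ is of size $\varepsilon$ and costs $m+1$
  -- orders, like $\varepsilon T\varphi$; the choice $2\sigma=m+1+q$ bounds every error by
  -- $\varepsilon\|\varphi\|_\sigma^2$.
  set σ := (m + 1 + q) / 2 with hσ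
  obtain ⟨CR, hCR0, hCR⟩ := hR.sob_le (a := 0) (s := 0) (by ring)
  obtain ⟨C1, hC10, hC1⟩ := hAq.sob_le (a := σ - q) (s := σ) rfl
  obtain ⟨C2, hC20, hC2⟩ := hAq.sob_le (a := -σ) (s := q - σ) (by ring)
  obtain ⟨C3, hC30, hC3⟩ := hG.order.sob_le (a := q - σ + 1) (s := σ) (by rw [hσ]; ring)
  obtain ⟨C4, hC4⟩ : ∃ C4, C4 = 2 * (C3 * C1 + C2 * C3 + C1 + C2) := ⟨_, rfl⟩
  have hC40 : 0 < C4 := by rw [hC4]; positivity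
  -- Since $q<2r$, the exponent $\sigma$ is below the exponent $r+(m+1)/2$ of the viscous
  -- dissipation, which therefore absorbs these errors. The leftover is a multiple of
  -- $\|\varphi\|^2$, with $\varepsilon\le\lambda^{-1}$.
  obtain ⟨C5, hC50, hC5⟩ := D.sob_interp (r := σ) (s := r + (m + 1) / 2) (by rw [hσ]; linarith)
    (inv_pos.2 hC40)
  have hl := D.pos
  refine ⟨CR + lam⁻¹ * (C4 * C5), by positivity, fun n t φ hφ => ?_⟩
  have hn := D.ev_pos n
  set ε := (ev lam n)⁻¹ with hε
  have hε0 : 0 < ε := inv_pos.2 hn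
  have hεl : ε ≤ lam⁻¹ := by
    refine inv_anti₀ hl ?_
    unfold ev
    linarith [(n.cast_nonneg : (0 : ℝ) ≤ n)]
  set d := G t φ - D.trunc n (G t φ) with hd
  set N := K.sob σ φ with hN
  have hN0 : 0 ≤ N := apply_nonneg _ _
  have hA : ∀ χ, A t χ = P χ + B t χ := fun χ => by
    simp only [hB, Pi.sub_apply, LinearMap.sub_apply]; abel
  have hv : galerkin D m G n t φ = -(Complex.I • G t φ) + Complex.I • d - (ε : ℂ) • T φ := by
    rw [galerkin_apply, hd, smul_sub, hε, Complex.ofReal_inv]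
    abel
  -- The truncation defect $d$ is orthogonal to the truncated space, which $K_0^{2r}$ preserves. So
  -- the principal part of the energy does not see $d$; only the lower order part $B$ does.
  have hdP : ∀ χ : K.smooth, D.trunc n χ = χ → ⟪(d : H), (χ : H)⟫_ℂ = 0 := by
    intro χ hχ
    rw [← hχ, ← inner_trunc, hd, Submodule.coe_sub, map_sub, trunc_trunc, sub_self]
    exact inner_zero_left _
  have hPφ : D.trunc n (P φ) = P φ := by rw [hP, D.diag_trunc (D.tempered_rpow _), hφ]
  have hsymP : K.IsSymm P := D.isSymm_diag (D.tempered_rpow _)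
  have hd1 : K.sob (q - σ) d ≤ ε * C3 * N := by
    refine (D.sob_sub_trunc_le _ n _).trans ?_
    rw [mul_assoc]
    exact mul_le_mul_of_nonneg_left (hC3 t φ) hε0.le
  have b1 : ‖⟪(d : H), (B t φ : H)⟫_ℂ‖ ≤ ε * C3 * C1 * N ^ 2 :=
    abs_re_inner_le D (by ring) hd1 (hC1 t φ) (by positivity) hN0
  have b2 : ‖⟪(φ : H), (B t d : H)⟫_ℂ‖ ≤ 1 * (C2 * (ε * C3)) * N ^ 2 := by
    refine abs_re_inner_le D (a := σ) rfl (by rw [one_mul]) ((hC2 t d).trans ?_) zero_le_one hN0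
    rw [mul_assoc]
    exact mul_le_mul_of_nonneg_left hd1 hC20.le
  have hT1 : K.sob (q - σ) (T φ) ≤ 1 * N := by
    rw [one_mul]
    exact D.sob_diag_rpow_le (by rw [hσ]; ring) φ
  have b3 : ‖⟪(T φ : H), (B t φ : H)⟫_ℂ‖ ≤ 1 * C1 * N ^ 2 :=
    abs_re_inner_le D (by ring) hT1 (hC1 t φ) zero_le_one hN0
  have b4 : ‖⟪(φ : H), (B t (T φ) : H)⟫_ℂ‖ ≤ 1 * C2 * N ^ 2 := by
    refine abs_re_inner_le D (a := σ) rfl (by rw [one_mul]) ((hC2 t _).trans ?_) zero_le_one hN0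
    exact mul_le_mul_of_nonneg_left (by linarith) hC20.le
  have b5 : ‖⟪(φ : H), ((A' + Complex.I • (G * A - A * G)) t φ : H)⟫_ℂ‖ ≤ CR * ‖(φ : H)‖ ^ 2 := by
    have := hCR t φ
    rw [D.sob_zero, D.sob_zero] at this
    refine (_root_.norm_inner_le_norm _ _).trans ?_
    rw [pow_two, ← mul_assoc, mul_comm CR, mul_assoc]
    exact mul_le_mul_of_nonneg_left this (norm_nonneg _)
  have p1 : (⟪(T φ : H), (P φ : H)⟫_ℂ).re = K.sob (r + (m + 1) / 2) φ ^ 2 :=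
    D.re_inner_diag_rpow (by ring) φ
  have p2 : (⟪(φ : H), (P (T φ) : H)⟫_ℂ).re = K.sob (r + (m + 1) / 2) φ ^ 2 := by
    rw [hsymP, ← inner_conj_symm, Complex.conj_re, p1]
  have key : (⟪(galerkin D m G n t φ : H), (A t φ : H)⟫_ℂ) +
      ⟪(φ : H), (A' t φ + A t (galerkin D m G n t φ) : K.smooth)⟫_ℂ =
      ⟪(φ : H), ((A' + Complex.I • (G * A - A * G)) t φ : H)⟫_ℂ -
        Complex.I * ⟪(d : H), (B t φ : H)⟫_ℂ + Complex.I * ⟪(φ : H), (B t d : H)⟫_ℂ -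
        ε * (⟪(T φ : H), (P φ : H)⟫_ℂ + ⟪(φ : H), (P (T φ) : H)⟫_ℂ +
          ⟪(T φ : H), (B t φ : H)⟫_ℂ + ⟪(φ : H), (B t (T φ) : H)⟫_ℂ) := by
    have q1 : ⟪(d : H), (A t φ : H)⟫_ℂ = ⟪(d : H), (B t φ : H)⟫_ℂ := by
      rw [hA, Submodule.coe_add, inner_add_right, hdP _ hPφ, zero_add]
    have q2 : ⟪(φ : H), (A t d : H)⟫_ℂ = ⟪(φ : H), (B t d : H)⟫_ℂ := by
      rw [hA, Submodule.coe_add, inner_add_right, hsymP, ← inner_conj_symm, hdP _ hPφ, map_zero,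
        zero_add]
    have q3 : ⟪(T φ : H), (A t φ : H)⟫_ℂ = ⟪(T φ : H), (P φ : H)⟫_ℂ + ⟪(T φ : H), (B t φ : H)⟫_ℂ := by
      rw [hA, Submodule.coe_add, inner_add_right]
    have q4 : ⟪(φ : H), (A t (T φ) : H)⟫_ℂ =
        ⟪(φ : H), (P (T φ) : H)⟫_ℂ + ⟪(φ : H), (B t (T φ) : H)⟫_ℂ := by
      rw [hA, Submodule.coe_add, inner_add_right]
    have q5 : ⟪(G t φ : H), (A t φ : H)⟫_ℂ = ⟪(φ : H), (G t (A t φ) : H)⟫_ℂ :=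
      (hG.symm t _ _).symm
    rw [hv]
    simp only [Pi.add_apply, Pi.smul_apply, Pi.sub_apply, Pi.mul_apply, LinearMap.add_apply,
      LinearMap.smul_apply, LinearMap.sub_apply, Module.End.mul_apply, map_add, map_sub, map_neg,
      map_smul, Submodule.coe_add, Submodule.coe_sub, Submodule.coe_neg, Submodule.coe_smul,
      inner_add_left, inner_add_right, inner_sub_left, inner_sub_right, inner_neg_left,
      inner_neg_right, inner_smul_left, inner_smul_right, Complex.conj_I, Complex.conj_ofReal,
      q1, q2, q3, q4, q5]
    ring
  rw [← Complex.add_re, key, Complex.sub_re, Complex.add_re, Complex.sub_re, Complex.re_ofReal_mul,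
    Complex.add_re, Complex.add_re, Complex.add_re, p1, p2, Complex.I_mul_re, Complex.I_mul_re]
  have i1 := (Complex.abs_im_le_norm _).trans b1
  have i2 := (Complex.abs_im_le_norm _).trans b2
  have i3 := (Complex.abs_re_le_norm _).trans b3
  have i4 := (Complex.abs_re_le_norm _).trans b4
  have i5 := (Complex.abs_re_le_norm _).trans b5
  rw [abs_le] at i1 i2 i3 i4 i5
  have i6 := hC5 φ
  have i7 : C4 * N ^ 2 ≤ K.sob (r + (m + 1) / 2) φ ^ 2 + C4 * C5 * ‖(φ : H)‖ ^ 2 := by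
    calc C4 * N ^ 2 ≤ C4 * (C4⁻¹ * K.sob (r + (m + 1) / 2) φ ^ 2 + C5 * ‖(φ : H)‖ ^ 2) := by gcongr
      _ = _ := by field_simp
  have i8 := mul_le_mul_of_nonneg_left i7 hε0.le
  have i9 : ε * (C4 * C5 * ‖(φ : H)‖ ^ 2) ≤ lam⁻¹ * (C4 * C5 * ‖(φ : H)‖ ^ 2) := by gcongr
  have j3 := mul_le_mul_of_nonneg_left i3.1 hε0.le
  have j4 := mul_le_mul_of_nonneg_left i4.1 hε0.le
  have j5 : 0 ≤ ε * K.sob (r + (m + 1) / 2) φ ^ 2 := by positivity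
  have j6 : 0 ≤ ε * (C3 * C1 + C2 * C3 + C1 + C2) * N ^ 2 := by positivity
  have j7 : ε * (C4 * N ^ 2) = 2 * (ε * (C3 * C1 + C2 * C3 + C1 + C2) * N ^ 2) := by rw [hC4]; ring
  linarith

end IsHamiltonian

end SobolevGrowth
end

noncomputable section
namespace SobolevGrowth
variable {H : Type*} [NormedAddCommGroup H] [InnerProductSpace ℂ H] [CompleteSpace H]

/-! ## Forward solutions -/

open ReferenceOperator ReferenceOperator.IsDiscrete

variable {K : ReferenceOperator H} {lam : ℝ} {m : ℝ} {G : ℝ → Module.End ℂ K.smooth}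

theorem le_add_mul_of_deriv_le {f f' : ℝ → ℝ} {s c T : ℝ}
    (hf : ∀ t, s ≤ t → HasDerivWithinAt f (f' t) (Set.Ici s) t)
    (hb : ∀ t, s ≤ t → t < T → f' t ≤ c) {t : ℝ} (ht : s ≤ t) (htT : t ≤ T) :
    f t ≤ f s + c * (t - s) := by
  refine image_le_of_deriv_right_le_deriv_boundary (a := s) (b := T) (f' := f')
    (B := fun x => f s + c * (x - s)) (B' := fun _ => c)
    (fun x hx => ((hf x hx.1).mono Set.Icc_subset_Ici_self).continuousWithinAt)
    (fun x hx => (hf x hx.1).mono (Set.Ici_subset_Ici.2 hx.1)) (by simp)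
    (by fun_prop) (fun x _ => ?_) (fun x hx => hb x hx.1 hx.2) ⟨ht, htT⟩
  have := (((hasDerivAt_id x).sub_const s).const_mul c).const_add (f s)
  simpa using this.hasDerivWithinAt

theorem HasSobDerivWithin.sub {u w : ℝ → K.smooth} {u' w' : K.smooth} {S : Set ℝ} {t : ℝ}
    (hu : HasSobDerivWithin u u' S t) (hw : HasSobDerivWithin w w' S t) :
    HasSobDerivWithin (fun τ => u τ - w τ) (u' - w') S t := fun r => by
  have := (hu r).sub (hw r)
  rw [← map_sub] at this
  exact this.congr (fun τ _ => map_sub _ _ _) (map_sub _ _ _)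

theorem re_inner_self_eq {E : Type*} [NormedAddCommGroup E] [InnerProductSpace ℂ E] (x : E) :
    (⟪x, x⟫_ℂ).re = ‖x‖ ^ 2 := inner_self_eq_norm_sq (𝕜 := ℂ) x

/-- `H^∞` is complete for the family of norms `‖·‖_r`. -/
theorem ReferenceOperator.IsDiscrete.exists_limit (D : K.IsDiscrete lam) {x : ℕ → K.smooth}
    (hx : ∀ r, CauchySeq fun n => K.powS r (x n)) :
    ∃ y : K.smooth, ∀ r, Tendsto (fun n => K.powS r (x n)) atTop (𝓝 (K.powS r y)) := by
  choose χ hχ using fun r => cauchySeq_tendsto_of_complete (hx r)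
  have hb : ∀ r n, K.block lam n (χ r) = ((ev lam n ^ r : ℝ) : ℂ) • K.block lam n (χ 0) := by
    intro r n
    have h1 := ((K.block lam n).continuous.tendsto _).comp (hχ r)
    have h2 := (((K.block lam n).continuous.tendsto _).comp (hχ 0)).const_smul ((ev lam n ^ r : ℝ) : ℂ)
    refine tendsto_nhds_unique h1 (h2.congr fun k => ?_)
    simp only [Function.comp_apply, block_powS, Real.rpow_zero, Complex.ofReal_one, one_smul]
  have hs : χ 0 ∈ K.smooth := (D.mem_smooth_iff _).2 fun r => ⟨χ r, hb r⟩
  refine ⟨⟨χ 0, hs⟩, fun r => ?_⟩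
  have : K.powS r ⟨χ 0, hs⟩ = χ r := D.ext_block fun n => by rw [block_powS, hb r]
  rw [this]
  exact hχ r

namespace IsHamiltonian

/-- `u` solves the truncated equation with initial value (the truncation of) `ψ` at time `s`. -/
def IsGalerkin (D : K.IsDiscrete lam) (m : ℝ) (G : ℝ → Module.End ℂ K.smooth) (n : ℕ) (s : ℝ)
    (ψ : K.smooth) (u : ℝ → K.smooth) : Prop :=
  u s = D.trunc n ψ ∧ ∀ t, s ≤ t → D.trunc n (u t) = u t ∧
    HasSobDerivWithin u (galerkin D m G n t (u t)) (Set.Ici s) t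

variable {D : K.IsDiscrete lam}

theorem IsGalerkin.norm_le (hG : IsHamiltonian K m G) {n : ℕ} {s : ℝ} {ψ : K.smooth}
    {u : ℝ → K.smooth} (hu : IsGalerkin D m G n s ψ u) {t : ℝ} (ht : s ≤ t) :
    ‖(u t : H)‖ ≤ ‖(ψ : H)‖ := by
  have h1 := le_add_mul_of_deriv_le (c := 0) (T := t)
    (fun τ hτ => HasSobDerivWithin.re_inner D (hu.2 τ hτ).2 (hu.2 τ hτ).2) (fun τ hτ _ => by
      have h := re_inner_galerkin_le D hG τ (hu.2 τ hτ).1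
      rw [← inner_conj_symm, Complex.conj_re]
      linarith) ht le_rfl
  rw [re_inner_self_eq, re_inner_self_eq, zero_mul, add_zero, hu.1] at h1
  have h2 := D.sob_trunc_le 0 n ψ
  rw [D.sob_zero, D.sob_zero] at h2
  exact (abs_le_of_sq_le_sq' h1 (norm_nonneg _)).2.trans h2

/-- The energy grows at a rate bounded by $\|\psi\|^2$, because the norm of $\mathcal H$ does not
increase. Interpolation absorbs the part of order $q<2r$ and makes the energy comparable to
$\|\cdot\|_r^2$ modulo $\|\cdot\|^2$. The linear growth is uniform in the truncation. -/
theorem exists_galerkin_bound (D : K.IsDiscrete lam) (hG : IsHamiltonian K m G) {r : ℝ}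
    (hr : 0 < r) : ∃ C : ℝ, 0 < C ∧ ∀ n s ψ u, IsGalerkin D m G n s ψ u → ∀ t, s ≤ t →
      K.sob r (u t) ^ 2 ≤ C * (1 + (t - s)) * K.sob r ψ ^ 2 := by
  obtain ⟨q, hq, A, A', hA, hAc, hAd, hAq, hR⟩ := hG.energy r hr
  obtain ⟨C0, hC00, hC0⟩ := energy_inequality D hG hq hAq hR
  obtain ⟨C1, hC10, hC1⟩ := hA.sob_le (a := -r) (s := r) (by ring)
  obtain ⟨C2, hC20, hC2⟩ := hAq.sob_le (a := -(q / 2)) (s := q / 2) (by ring)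
  obtain ⟨C3, hC30, hC3⟩ := D.sob_interp (r := q / 2) (s := r) (by linarith)
    (show (0 : ℝ) < (2 * C2)⁻¹ by positivity)
  obtain ⟨C4, hC40, hC4⟩ := D.sob_mono hr.le
  have upper : ∀ t (φ : K.smooth), (⟪(φ : H), (A t φ : H)⟫_ℂ).re ≤ C1 * K.sob r φ ^ 2 := by
    intro t φ
    refine (Complex.re_le_norm _).trans ((D.norm_inner_le r _ _).trans ?_)
    have := hC1 t φ
    have h0 : 0 ≤ K.sob r φ := apply_nonneg _ _
    nlinarith
  have lower : ∀ t (φ : K.smooth), K.sob r φ ^ 2 ≤ 2 * (⟪(φ : H), (A t φ : H)⟫_ℂ).re +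
      2 * (C2 * C3) * ‖(φ : H)‖ ^ 2 := by
    intro t φ
    obtain ⟨B, hB⟩ : ∃ B, B = (A - (fun _ => K.diag fun x => ((x ^ (2 * r) : ℝ) : ℂ)) :
      ℝ → Module.End ℂ K.smooth) t φ := ⟨_, rfl⟩
    have e : A t φ = K.diag (fun x => ((x ^ (2 * r) : ℝ) : ℂ)) φ + B := by
      rw [hB, Pi.sub_apply, LinearMap.sub_apply]
      abel
    have h1 := D.re_inner_diag_rpow (a := 0) (b := 2 * r) (r := r) (by ring) φ
    rw [D.coe_diag_rpow 0, D.powS_zero] at h1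
    have h2 : ‖⟪(φ : H), (B : H)⟫_ℂ‖ ≤ C2 * K.sob (q / 2) φ ^ 2 := by
      refine (D.norm_inner_le (q / 2) _ _).trans ?_
      have := hC2 t φ
      rw [← hB] at this
      have h0 : 0 ≤ K.sob (q / 2) φ := apply_nonneg _ _
      nlinarith
    have h3 := (abs_le.1 ((Complex.abs_re_le_norm _).trans h2)).1
    have h4 : C2 * K.sob (q / 2) φ ^ 2 ≤ 1 / 2 * K.sob r φ ^ 2 + C2 * C3 * ‖(φ : H)‖ ^ 2 := by
      calc _ ≤ C2 * ((2 * C2)⁻¹ * K.sob r φ ^ 2 + C3 * ‖(φ : H)‖ ^ 2) := by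
            gcongr; exact hC3 φ
        _ = _ := by field_simp
    rw [e, Submodule.coe_add, inner_add_right, Complex.add_re, h1]
    linarith
  refine ⟨2 * C1 + 2 * C0 * C4 ^ 2 + 2 * (C2 * C3) * C4 ^ 2, by positivity,
    fun n s ψ u hu t ht => ?_⟩
  have h1 := le_add_mul_of_deriv_le (c := C0 * ‖(ψ : H)‖ ^ 2) (T := t)
    (fun τ hτ => HasSobDerivWithin.re_inner D (hu.2 τ hτ).2
      (HasSobDerivWithin.apply hA hAc hAd (hu.2 τ hτ).2))
    (fun τ hτ _ => (hC0 n τ (u τ) (hu.2 τ hτ).1).trans (by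
      have := hu.norm_le hG hτ
      gcongr)) ht le_rfl
  have h2 := upper s (u s)
  have h3 := lower t (u t)
  have h4 : K.sob r (u s) ^ 2 ≤ K.sob r ψ ^ 2 := by
    rw [hu.1]
    exact pow_le_pow_left₀ (apply_nonneg _ _) (D.sob_trunc_le r n ψ) 2
  have h5 : ‖(ψ : H)‖ ^ 2 ≤ C4 ^ 2 * K.sob r ψ ^ 2 := by
    rw [← mul_pow, ← D.sob_zero]
    exact pow_le_pow_left₀ (apply_nonneg _ _) (hC4 ψ) 2
  have h6 : ‖(u t : H)‖ ^ 2 ≤ ‖(ψ : H)‖ ^ 2 := pow_le_pow_left₀ (norm_nonneg _) (hu.norm_le hG ht) 2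
  have ht0 : 0 ≤ t - s := by linarith
  set S := K.sob r ψ ^ 2 with hS
  have hS0 : 0 ≤ S := by positivity
  calc K.sob r (u t) ^ 2 ≤ 2 * (C1 * S + C0 * (C4 ^ 2 * S) * (t - s)) + 2 * (C2 * C3) * (C4 ^ 2 * S) := by
        have a1 : C1 * K.sob r (u s) ^ 2 ≤ C1 * S := by gcongr
        have a2 : C0 * ‖(ψ : H)‖ ^ 2 * (t - s) ≤ C0 * (C4 ^ 2 * S) * (t - s) := by gcongr
        have a3 : 2 * (C2 * C3) * ‖(u t : H)‖ ^ 2 ≤ 2 * (C2 * C3) * (C4 ^ 2 * S) := by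
          gcongr; exact h6.trans h5
        linarith
    _ ≤ _ := by
        have b1 : 0 ≤ C1 * S * (t - s) := by positivity
        have b2 : 0 ≤ C0 * C4 ^ 2 * S := by positivity
        have b3 : 0 ≤ C2 * C3 * C4 ^ 2 * S * (t - s) := by positivity
        nlinarith

/-- Uniform bounds on compact time intervals. -/
theorem exists_galerkin_bound_Icc (D : K.IsDiscrete lam) (hG : IsHamiltonian K m G) (r s T : ℝ)
    (ψ : K.smooth) : ∃ B : ℝ, 0 < B ∧ ∀ n u, IsGalerkin D m G n s ψ u → ∀ t ∈ Set.Icc s T,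
      K.sob r (u t) ≤ B := by
  obtain ⟨C, hC0, hC⟩ := exists_galerkin_bound D hG (r := max r 1) (by positivity)
  obtain ⟨C', hC'0, hC'⟩ := D.sob_mono (le_max_left r 1)
  set Q := C * (1 + |T - s|) * K.sob (max r 1) ψ ^ 2 with hQ
  have hQ0 : 0 ≤ Q := by positivity
  refine ⟨C' * (Q + 1), by positivity, fun n u hu t ht => (hC' _).trans ?_⟩
  have h1 : K.sob (max r 1) (u t) ^ 2 ≤ Q := by
    refine (hC n s ψ u hu t ht.1).trans ?_
    rw [hQ]
    gcongr
    exact (by linarith [ht.2] : t - s ≤ T - s).trans (le_abs_self _)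
  gcongr
  nlinarith [sq_nonneg (K.sob (max r 1) (u t) - 1), apply_nonneg (K.sob (max r 1)) (u t)]

/-- The Schrödinger vector field. -/
theorem sob_galerkin_sub_le (D : K.IsDiscrete lam) (hG : IsHamiltonian K m G) (r : ℝ) :
    ∃ C : ℝ, 0 < C ∧ ∀ n t φ, K.sob r (galerkin D m G n t φ - -(Complex.I • G t φ)) ≤
      C * (ev lam n)⁻¹ * K.sob (r + m + 1) φ := by
  obtain ⟨C, hC0, hC⟩ := hG.order.sob_le (a := r + 1) (s := r + m + 1) (by ring)
  refine ⟨C + 1, by positivity, fun n t φ => ?_⟩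
  have hn := D.ev_pos n
  have e : galerkin D m G n t φ - -(Complex.I • G t φ) = Complex.I • (G t φ - D.trunc n (G t φ)) -
      ((ev lam n : ℂ)⁻¹) • K.diag (fun x => ((x ^ (m + 1) : ℝ) : ℂ)) φ := by
    rw [galerkin_apply, smul_sub]
    abel
  rw [e]
  refine (map_sub_le_add _ _ _).trans ?_
  rw [map_smul_eq_mul, map_smul_eq_mul, Complex.norm_I, one_mul, norm_inv, Complex.norm_real,
    Real.norm_of_nonneg hn.le]
  have h1 := (D.sob_sub_trunc_le r n (G t φ)).trans
    (mul_le_mul_of_nonneg_left (hC t φ) (inv_pos.2 hn).le)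
  have h2 := mul_le_mul_of_nonneg_left
    (D.sob_diag_rpow_le (a := r) (b := m + 1) (s := r + m + 1) (by ring) φ) (inv_pos.2 hn).le
  calc _ ≤ _ := add_le_add h1 h2
    _ = _ := by ring

theorem re_inner_I_smul (hG : IsHamiltonian K m G) (t : ℝ) (φ : K.smooth) :
    (⟪(φ : H), (-(Complex.I • G t φ) : K.smooth)⟫_ℂ).re = 0 := by
  have h1 : (⟪(φ : H), (G t φ : H)⟫_ℂ).im = 0 := by
    have h2 := hG.symm t φ φ
    rw [← inner_conj_symm] at h2
    have := congrArg Complex.im h2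
    rw [Complex.conj_im] at this
    rw [← inner_conj_symm, Complex.conj_im]
    linarith
  rw [Submodule.coe_neg, Submodule.coe_smul, inner_neg_right, inner_smul_right, Complex.neg_re,
    Complex.I_mul_re, h1]
  simp

/-- The difference of two approximations solves the true equation up to errors of size
$(n+\lambda)^{-1}$ and $(k+\lambda)^{-1}$, controlled by the uniform $\mathcal H^{m+1}$ bounds. The
skew part does not contribute to the norm. -/
theorem exists_galerkin_cauchy (D : K.IsDiscrete lam) (hG : IsHamiltonian K m G) (s T : ℝ)
    (ψ : K.smooth) : ∃ C : ℝ, 0 < C ∧ ∀ n k u w, IsGalerkin D m G n s ψ u →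
      IsGalerkin D m G k s ψ w → ∀ t ∈ Set.Icc s T,
        ‖(u t : H) - w t‖ ^ 2 ≤ C * ((ev lam n)⁻¹ + (ev lam k)⁻¹) := by
  obtain ⟨C, hC0, hC⟩ := sob_galerkin_sub_le D hG 0
  obtain ⟨B, hB0, hB⟩ := exists_galerkin_bound_Icc D hG (0 + m + 1) s T ψ
  -- A factor $2$ comes from differentiating the square, and $2\|\psi\|$ bounds the difference
  -- itself.
  set c := 4 * ‖(ψ : H)‖ * C * B with hc
  refine ⟨2 * ‖(ψ : H)‖ * K.sob (0 + 1) ψ + c * |T - s| + 1, by positivity,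
    fun n k u w hu hw t ht => ?_⟩
  have hn := inv_pos.2 (D.ev_pos n)
  have hk := inv_pos.2 (D.ev_pos k)
  have h1 := le_add_mul_of_deriv_le (c := c * ((ev lam n)⁻¹ + (ev lam k)⁻¹)) (T := T)
    (fun τ hτ => HasSobDerivWithin.re_inner D ((hu.2 τ hτ).2.sub (hw.2 τ hτ).2)
      ((hu.2 τ hτ).2.sub (hw.2 τ hτ).2)) (fun τ hτ hτT => ?_) ht.1 ht.2
  · rw [re_inner_self_eq, re_inner_self_eq, Submodule.coe_sub, Submodule.coe_sub, hu.1, hw.1] at h1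
    have h2 : ‖(D.trunc n ψ : H) - D.trunc k ψ‖ ^ 2 ≤
        2 * ‖(ψ : H)‖ * (((ev lam n)⁻¹ + (ev lam k)⁻¹) * K.sob (0 + 1) ψ) := by
      have a : ∀ j, ‖(D.trunc j ψ : H)‖ ≤ ‖(ψ : H)‖ := fun j => by
        have := D.sob_trunc_le 0 j ψ
        rwa [D.sob_zero, D.sob_zero] at this
      have b : ∀ j, ‖(ψ : H) - D.trunc j ψ‖ ≤ (ev lam j)⁻¹ * K.sob (0 + 1) ψ := fun j => by
        have := D.sob_sub_trunc_le 0 j ψ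
        rwa [D.sob_zero] at this
      have e : (D.trunc n ψ : H) - D.trunc k ψ =
          ((ψ : H) - D.trunc k ψ) - ((ψ : H) - D.trunc n ψ) := by abel
      rw [pow_two]
      refine mul_le_mul ?_ ?_ (norm_nonneg _) (by positivity)
      · exact (norm_sub_le _ _).trans (by linarith [a n, a k])
      · rw [e]
        exact (norm_sub_le _ _).trans (by linarith [b n, b k])
    have ht1 : t - s ≤ |T - s| := (by linarith [ht.2] : t - s ≤ T - s).trans (le_abs_self _)
    have hc0 : 0 ≤ c := by positivity
    have h3 : c * ((ev lam n)⁻¹ + (ev lam k)⁻¹) * (t - s) ≤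
        c * ((ev lam n)⁻¹ + (ev lam k)⁻¹) * |T - s| := by gcongr
    nlinarith
  · set x := u τ - w τ with hx
    set v := galerkin D m G n τ (u τ) - galerkin D m G k τ (w τ) with hv
    set en := galerkin D m G n τ (u τ) - -(Complex.I • G τ (u τ)) with hen
    set ek := galerkin D m G k τ (w τ) - -(Complex.I • G τ (w τ)) with hek
    have e : v = -(Complex.I • G τ x) + (en - ek) := by
      rw [hv, hen, hek, hx, map_sub, smul_sub]
      abel
    have hxn : ‖(x : H)‖ ≤ 2 * ‖(ψ : H)‖ := by
      have := hu.norm_le hG hτ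
      have := hw.norm_le hG hτ
      rw [hx, Submodule.coe_sub]
      exact (norm_sub_le _ _).trans (by linarith)
    have hn1 : ‖(en : H)‖ ≤ C * (ev lam n)⁻¹ * B := by
      rw [← D.sob_zero]
      exact (hC n τ _).trans (mul_le_mul_of_nonneg_left (hB n u hu τ ⟨hτ, hτT.le⟩) (by positivity))
    have hk1 : ‖(ek : H)‖ ≤ C * (ev lam k)⁻¹ * B := by
      rw [← D.sob_zero]
      exact (hC k τ _).trans (mul_le_mul_of_nonneg_left (hB k w hw τ ⟨hτ, hτT.le⟩) (by positivity))
    have h4 : (⟪(x : H), (v : H)⟫_ℂ).re ≤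
        2 * ‖(ψ : H)‖ * (C * (ev lam n)⁻¹ * B + C * (ev lam k)⁻¹ * B) := by
      rw [e, Submodule.coe_add, inner_add_right, Complex.add_re, re_inner_I_smul hG, zero_add]
      refine (Complex.re_le_norm _).trans ((_root_.norm_inner_le_norm _ _).trans ?_)
      refine mul_le_mul hxn ?_ (norm_nonneg _) (by positivity)
      rw [Submodule.coe_sub]
      exact (norm_sub_le _ _).trans (add_le_add hn1 hk1)
    have h5 : (⟪(v : H), (x : H)⟫_ℂ).re = (⟪(x : H), (v : H)⟫_ℂ).re := by
      rw [← inner_conj_symm, Complex.conj_re]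
    rw [h5, hc]
    nlinarith

end IsHamiltonian

end SobolevGrowth
end

/-! ### Passage to the limit in the Galerkin scheme. -/

noncomputable section
namespace SobolevGrowth
variable {H : Type*} [NormedAddCommGroup H] [InnerProductSpace ℂ H] [CompleteSpace H]

open ReferenceOperator ReferenceOperator.IsDiscrete

variable {K : ReferenceOperator H} {lam : ℝ} {m : ℝ} {G : ℝ → Module.End ℂ K.smooth}

theorem ReferenceOperator.IsDiscrete.tendsto_inv_ev (lam : ℝ) :
    Tendsto (fun n => (ev lam n)⁻¹) atTop (𝓝 0) :=
  tendsto_inv_atTop_zero.comp (tendsto_atTop_add_const_right _ _ tendsto_natCast_atTop_atTop)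

namespace IsHamiltonian

variable {D : K.IsDiscrete lam}

/-- Convergence in $\mathcal H$ is upgraded by convexity, $\|x\|_r^2\le\|x\|\,\|x\|_{2r}$, where the
last factor is bounded uniformly on compact time intervals. -/
theorem exists_uniform_limit (D : K.IsDiscrete lam) (hG : IsHamiltonian K m G) {s : ℝ}
    {ψ : K.smooth} {u : ℕ → ℝ → K.smooth} (hu : ∀ n, IsGalerkin D m G n s ψ (u n)) :
    ∃ y : ℝ → K.smooth, ∀ r T, ∃ e : ℕ → ℝ, Tendsto e atTop (𝓝 0) ∧
      ∀ n, ∀ t ∈ Set.Icc s T, K.sob r (u n t - y t) ≤ e n := by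
  have key : ∀ r T, ∃ C : ℝ, 0 < C ∧ ∀ n k, ∀ t ∈ Set.Icc s T,
      K.sob r (u n t - u k t) ^ 2 ≤ C * √((ev lam n)⁻¹ + (ev lam k)⁻¹) := by
    intro r T
    obtain ⟨C, hC0, hC⟩ := exists_galerkin_cauchy D hG s T ψ
    obtain ⟨B, hB0, hB⟩ := exists_galerkin_bound_Icc D hG (r + r) s T ψ
    refine ⟨√C * (2 * B), by positivity, fun n k t ht => ?_⟩
    refine (D.sob_sq_le r r _).trans ?_
    rw [sub_self, D.sob_zero]
    have h1 : ‖((u n t - u k t : K.smooth) : H)‖ ≤ √(C * ((ev lam n)⁻¹ + (ev lam k)⁻¹)) :=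
      Real.le_sqrt_of_sq_le (hC n k _ _ (hu n) (hu k) t ht)
    rw [Real.sqrt_mul hC0.le] at h1
    have h2 : K.sob (r + r) (u n t - u k t) ≤ 2 * B :=
      (map_sub_le_add _ _ _).trans (by linarith [hB n _ (hu n) t ht, hB k _ (hu k) t ht])
    calc _ ≤ √C * √((ev lam n)⁻¹ + (ev lam k)⁻¹) * (2 * B) :=
          mul_le_mul h1 h2 (apply_nonneg _ _) (by positivity)
      _ = _ := by ring
  have hlim : ∀ t, s ≤ t → ∃ y : K.smooth, ∀ r,
      Tendsto (fun n => K.powS r (u n t)) atTop (𝓝 (K.powS r y)) := by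
    intro t ht
    refine D.exists_limit fun r => ?_
    obtain ⟨C, hC0, hC⟩ := key r t
    have h0 : Tendsto (fun N => √(C * √((ev lam N)⁻¹ + (ev lam N)⁻¹))) atTop (𝓝 0) := by
      have := ((((tendsto_inv_ev lam).add (tendsto_inv_ev lam)).sqrt).const_mul C).sqrt
      simpa using this
    refine cauchySeq_of_le_tendsto_0 _ (fun n k N hn hk => ?_) h0
    rw [dist_eq_norm, ← map_sub, ← sob_eq]
    refine Real.le_sqrt_of_sq_le ((hC n k t ⟨ht, le_rfl⟩).trans ?_)
    have := D.ev_pos N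
    have h1 := inv_anti₀ this (ev_le_ev (lam := lam) hn)
    have h2 := inv_anti₀ this (ev_le_ev (lam := lam) hk)
    gcongr
  choose! y hy using hlim
  refine ⟨y, fun r T => ?_⟩
  obtain ⟨C, hC0, hC⟩ := key r T
  refine ⟨fun n => √(C * √((ev lam n)⁻¹)), ?_, fun n t ht => ?_⟩
  · have := (((tendsto_inv_ev lam).sqrt).const_mul C).sqrt
    simpa using this
  · refine Real.le_sqrt_of_sq_le ?_
    have h1 : Tendsto (fun k => C * √((ev lam n)⁻¹ + (ev lam k)⁻¹)) atTop
        (𝓝 (C * √((ev lam n)⁻¹))) := by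
      have := (((tendsto_inv_ev lam).const_add (ev lam n)⁻¹).sqrt).const_mul C
      rwa [add_zero] at this
    have h2 : Tendsto (fun k => K.sob r (u n t - u k t) ^ 2) atTop
        (𝓝 (K.sob r (u n t - y t) ^ 2)) := by
      have := (((hy t ht.1 r).const_sub (K.powS r (u n t))).norm).pow 2
      simp only [← map_sub] at this
      exact this
    exact le_of_tendsto_of_tendsto' h2 h1 fun k => hC n k t ht

/-- Bounds one viscosity order higher make the regularized fields converge uniformly to $-iG(t)y(t)$
in every norm. Uniform convergence of functions and derivatives then gives the equation for $t>s$,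
and the growth bound survives the limit. -/
theorem exists_forward (D : K.IsDiscrete lam) (hG : IsHamiltonian K m G) :
    ∃ Cst : ℝ → ℝ, ∀ (s : ℝ) (ψ : K.smooth), ∃ u : ℝ → K.smooth, u s = ψ ∧
      (∀ r, ContinuousOn (fun t => K.powS r (u t)) (Set.Ici s)) ∧
      (∀ t, s < t → HasSobDerivWithin u (-(Complex.I • G t (u t))) Set.univ t) ∧
      ∀ r, 0 < r → ∀ t, s ≤ t → K.sob r (u t) ^ 2 ≤ Cst r * (1 + (t - s)) * K.sob r ψ ^ 2 := by
  choose! Cst hCst0 hCst using fun r (hr : 0 < r) => exists_galerkin_bound D hG (r := r) hr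
  refine ⟨Cst, fun s ψ => ?_⟩
  choose u hu using fun n => exists_galerkin D hG n s ψ
  have hu' : ∀ n, IsGalerkin D m G n s ψ (u n) := hu
  obtain ⟨y, hy⟩ := exists_uniform_limit D hG hu'
  have hunif : ∀ r T, TendstoUniformlyOn (fun n t => K.powS r (u n t)) (fun t => K.powS r (y t))
      atTop (Set.Icc s T) := by
    intro r T
    obtain ⟨e, he, h⟩ := hy r T
    rw [Metric.tendstoUniformlyOn_iff]
    intro ε hε
    filter_upwards [he.eventually (gt_mem_nhds hε)] with n hn t ht
    rw [dist_comm, dist_eq_norm, ← map_sub]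
    exact (h n t ht).trans_lt hn
  have hpt : ∀ r t, s ≤ t → Tendsto (fun n => K.powS r (u n t)) atTop (𝓝 (K.powS r (y t))) :=
    fun r t ht => (hunif r t).tendsto_at ⟨ht, le_rfl⟩
  refine ⟨y, ?_, fun r => ?_, fun t ht r => ?_, fun r hr t ht => ?_⟩
  · have h1 := hpt 0 s le_rfl
    have h2 := D.tendsto_sob_sum_blk 0 ψ
    simp only [D.powS_zero] at h1
    refine Subtype.ext (tendsto_nhds_unique h1 ?_)
    rw [tendsto_iff_norm_sub_tendsto_zero]
    refine h2.congr fun n => ?_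
    rw [D.sob_zero, (hu n).1, trunc, LinearMap.sum_apply, Submodule.coe_sub]
  · intro t ht
    have hc : ContinuousOn (fun t => K.powS r (y t)) (Set.Icc s (t + 1)) :=
      (hunif r (t + 1)).continuousOn (Frequently.of_forall fun n τ hτ =>
        (((hu n).2 τ hτ.1).2 r).continuousWithinAt.mono Set.Icc_subset_Ici_self)
    exact (hc t ⟨ht, by linarith⟩).mono_of_mem_nhdsWithin
      (inter_mem_nhdsWithin _ (Iic_mem_nhds (by linarith)))
  · rw [hasDerivWithinAt_univ]
    obtain ⟨C, hC0, hC⟩ := sob_galerkin_sub_le D hG r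
    obtain ⟨C', hC'0, hC'⟩ := hG.order.sob_le (a := r) (s := r + m) (by ring)
    obtain ⟨B, hB0, hB⟩ := exists_galerkin_bound_Icc D hG (r + m + 1) s (t + 1) ψ
    obtain ⟨e, he, hye⟩ := hy (r + m) (t + 1)
    have hd : TendstoUniformlyOn (fun n t => K.powS r (galerkin D m G n t (u n t)))
        (fun t => K.powS r (-(Complex.I • G t (y t)))) atTop (Set.Ioo s (t + 1)) := by
      rw [Metric.tendstoUniformlyOn_iff]
      intro ε hε
      have h0 : Tendsto (fun n => C * (ev lam n)⁻¹ * B + C' * e n) atTop (𝓝 0) := by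
        simpa using (((tendsto_inv_ev lam).const_mul C).mul_const B).add (he.const_mul C')
      filter_upwards [h0.eventually (gt_mem_nhds hε)] with n hn τ hτ
      have hτ' : τ ∈ Set.Icc s (t + 1) := ⟨hτ.1.le, hτ.2.le⟩
      have hn0 := D.ev_pos n
      rw [dist_comm, dist_eq_norm, ← map_sub]
      refine lt_of_le_of_lt ?_ hn
      have e1 : galerkin D m G n τ (u n τ) - -(Complex.I • G τ (y τ)) =
          (galerkin D m G n τ (u n τ) - -(Complex.I • G τ (u n τ))) +
            -(Complex.I • G τ (u n τ - y τ)) := by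
        rw [map_sub, smul_sub]
        abel
      rw [e1]
      refine (map_add_le_add (K.sob r) _ _).trans (add_le_add ?_ ?_)
      · exact (hC n τ _).trans (mul_le_mul_of_nonneg_left (hB n _ (hu' n) τ hτ') (by positivity))
      · rw [map_neg_eq_map, map_smul_eq_mul, Complex.norm_I, one_mul]
        exact (hC' τ _).trans (mul_le_mul_of_nonneg_left (hye n τ hτ') hC'0.le)
    refine hasDerivAt_of_tendstoLocallyUniformlyOn isOpen_Ioo hd.tendstoLocallyUniformlyOn
      (Eventually.of_forall fun n τ hτ => ?_) (fun τ hτ => hpt r τ hτ.1.le) ⟨ht, by linarith⟩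
    exact (((hu n).2 τ hτ.1.le).2 r).hasDerivAt (Ici_mem_nhds hτ.1)
  · refine le_of_tendsto ((hpt r t ht).norm.pow 2) (Eventually.of_forall fun n => ?_)
    exact hCst r hr n s ψ _ (hu' n) t ht

/-! ### Time reversal and solutions on the whole line -/

theorem _root_.HasDerivAt.comp_neg' {E : Type*} [NormedAddCommGroup E] [NormedSpace ℝ E] {f : ℝ → E}
    {f' : E} {t : ℝ} (h : HasDerivAt f f' (-t)) : HasDerivAt (fun τ => f (-τ)) (-f') t := by
  simpa [Function.comp_def] using h.scomp t (hasDerivAt_neg t)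

/-- The reversed energy is $A(-t)$. Its time derivative and its commutator with the reversed
generator both change sign, so the order of the Heisenberg derivative is unchanged. -/
theorem reverse (hG : IsHamiltonian K m G) : IsHamiltonian K m fun t => -G (-t) where
  symm t u v := by
    have := hG.symm (-t) u v
    simp only [LinearMap.neg_apply, Submodule.coe_neg, inner_neg_left, inner_neg_right, this]
  order s := by
    obtain ⟨C, hC0, hC⟩ := hG.order s
    refine ⟨C, hC0, fun t ψ => ?_⟩
    rw [LinearMap.neg_apply, map_neg_eq_map]
    exact hC (-t) ψ
  cont r ψ := by
    simp only [LinearMap.neg_apply, map_neg]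
    exact ((hG.cont r ψ).comp continuous_neg).neg
  energy r hr := by
    obtain ⟨q, hq, A, A', hA, hAc, hAd, hAq, hR⟩ := hG.energy r hr
    refine ⟨q, hq, fun t => A (-t), fun t => -A' (-t), fun s => ?_, fun r ψ => ?_, fun ψ t => ?_,
      fun s => ?_, fun s => ?_⟩
    · obtain ⟨C, hC0, hC⟩ := hA s
      exact ⟨C, hC0, fun t ψ => hC (-t) ψ⟩
    · exact (hAc r ψ).comp continuous_neg
    · refine hasSeminormDerivAt_sob_iff.2 fun r => ?_
      have := (hasSeminormDerivAt_sob_iff.1 (hAd ψ (-t)) r).comp_neg'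
      rw [LinearMap.neg_apply, map_neg]
      exact this
    · obtain ⟨C, hC0, hC⟩ := hAq s
      exact ⟨C, hC0, fun t ψ => hC (-t) ψ⟩
    · obtain ⟨C, hC0, hC⟩ := hR s
      refine ⟨C, hC0, fun t ψ => ?_⟩
      have := hC (-t) ψ
      rw [← map_neg_eq_map] at this
      convert this using 2
      simp only [Pi.add_apply, Pi.smul_apply, Pi.sub_apply, Pi.mul_apply, LinearMap.add_apply,
        LinearMap.smul_apply, LinearMap.sub_apply, Module.End.mul_apply, LinearMap.neg_apply, map_neg,
        smul_sub, smul_neg]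
      abel

theorem continuous_apply (hG : IsHamiltonian K m G) {u : ℝ → K.smooth}
    (hu : ∀ r, Continuous fun t => K.powS r (u t)) (r : ℝ) :
    Continuous fun t => K.powS r (G t (u t)) := by
  obtain ⟨C, hC0, hC⟩ := hG.order.sob_le (a := r) (s := r + m) (by ring)
  refine continuous_iff_continuousAt.2 fun t => ?_
  have h1 : Tendsto (fun τ => K.powS r (G τ (u τ - u t))) (𝓝 t) (𝓝 0) := by
    have h2 := tendsto_iff_norm_sub_tendsto_zero.1 ((hu (r + m)).tendsto t)
    refine squeeze_zero_norm (fun τ => hC τ _) ?_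
    have := h2.const_mul C
    rw [mul_zero] at this
    refine this.congr fun τ => ?_
    rw [← map_sub]
    rfl
  have h3 := h1.add ((hG.cont r (u t)).tendsto t)
  rw [zero_add] at h3
  refine h3.congr fun τ => ?_
  rw [← map_add, map_sub, sub_add_cancel]

/-- The solution of the Schrödinger equation with smooth initial data. -/
theorem exists_solution (D : K.IsDiscrete lam) (hG : IsHamiltonian K m G) :
    ∃ Cst : ℝ → ℝ, ∀ (s : ℝ) (ψ : K.smooth), ∃ u : ℝ → K.smooth, u s = ψ ∧
      (∀ t, HasSobDerivWithin u (-(Complex.I • G t (u t))) Set.univ t) ∧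
      ∀ r, 0 < r → ∀ t, K.sob r (u t) ^ 2 ≤ Cst r * (1 + |t - s|) * K.sob r ψ ^ 2 := by
  obtain ⟨C₁, h₁⟩ := exists_forward D hG
  obtain ⟨C₂, h₂⟩ := exists_forward D hG.reverse
  refine ⟨fun r => max (C₁ r) (C₂ r), fun s ψ => ?_⟩
  obtain ⟨u, hus, huc, hud, hub⟩ := h₁ s ψ
  obtain ⟨w, hws, hwc, hwd, hwb⟩ := h₂ (-s) ψ
  set y : ℝ → K.smooth := fun t => if s ≤ t then u t else w (-t) with hy
  have hyu : ∀ t, s ≤ t → y t = u t := fun t ht => if_pos ht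
  have hyw : ∀ t, t ≤ s → y t = w (-t) := fun t ht => by
    rcases ht.eq_or_lt with rfl | h
    · rw [hyu t le_rfl, hus, hws]
    · exact if_neg h.not_ge
  have hyc : ∀ r, Continuous fun t => K.powS r (y t) := by
    intro r
    have e : (fun t => K.powS r (y t)) =
        fun t => if s ≤ t then K.powS r (u t) else K.powS r (w (-t)) := by
      ext1 t
      simp only [hy]
      split_ifs <;> rfl
    rw [e]
    refine continuous_if_le continuous_const continuous_id (huc r) ((hwc r).comp
      continuous_neg.continuousOn fun t ht => neg_le_neg (show t ≤ s from ht)) fun t ht => ?_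
    rw [← (show s = t from ht), hus, hws]
  have hne : ∀ t, t ≠ s → ∀ r,
      HasDerivAt (fun t => K.powS r (y t)) (K.powS r (-(Complex.I • G t (y t)))) t := by
    intro t ht r
    rcases ht.lt_or_gt with h | h
    · have h1 := hwd (-t) (by linarith) r
      rw [hasDerivWithinAt_univ] at h1
      have h2 := h1.comp_neg'
      rw [hyw t h.le, ← map_neg] at *
      refine (h2.congr_of_eventuallyEq ?_).congr_deriv ?_
      · filter_upwards [Iio_mem_nhds h] with τ hτ
        rw [hyw τ (le_of_lt hτ)]
      · simp
    · have h1 := hud t h r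
      rw [hasDerivWithinAt_univ] at h1
      rw [hyu t h.le]
      refine h1.congr_of_eventuallyEq ?_
      filter_upwards [Ioi_mem_nhds h] with τ hτ
      rw [hyu τ (le_of_lt hτ)]
  refine ⟨y, by rw [hyu s le_rfl, hus], fun t r => ?_, fun r hr t => ?_⟩
  · rw [hasDerivWithinAt_univ]
    by_cases ht : t = s
    · rw [ht]
      -- At the junction the derivative is the limit of the derivatives on both sides, since
      -- $-iG(t)y(t)$ is continuous across it.
      refine hasDerivAt_of_hasDerivAt_of_ne (g := fun t => K.powS r (-(Complex.I • G t (y t))))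
        (fun τ hτ => hne τ hτ r) (hyc r).continuousAt ?_
      have := ((hG.continuous_apply hyc r).const_smul Complex.I).neg
      refine (this.congr fun τ => ?_).continuousAt
      rw [map_neg, map_smul]
      rfl
    · exact hne t ht r
  · have h0 : 0 ≤ K.sob r ψ ^ 2 := by positivity
    rcases le_total s t with h | h
    · rw [hyu t h, abs_of_nonneg (by linarith)]
      refine (hub r hr t h).trans ?_
      have : 0 ≤ t - s := by linarith
      gcongr
      exact le_max_left _ _
    · rw [hyw t h, abs_of_nonpos (by linarith)]
      refine (hwb r hr (-t) (by linarith)).trans ?_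
      have : 0 ≤ s - t := by linarith
      have e : -t - -s = -(t - s) := by ring
      rw [e]
      have : 0 ≤ -(t - s) := by linarith
      gcongr
      exact le_max_right _ _

end IsHamiltonian

end SobolevGrowth
end

noncomputable section
namespace SobolevGrowth
variable {H : Type*} [NormedAddCommGroup H] [InnerProductSpace ℂ H] [CompleteSpace H]

/-! ## The flow on `H^∞` -/

open ReferenceOperator ReferenceOperator.IsDiscrete

variable {K : ReferenceOperator H} {lam : ℝ} {m : ℝ} {G : ℝ → Module.End ℂ K.smooth}

/-- `u` solves `u' = -i G(t) u`, with derivatives in every norm `‖·‖_r`. -/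
def IsSmoothSolution (G : ℝ → Module.End ℂ K.smooth) (u : ℝ → K.smooth) : Prop :=
  ∀ t, HasSobDerivWithin u (-(Complex.I • G t (u t))) Set.univ t

namespace IsSmoothSolution

theorem sub {u w : ℝ → K.smooth} (hu : IsSmoothSolution G u) (hw : IsSmoothSolution G w) :
    IsSmoothSolution G fun t => u t - w t := fun t => by
  have := (hu t).sub (hw t)
  rwa [← neg_sub_neg, neg_neg, neg_neg, ← neg_sub, ← smul_sub, ← map_sub] at this

theorem smul (c : ℂ) {u : ℝ → K.smooth} (hu : IsSmoothSolution G u) :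
    IsSmoothSolution G fun t => c • u t := fun t r => by
  have := (hu t r).const_smul c
  rw [← map_smul, smul_neg, smul_comm, ← map_smul] at this
  exact this.congr (fun τ _ => map_smul _ _ _) (map_smul _ _ _)

theorem re_inner_eq (D : K.IsDiscrete lam) (hG : IsHamiltonian K m G) {u w : ℝ → K.smooth}
    (hu : IsSmoothSolution G u) (hw : IsSmoothSolution G w) (t s : ℝ) :
    (⟪(u t : H), (w t : H)⟫_ℂ).re = (⟪(u s : H), (w s : H)⟫_ℂ).re := by
  refine is_const_of_deriv_eq_zero (f := fun t => (⟪(u t : H), (w t : H)⟫_ℂ).re)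
    (fun τ => ?_) (fun τ => ?_) t s
  · exact (hasDerivWithinAt_univ.1 (HasSobDerivWithin.re_inner D (hu τ) (hw τ))).differentiableAt
  · rw [(hasDerivWithinAt_univ.1 (HasSobDerivWithin.re_inner D (hu τ) (hw τ))).deriv]
    simp only [Submodule.coe_neg, Submodule.coe_smul, inner_neg_left, inner_neg_right,
      inner_smul_left, inner_smul_right, hG.symm τ (u τ) (w τ), Complex.conj_I]
    rw [← Complex.add_re]
    ring_nf
    rfl

theorem norm_eq (D : K.IsDiscrete lam) (hG : IsHamiltonian K m G) {u : ℝ → K.smooth}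
    (hu : IsSmoothSolution G u) (t s : ℝ) : ‖(u t : H)‖ = ‖(u s : H)‖ := by
  have := re_inner_eq D hG hu hu t s
  rw [re_inner_self_eq, re_inner_self_eq] at this
  exact (sq_eq_sq₀ (norm_nonneg _) (norm_nonneg _)).1 this

theorem eq_of_eq (D : K.IsDiscrete lam) (hG : IsHamiltonian K m G) {u w : ℝ → K.smooth}
    (hu : IsSmoothSolution G u) (hw : IsSmoothSolution G w) {s : ℝ} (h : u s = w s) (t : ℝ) :
    u t = w t := by
  have := norm_eq D hG (hu.sub hw) t s
  rw [h, sub_self, Submodule.coe_zero, norm_zero, norm_eq_zero] at this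
  exact sub_eq_zero.1 (Subtype.ext this)

end IsSmoothSolution

/-- `S(t, s)` is the flow of the equation `u' = -i G(t) u` on `H^∞`. -/
structure IsFlow (K : ReferenceOperator H) (G : ℝ → Module.End ℂ K.smooth)
    (S : ℝ → ℝ → Module.End ℂ K.smooth) (Cst : ℝ → ℝ) : Prop where
  self : ∀ s ψ, S s s ψ = ψ
  solution : ∀ s ψ, IsSmoothSolution G fun t => S t s ψ
  unique : ∀ u, IsSmoothSolution G u → ∀ t s, u t = S t s (u s)
  re_inner : ∀ t s φ ψ, (⟪(S t s φ : H), (S t s ψ : H)⟫_ℂ).re = (⟪(φ : H), (ψ : H)⟫_ℂ).re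
  bound : ∀ r, 0 < r → ∀ t s ψ, K.sob r (S t s ψ) ≤ Cst r * √(1 + |t - s|) * K.sob r ψ

/-- Linearity of the solution map and the flow property follow from uniqueness, which in turn is
conservation of the norm of a difference. -/
theorem IsHamiltonian.exists_flow (D : K.IsDiscrete lam) (hG : IsHamiltonian K m G) :
    ∃ S Cst, (∀ r, 0 ≤ Cst r) ∧ IsFlow K G S Cst := by
  obtain ⟨Cst, h⟩ := hG.exists_solution D
  choose u hus hu hub using h
  have huniq : ∀ w, IsSmoothSolution G w → ∀ t s, w t = u s (w s) t := fun w hw t s =>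
    hw.eq_of_eq D hG (hu s (w s)) (hus s (w s)).symm t
  refine ⟨fun t s =>
    { toFun := fun ψ => u s ψ t
      map_add' := fun φ ψ => ?_
      map_smul' := fun c ψ => ?_ }, fun r => √(Cst r), fun r => Real.sqrt_nonneg _,
    hus, hu, huniq, fun t s φ ψ => ?_, fun r hr t s ψ => ?_⟩
  · have h1 := huniq _ (IsSmoothSolution.sub (hu s φ) (IsSmoothSolution.smul (-1) (hu s ψ))) t s
    simp only [hus, neg_one_smul, sub_neg_eq_add] at h1
    exact h1.symm
  · have h1 := huniq _ (IsSmoothSolution.smul c (hu s ψ)) t s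
    simp only [hus] at h1
    exact h1.symm
  · have := IsSmoothSolution.re_inner_eq D hG (hu s φ) (hu s ψ) t s
    rwa [hus, hus] at this
  · have h1 := Real.le_sqrt_of_sq_le (hub s ψ r hr t)
    have h2 : (0 : ℝ) ≤ 1 + |t - s| := by positivity
    rwa [Real.sqrt_mul' _ (by positivity), Real.sqrt_mul' _ h2, Real.sqrt_sq (apply_nonneg _ _)] at h1

namespace IsFlow

variable {S : ℝ → ℝ → Module.End ℂ K.smooth} {Cst : ℝ → ℝ}

theorem comp (hS : IsFlow K G S Cst) (t r s : ℝ) (ψ : K.smooth) : S t r (S r s ψ) = S t s ψ :=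
  (hS.unique _ (hS.solution s ψ) t r).symm

theorem norm_eq (hS : IsFlow K G S Cst) (t s : ℝ) (ψ : K.smooth) : ‖(S t s ψ : H)‖ = ‖(ψ : H)‖ := by
  have := hS.re_inner t s ψ ψ
  rw [re_inner_self_eq, re_inner_self_eq] at this
  exact (sq_eq_sq₀ (norm_nonneg _) (norm_nonneg _)).1 this

theorem re_inner_left (hS : IsFlow K G S Cst) (t s : ℝ) (φ ψ : K.smooth) :
    (⟪(S t s ψ : H), (φ : H)⟫_ℂ).re = (⟪(ψ : H), (S s t φ : H)⟫_ℂ).re := by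
  have := hS.re_inner t s ψ (S s t φ)
  rwa [hS.comp, hS.self] at this

/-- Bounds in all the spaces of the scale. -/
theorem exists_bound (hS : IsFlow K G S Cst) (D : K.IsDiscrete lam) (hC : ∀ r, 0 ≤ Cst r) (r : ℝ) :
    ∃ C, 0 ≤ C ∧ ∀ t s ψ, K.sob r (S t s ψ) ≤ C * √(1 + |t - s|) * K.sob r ψ := by
  rcases lt_trichotomy r 0 with h | rfl | h
  -- Negative exponents follow by duality: the adjoint of $S(t,s)$ is $S(s,t)$, and testing $\chi$
  -- against $K_0^{2r}\chi$, whose $\|\cdot\|_{-r}$ norm is at most $\|\chi\|_r$, recovers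
  -- $\|\chi\|_r^2$.
  · refine ⟨Cst (-r), hC _, fun t s ψ => ?_⟩
    set χ := S t s ψ with hχ
    set φ := K.diag (fun x => ((x ^ (2 * r) : ℝ) : ℂ)) χ with hφ
    have h1 : K.sob r χ ^ 2 = (⟪(χ : H), (φ : H)⟫_ℂ).re := by
      have := D.re_inner_diag_rpow (a := 0) (b := 2 * r) (r := r) (by ring) χ
      rw [D.coe_diag_rpow 0, D.powS_zero] at this
      exact this.symm
    have h2 : K.sob r χ ^ 2 ≤ K.sob r ψ * (Cst (-r) * √(1 + |t - s|) * K.sob r χ) := by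
      rw [h1, hχ, hS.re_inner_left]
      refine (Complex.re_le_norm _).trans ((D.norm_inner_le r _ _).trans ?_)
      refine mul_le_mul_of_nonneg_left ((hS.bound (-r) (by linarith) s t φ).trans ?_)
        (apply_nonneg _ _)
      rw [abs_sub_comm]
      have := hC (-r)
      exact mul_le_mul_of_nonneg_left (D.sob_diag_rpow_le (by ring) χ) (by positivity)
    rcases (apply_nonneg (K.sob r) χ).eq_or_lt with h0 | h0
    · rw [← h0]
      have := hC (-r)
      positivity
    · refine le_of_mul_le_mul_right ?_ h0
      linarith
  · refine ⟨1, zero_le_one, fun t s ψ => ?_⟩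
    rw [D.sob_zero, D.sob_zero, hS.norm_eq, one_mul]
    refine le_mul_of_one_le_left (norm_nonneg _) (Real.one_le_sqrt.2 ?_)
    linarith [abs_nonneg (t - s)]
  · exact ⟨Cst r, hC r, hS.bound r h⟩

/-- Differentiability is known only in the later time. Continuity in the initial time comes from
$S(s,s')\psi-\psi=S(s,s')(\psi-S(s',s)\psi)$ together with locally uniform bounds. -/
theorem continuous_apply (hS : IsFlow K G S Cst) (D : K.IsDiscrete lam) (hC : ∀ r, 0 ≤ Cst r)
    (r : ℝ) (ψ : K.smooth) : Continuous fun p : ℝ × ℝ => K.powS r (S p.1 p.2 ψ) := by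
  obtain ⟨C, hC0, hb⟩ := hS.exists_bound D hC r
  have ht : ∀ s φ, Continuous fun t => K.powS r (S t s φ) := fun s φ =>
    continuous_iff_continuousAt.2 fun t =>
      (hasDerivWithinAt_univ.1 (hS.solution s φ t r)).continuousAt
  refine continuous_iff_continuousAt.2 fun ⟨t, s⟩ => ?_
  have h1 : Tendsto (fun p : ℝ × ℝ => K.powS r (S p.1 s (S s p.2 ψ - ψ))) (𝓝 (t, s)) (𝓝 0) := by
    have h2 : Tendsto (fun p : ℝ × ℝ => C * √(1 + |p.1 - s|) * (C * √(1 + |s - p.2|) *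
        ‖K.powS r ψ - K.powS r (S p.2 s ψ)‖)) (𝓝 (t, s)) (𝓝 0) := by
      have hcont : Continuous (fun p : ℝ × ℝ => C * √(1 + |p.1 - s|) * (C * √(1 + |s - p.2|) *
          ‖K.powS r ψ - K.powS r (S p.2 s ψ)‖)) := by
        have : Continuous fun p : ℝ × ℝ => K.powS r (S p.2 s ψ) := (ht s ψ).comp continuous_snd
        fun_prop
      have := hcont.tendsto (t, s)
      simpa [hS.self] using this
    refine squeeze_zero_norm (fun p => ?_) h2
    refine (hb _ _ _).trans (mul_le_mul_of_nonneg_left ?_ (by positivity))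
    have e : S s p.2 ψ - ψ = S s p.2 (ψ - S p.2 s ψ) := by rw [map_sub, hS.comp, hS.self]
    rw [e, ← map_sub]
    exact hb _ _ _
  have h3 : Tendsto (fun p : ℝ × ℝ => K.powS r (S p.1 s ψ)) (𝓝 (t, s)) (𝓝 (K.powS r (S t s ψ))) :=
    ((ht s ψ).comp continuous_fst).tendsto (t, s)
  have h4 := h1.add h3
  rw [zero_add] at h4
  refine h4.congr fun p => ?_
  rw [← map_add, map_sub, hS.comp, sub_add_cancel]

end IsFlow

/-! ### Extension to the spaces of the scale -/

namespace ReferenceOperator.IsDiscrete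

theorem tendsto_trunc (D : K.IsDiscrete lam) (x : H) :
    Tendsto (fun n => (D.trunc n x : H)) atTop (𝓝 x) := by
  refine (D.hasSum_block x).tendsto_sum_nat.congr fun n => ?_
  rw [trunc, LinearMap.sum_apply, Submodule.coe_sum]
  rfl

theorem denseRange_subtype (D : K.IsDiscrete lam) : DenseRange K.smooth.subtype := fun x =>
  mem_closure_of_tendsto (D.tendsto_trunc x) (Eventually.of_forall fun n => ⟨D.trunc n x, rfl⟩)

theorem tendsto_powS_trunc (D : K.IsDiscrete lam) (r : ℝ) (ψ : (K.pow r).domain) :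
    Tendsto (fun n => K.powS r (D.trunc n (ψ : H))) atTop (𝓝 (K.pow r ψ)) := by
  refine (D.tendsto_trunc (K.pow r ψ)).congr fun n => D.ext_block fun j => ?_
  have h : K.block lam j (K.pow r ψ) = ((ev lam j ^ r : ℝ) : ℂ) • K.block lam j (ψ : H) :=
    block_func _ ψ j
  rw [block_powS, block_trunc, block_trunc, h]
  split_ifs
  · rfl
  · rw [smul_zero]

/-- The powers of `K₀` are closed operators. -/
theorem pow_closed (D : K.IsDiscrete lam) {r : ℝ} {x : ℕ → K.smooth} {y χ : H}
    (hx : Tendsto (fun n => (x n : H)) atTop (𝓝 y))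
    (hr : Tendsto (fun n => K.powS r (x n)) atTop (𝓝 χ)) :
    ∃ h : y ∈ (K.pow r).domain, K.pow r ⟨y, h⟩ = χ := by
  have hb : ∀ j, K.block lam j χ = ((ev lam j ^ r : ℝ) : ℂ) • K.block lam j y := fun j => by
    have h1 := ((K.block lam j).continuous.tendsto _).comp hr
    have h2 := (((K.block lam j).continuous.tendsto _).comp hx).const_smul ((ev lam j ^ r : ℝ) : ℂ)
    refine tendsto_nhds_unique h1 (h2.congr fun k => ?_)
    simp only [Function.comp_apply, block_powS]
  have h : y ∈ (K.pow r).domain := (D.mem_func_domain_iff _ y).2 ⟨χ, hb⟩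
  exact ⟨h, D.ext_block fun j => (block_func _ ⟨y, h⟩ j).trans (hb j).symm⟩

/-- Spectral truncations of $\psi$ converge in $\mathcal H^r$, the bound makes their images Cauchy
there, and closedness of $K_0^r$ identifies the limit. -/
theorem tendsto_powS_of_le (D : K.IsDiscrete lam) {r C : ℝ} {T : Module.End ℂ K.smooth}
    {U : H →L[ℂ] H} (hU : ∀ ψ : K.smooth, U ψ = T ψ)
    (hT : ∀ ψ, K.sob r (T ψ) ≤ C * K.sob r ψ) (ψ : (K.pow r).domain) :
    ∃ h : U ψ ∈ (K.pow r).domain,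
      Tendsto (fun n => K.powS r (T (D.trunc n (ψ : H)))) atTop (𝓝 (K.pow r ⟨U ψ, h⟩)) := by
  have h1 := D.tendsto_powS_trunc r ψ
  have hc : CauchySeq fun n => K.powS r (T (D.trunc n (ψ : H))) := by
    rw [Metric.cauchySeq_iff']
    intro ε hε
    obtain ⟨N, hN⟩ := Metric.cauchySeq_iff'.1 h1.cauchySeq (ε / (|C| + 1)) (by positivity)
    refine ⟨N, fun n hn => ?_⟩
    have h2 := hN n hn
    rw [dist_eq_norm, ← map_sub, ← sob_eq] at h2 ⊢
    rw [← map_sub]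
    rw [lt_div_iff₀ (by positivity)] at h2
    have h0 : 0 ≤ K.sob r (D.trunc n (ψ : H) - D.trunc N (ψ : H)) := apply_nonneg _ _
    refine (hT _).trans_lt (lt_of_le_of_lt ?_ h2)
    nlinarith [le_abs_self C]
  obtain ⟨χ, hχ⟩ := cauchySeq_tendsto_of_complete hc
  have h3 : Tendsto (fun n => (T (D.trunc n (ψ : H)) : H)) atTop (𝓝 (U ψ)) := by
    refine ((U.continuous.tendsto _).comp (D.tendsto_trunc (ψ : H))).congr fun n => ?_
    rw [Function.comp_apply, hU]
  obtain ⟨h, e⟩ := D.pow_closed h3 hχ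
  exact ⟨h, by rwa [e]⟩

theorem isBoundedOn_of_le (D : K.IsDiscrete lam) {r C : ℝ} {T : Module.End ℂ K.smooth}
    {U : H →L[ℂ] H} (hU : ∀ ψ : K.smooth, U ψ = T ψ)
    (hT : ∀ ψ, K.sob r (T ψ) ≤ C * K.sob r ψ) : IsBoundedOn K r C U := by
  intro ψ
  obtain ⟨h, hl⟩ := D.tendsto_powS_of_le hU hT ψ
  exact ⟨h, le_of_tendsto_of_tendsto' hl.norm ((D.tendsto_powS_trunc r ψ).norm.const_mul C)
    fun n => hT _⟩

end ReferenceOperator.IsDiscrete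

theorem IsFlow.exists_extension {S : ℝ → ℝ → Module.End ℂ K.smooth} {Cst : ℝ → ℝ}
    (hS : IsFlow K G S Cst) (D : K.IsDiscrete lam) :
    ∃ U : ℝ → ℝ → H →L[ℂ] H, ∀ t s (ψ : K.smooth), U t s ψ = S t s ψ :=
  ⟨fun t s => (K.smooth.subtype ∘ₗ S t s).extendOfNorm K.smooth.subtype, fun t s ψ =>
    LinearMap.extendOfNorm_eq D.denseRange_subtype
      ⟨1, fun ψ => by rw [one_mul]; exact (hS.norm_eq t s ψ).le⟩ ψ⟩

end SobolevGrowth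
end

noncomputable section
namespace SobolevGrowth
variable {H : Type*} [NormedAddCommGroup H] [InnerProductSpace ℂ H] [CompleteSpace H]

/-! ## Interpolation -/

open ReferenceOperator ReferenceOperator.IsDiscrete

variable {K : ReferenceOperator H} {lam : ℝ}

namespace ReferenceOperator.IsDiscrete

theorem norm_exp_mul_log (D : K.IsDiscrete lam) (w : ℂ) (n : ℕ) :
    ‖Complex.exp (w * Real.log (ev lam n))‖ = ev lam n ^ w.re := by
  rw [Complex.norm_exp, Complex.re_mul_ofReal, mul_comm, Real.rpow_def_of_pos (D.ev_pos n)]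

theorem tempered_exp_mul_log (D : K.IsDiscrete lam) (w : ℂ) :
    Tempered lam fun x => Complex.exp (w * Real.log x) :=
  ⟨1, w.re, fun n => by rw [D.norm_exp_mul_log, one_mul]⟩

theorem sob_diag_exp_le (D : K.IsDiscrete lam) {w : ℂ} {a b : ℝ} (h : a = b - w.re)
    (ψ : K.smooth) :
    K.sob a (K.diag (fun x => Complex.exp (w * Real.log x)) ψ) ≤ K.sob b ψ := by
  subst h
  have := D.sob_diag_le (g := fun x => Complex.exp (w * Real.log x)) (C := 1) (m := w.re)
    (fun n => by rw [D.norm_exp_mul_log, one_mul]) b ψ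
  rwa [one_mul] at this

theorem diag_exp_ofReal_diag_rpow (D : K.IsDiscrete lam) (a b : ℝ) (ψ : K.smooth) :
    K.diag (fun x => Complex.exp ((a : ℂ) * Real.log x)) (K.diag (fun x => ((x ^ b : ℝ) : ℂ)) ψ) =
      K.diag (fun x => ((x ^ (a + b) : ℝ) : ℂ)) ψ :=
  D.ext_smooth fun n => by
    have hn := D.ev_pos n
    rw [D.block_diag (D.tempered_exp_mul_log _), D.block_diag (D.tempered_rpow _),
      D.block_diag (D.tempered_rpow _), smul_smul, ← Complex.ofReal_mul, ← Complex.ofReal_exp,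
      ← Complex.ofReal_mul, Real.rpow_add hn, Real.rpow_def_of_pos hn a, mul_comm a]

theorem sum_eq_inner_diag_exp (D : K.IsDiscrete lam) (T : Module.End ℂ K.smooth) (z : ℂ) (n : ℕ)
    (φ ψ : H) :
    ∑ j ∈ Finset.range n, ∑ k ∈ Finset.range n, Complex.exp (z * Real.log (ev lam j)) *
        Complex.exp (-z * Real.log (ev lam k)) * ⟪(D.blk j φ : H), (T (D.blk k ψ) : H)⟫_ℂ =
      ⟪(K.diag (fun x => Complex.exp (starRingEnd ℂ z * Real.log x)) (D.trunc n φ) : H),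
        (T (K.diag (fun x => Complex.exp (-z * Real.log x)) (D.trunc n ψ)) : H)⟫_ℂ := by
  simp only [trunc, LinearMap.sum_apply, map_sum, D.diag_blk (D.tempered_exp_mul_log _), map_smul,
    Submodule.coe_sum, Submodule.coe_smul, sum_inner, inner_sum, inner_smul_left, inner_smul_right]
  rw [Finset.sum_comm]
  refine Finset.sum_congr rfl fun k _ => ?_
  rw [Finset.mul_sum]
  refine Finset.sum_congr rfl fun j _ => ?_
  rw [← Complex.exp_conj, map_mul, Complex.conj_conj, Complex.conj_ofReal]
  ring

/-- Interpolation between `H` and `H^R`. -/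
theorem interpolation (D : K.IsDiscrete lam) {T : Module.End ℂ K.smooth} {R r M : ℝ} (hr : 0 < r)
    (hrR : r < R) (hM : 0 ≤ M) (h0 : ∀ ψ, ‖(T ψ : H)‖ ≤ ‖(ψ : H)‖)
    (hR : ∀ ψ, K.sob R (T ψ) ≤ M * K.sob R ψ) (χ : K.smooth) :
    K.sob r (T χ) ≤ M ^ (r / R) * K.sob r χ := by
  have hR0 : 0 < R := hr.trans hrR
  -- With this choice the interpolated form at $r/R$ tends to $\|T\chi\|_r^2$, so one factor
  -- $\|T\chi\|_r$ cancels at the end.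
  set φ := K.diag (fun x => ((x ^ r : ℝ) : ℂ)) (T χ) with hφ
  set ψ := K.diag (fun x => ((x ^ r : ℝ) : ℂ)) χ with hψ
  have hφn : ‖(φ : H)‖ = K.sob r (T χ) := by rw [hφ, D.coe_diag_rpow, sob_eq]
  have hψn : ‖(ψ : H)‖ = K.sob r χ := by rw [hψ, D.coe_diag_rpow, sob_eq]
  have tn : ∀ n (x : K.smooth), K.sob 0 (D.trunc n x) ≤ ‖(x : H)‖ := fun n x => by
    rw [← D.sob_zero]
    exact D.sob_trunc_le 0 n x
  have key : ∀ n, ‖⟪(D.trunc n (K.diag (fun x => ((x ^ r : ℝ) : ℂ)) φ : H) : H),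
      (T (D.trunc n χ) : H)⟫_ℂ‖ ≤ M ^ (r / R) * (‖(φ : H)‖ * ‖(ψ : H)‖) := by
    intro n
    -- This is $\langle K_0^{R\bar z}\varphi_n,TK_0^{-Rz}\psi_n\rangle$ for truncated vectors. As a
    -- finite sum of exponentials it is entire and bounded on the strip; on $\mathrm{Re}\,z=0$ the
    -- powers are unitary, and on $\mathrm{Re}\,z=1$ the pairing of $\mathcal H^{-R}$ with $\mathcal
    -- H^R$ brings in $M$.
    let F : ℂ → ℂ := fun z => ∑ j ∈ Finset.range n, ∑ k ∈ Finset.range n,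
      Complex.exp (R * z * Real.log (ev lam j)) * Complex.exp (-(R * z) * Real.log (ev lam k)) *
        ⟪(D.blk j φ : H), (T (D.blk k ψ) : H)⟫_ℂ
    have hF : ∀ z, F z = ⟪(K.diag (fun x => Complex.exp (starRingEnd ℂ (R * z) * Real.log x))
        (D.trunc n φ) : H), (T (K.diag (fun x => Complex.exp (-(R * z) * Real.log x))
        (D.trunc n ψ)) : H)⟫_ℂ := fun z => D.sum_eq_inner_diag_exp T (R * z) n φ ψ
    have hd : Differentiable ℂ F := by
      simp only [F]
      fun_prop
    have hre : ∀ z : ℂ, (starRingEnd ℂ (R * z)).re = R * z.re := fun z => by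
      rw [Complex.conj_re, Complex.re_ofReal_mul]
    have hre' : ∀ z : ℂ, (-((R : ℂ) * z)).re = -(R * z.re) := fun z => by
      rw [Complex.neg_re, Complex.re_ofReal_mul]
    have ha : ∀ z ∈ Complex.re ⁻¹' {0}, ‖F z‖ ≤ ‖(φ : H)‖ * ‖(ψ : H)‖ := by
      intro z hz
      have hz' : z.re = 0 := hz
      rw [hF]
      refine (_root_.norm_inner_le_norm _ _).trans (mul_le_mul ?_ ((h0 _).trans ?_)
        (norm_nonneg _) (norm_nonneg _))
      · rw [← D.sob_zero]
        exact (D.sob_diag_exp_le (b := 0) (by rw [hre, hz']; ring) _).trans (tn n φ)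
      · rw [← D.sob_zero]
        exact (D.sob_diag_exp_le (b := 0) (by rw [hre', hz']; ring) _).trans (tn n ψ)
    have hb : ∀ z ∈ Complex.re ⁻¹' {1}, ‖F z‖ ≤ M * (‖(φ : H)‖ * ‖(ψ : H)‖) := by
      intro z hz
      have hz' : z.re = 1 := hz
      rw [hF]
      refine (D.norm_inner_le (-R) _ _).trans ?_
      rw [neg_neg]
      calc _ ≤ ‖(φ : H)‖ * (M * ‖(ψ : H)‖) := by
            refine mul_le_mul ?_ ((hR _).trans (mul_le_mul_of_nonneg_left ?_ hM))
              (apply_nonneg _ _) (norm_nonneg _)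
            · exact (D.sob_diag_exp_le (b := 0) (by rw [hre, hz']; ring) _).trans (tn n φ)
            · exact (D.sob_diag_exp_le (b := 0) (by rw [hre', hz']; ring) _).trans (tn n ψ)
        _ = _ := by ring
    have hB : BddAbove ((norm ∘ F) '' Complex.HadamardThreeLines.verticalClosedStrip 0 1) := by
      refine ⟨∑ j ∈ Finset.range n, ∑ k ∈ Finset.range n,
        Real.exp (R * |Real.log (ev lam j)|) * Real.exp (R * |Real.log (ev lam k)|) *
          ‖⟪(D.blk j φ : H), (T (D.blk k ψ) : H)⟫_ℂ‖, ?_⟩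
      rintro _ ⟨z, hz, rfl⟩
      have hz' : z.re ∈ Set.Icc (0 : ℝ) 1 := hz
      have he : ∀ a x : ℝ, |a| ≤ R → a * x ≤ R * |x| := fun a x h =>
        (le_abs_self _).trans (by rw [abs_mul]; gcongr)
      have hz1 : |R * z.re| ≤ R := by
        rw [abs_of_nonneg (mul_nonneg hR0.le hz'.1)]
        exact mul_le_of_le_one_right hR0.le hz'.2
      refine (norm_sum_le _ _).trans (Finset.sum_le_sum fun j _ =>
        (norm_sum_le _ _).trans (Finset.sum_le_sum fun k _ => ?_))
      rw [norm_mul, norm_mul, Complex.norm_exp, Complex.norm_exp, Complex.re_mul_ofReal,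
        Complex.re_mul_ofReal, Complex.neg_re, Complex.re_ofReal_mul]
      exact mul_le_mul_of_nonneg_right (mul_le_mul (Real.exp_le_exp.2 (he _ _ hz1))
        (Real.exp_le_exp.2 (he _ _ (by rwa [abs_neg]))) (by positivity) (by positivity))
        (norm_nonneg _)
    have hθ : 0 < r / R := by positivity
    have hmem : ((r / R : ℝ) : ℂ) ∈ Complex.HadamardThreeLines.verticalClosedStrip 0 1 := by
      change ((r / R : ℝ) : ℂ).re ∈ Set.Icc (0 : ℝ) 1
      rw [Complex.ofReal_re]
      exact ⟨hθ.le, (div_le_one hR0).2 hrR.le⟩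
    have h1 := Complex.HadamardThreeLines.norm_le_interp_of_mem_verticalClosedStrip₀₁' F hmem
      hd.diffContOnCl hB ha hb
    rw [hF, Complex.ofReal_re] at h1
    have e1 : (R : ℂ) * ((r / R : ℝ) : ℂ) = ((r : ℝ) : ℂ) := by
      rw [← Complex.ofReal_mul, mul_div_cancel₀ _ hR0.ne']
    have e2 : K.diag (fun x => Complex.exp (((r : ℝ) : ℂ) * Real.log x)) (D.trunc n φ) =
        D.trunc n (K.diag (fun x => ((x ^ r : ℝ) : ℂ)) φ) := by
      refine D.ext_smooth fun j => ?_
      rw [D.block_diag (D.tempered_exp_mul_log _), block_trunc, block_trunc,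
        D.block_diag (D.tempered_rpow r) φ]
      split_ifs
      · rw [← Complex.ofReal_mul, ← Complex.ofReal_exp, Real.rpow_def_of_pos (D.ev_pos j), mul_comm r]
      · rw [smul_zero]
    have e3 : K.diag (fun x => Complex.exp (-((r : ℝ) : ℂ) * Real.log x)) (D.trunc n ψ) =
        D.trunc n χ := by
      rw [hψ, D.diag_trunc (D.tempered_rpow _), ← Complex.ofReal_neg, D.diag_exp_ofReal_diag_rpow]
      refine Subtype.ext ?_
      rw [D.coe_diag_rpow, neg_add_cancel, D.powS_zero]
    rw [e1, Complex.conj_ofReal, e2, e3] at h1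
    refine h1.trans (le_of_eq ?_)
    have hp : 0 ≤ ‖(φ : H)‖ * ‖(ψ : H)‖ := by positivity
    rw [Real.mul_rpow hM hp, mul_left_comm, ← Real.rpow_add' hp (by simp), sub_add_cancel,
      Real.rpow_one]
  have hT : Tendsto (fun n => (T (D.trunc n χ) : H)) atTop (𝓝 (T χ)) := by
    have h1 := tendsto_iff_norm_sub_tendsto_zero.1 (D.tendsto_trunc (χ : H))
    rw [tendsto_iff_norm_sub_tendsto_zero]
    refine squeeze_zero (fun _ => norm_nonneg _) (fun n => ?_) h1
    have := h0 (D.trunc n χ - χ)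
    rwa [map_sub] at this
  have hl := ((D.tendsto_trunc (K.diag (fun x => ((x ^ r : ℝ) : ℂ)) φ : H)).inner hT (𝕜 := ℂ)).norm
  have h2 := le_of_tendsto' hl key
  have h3 : ‖⟪(K.diag (fun x => ((x ^ r : ℝ) : ℂ)) φ : H), (T χ : H)⟫_ℂ‖ = K.sob r (T χ) ^ 2 := by
    have h := (D.isSymm_diag (g := fun x => x ^ r) (D.tempered_rpow r)) φ (T χ)
    rw [← h, ← hφ, inner_self_eq_norm_sq_to_K, ← hφn]
    simp
  rw [h3, hφn, hψn] at h2
  rcases (apply_nonneg (K.sob r) (T χ)).eq_or_lt with h | h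
  · rw [← h]
    positivity
  · refine le_of_mul_le_mul_right ?_ h
    nlinarith

theorem clm_ext (D : K.IsDiscrete lam) {A B : H →L[ℂ] H}
    (h : ∀ ψ : K.smooth, A ψ = B ψ) : A = B :=
  ContinuousLinearMap.coeFn_injective
    (D.denseRange_subtype.equalizer A.continuous B.continuous (funext h))

end ReferenceOperator.IsDiscrete

/-! ## The propagator -/

namespace IsFlow

variable {G : ℝ → Module.End ℂ K.smooth} {S : ℝ → ℝ → Module.End ℂ K.smooth} {Cst : ℝ → ℝ}

/-- The operator norms on $\mathcal H^r$ are bounded while $|t-s|$ is bounded, so the continuous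
orbits of truncated vectors converge locally uniformly. -/
theorem continuous_extension (hS : IsFlow K G S Cst) (D : K.IsDiscrete lam) (hC : ∀ r, 0 ≤ Cst r)
    {U : ℝ → ℝ → H →L[ℂ] H} (hU : ∀ t s (ψ : K.smooth), U t s ψ = S t s ψ) (r : ℝ)
    (ψ : (K.pow r).domain) : ∃ h : ∀ t s, U t s ψ ∈ (K.pow r).domain,
      Continuous fun p : ℝ × ℝ => K.pow r ⟨U p.1 p.2 ψ, h p.1 p.2⟩ := by
  obtain ⟨C, hC0, hb⟩ := hS.exists_bound D hC r
  have hmem := fun t s => D.tendsto_powS_of_le (hU t s) (hb t s) ψ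
  choose h hl using hmem
  refine ⟨h, ?_⟩
  have hlu : TendstoLocallyUniformly
      (fun n (p : ℝ × ℝ) => K.powS r (S p.1 p.2 (D.trunc n (ψ : H))))
      (fun p : ℝ × ℝ => K.pow r ⟨U p.1 p.2 ψ, h p.1 p.2⟩) atTop := by
    rw [Metric.tendstoLocallyUniformly_iff]
    rintro ε hε ⟨t, s⟩
    set B := C * √(1 + (|t - s| + 1)) with hB
    have hB0 : 0 ≤ B := by positivity
    refine ⟨{p | |p.1 - p.2| < |t - s| + 1}, ?_, ?_⟩
    · refine IsOpen.mem_nhds ?_ (by simp)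
      exact isOpen_lt (by fun_prop) continuous_const
    · have h1 := D.tendsto_powS_trunc r ψ
      have h2 := ((tendsto_iff_norm_sub_tendsto_zero.1 h1).const_mul B)
      rw [mul_zero] at h2
      filter_upwards [h2.eventually (gt_mem_nhds hε)] with n hn p hp
      rw [dist_eq_norm]
      refine lt_of_le_of_lt ?_ hn
      have h3 := ((hl p.1 p.2).sub_const (K.powS r (S p.1 p.2 (D.trunc n (ψ : H))))).norm
      have h4 := ((h1.sub_const (K.powS r (D.trunc n (ψ : H)))).norm).const_mul B
      rw [norm_sub_rev (K.powS r (D.trunc n (ψ : H)))]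
      refine le_of_tendsto_of_tendsto' h3 h4 fun k => ?_
      rw [← map_sub, ← map_sub, ← map_sub]
      refine (hb p.1 p.2 _).trans (mul_le_mul_of_nonneg_right ?_ (apply_nonneg _ _))
      have : |p.1 - p.2| ≤ |t - s| + 1 := le_of_lt hp
      rw [hB]
      gcongr
  exact hlu.continuous (Frequently.of_forall fun n => hS.continuous_apply D hC r _)

theorem isPropagator (hS : IsFlow K G S Cst) (D : K.IsDiscrete lam) (hC : ∀ r, 0 ≤ Cst r)
    {U : ℝ → ℝ → H →L[ℂ] H} (hU : ∀ t s (ψ : K.smooth), U t s ψ = S t s ψ) {H₀ : H →ₗ.[ℂ] H}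
    {V : ℝ → Module.End ℂ K.smooth} (hG : ∀ t (ψ : K.smooth), ∃ h : (ψ : H) ∈ H₀.domain,
      (G t ψ : H) = H₀ ⟨ψ, h⟩ + (V t ψ : H)) : IsPropagator K H₀ V U where
  self s := D.clm_ext fun ψ => by rw [hU, hS.self]; rfl
  comp t r s := D.clm_ext fun ψ => by
    rw [ContinuousLinearMap.comp_apply, hU, hU, hU, hS.comp]
  isometry t s ψ := by
    refine D.denseRange_subtype.induction_on ψ
      (isClosed_eq (U t s).continuous.norm continuous_norm) fun ψ => ?_
    rw [Submodule.subtype_apply, hU, hS.norm_eq]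
  bounded r t s := by
    obtain ⟨C, -, hb⟩ := hS.exists_bound D hC r
    exact ⟨_, D.isBoundedOn_of_le (hU t s) (hb t s)⟩
  continuous r ψ := hS.continuous_extension D hC hU r ψ
  solution s ψ := by
    refine ⟨fun t => S t s ψ, fun t => (hU t s ψ).symm, fun t => ?_⟩
    obtain ⟨h, e⟩ := hG t (S t s ψ)
    refine ⟨_, h, hasSeminormDerivAt_sob_iff.2 fun r =>
      hasDerivWithinAt_univ.1 (hS.solution s ψ t r), ?_⟩
    rw [← e, Submodule.coe_neg, Submodule.coe_smul, smul_neg, smul_smul, Complex.I_mul_I, neg_one_smul,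
      neg_neg]
  unique u hu t s := by
    rw [hU]
    congr 1
    refine hS.unique u (fun t r => ?_) t s
    obtain ⟨v, h, hd, e⟩ := hu t
    obtain ⟨h', e'⟩ := hG t (u t)
    have : v = -(Complex.I • G t (u t)) := Subtype.ext <| by
      rw [Submodule.coe_neg, Submodule.coe_smul, e', ← e, smul_smul, Complex.I_mul_I, neg_one_smul,
        neg_neg]
    rw [hasDerivWithinAt_univ, ← this]
    exact hasSeminormDerivAt_sob_iff.1 hd r

/-- Arbitrarily slow growth of the Sobolev norms. -/
theorem exists_growth_bound (hS : IsFlow K G S Cst) (D : K.IsDiscrete lam) (hC : ∀ r, 0 ≤ Cst r)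
    {r ε : ℝ} (hr : 0 < r) (hε : 0 < ε) : ∃ C : ℝ, 0 < C ∧ ∀ t s ψ,
      K.sob r (S t s ψ) ≤ C * √(1 + (t - s) ^ 2) ^ ε * K.sob r ψ := by
  -- Then $r/R=\epsilon/(1+\epsilon)\le\epsilon$. The square root bound on $\mathcal H^R$ gives the
  -- exponent $r/(2R)$, smaller still.
  set R := r + r / ε with hR
  have hrR : r < R := by
    have : 0 < r / ε := by positivity
    linarith
  have hR0 : 0 < R := hr.trans hrR
  have hθ : 0 < r / R := by positivity
  have hC1 : 0 < Cst R + 1 := by linarith [hC R]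
  refine ⟨(Cst R + 1) ^ (r / R) * 2 ^ (r / R / 2), by positivity, fun t s ψ => ?_⟩
  refine (D.interpolation hr hrR (M := (Cst R + 1) * √(1 + |t - s|)) (by positivity)
    (fun ψ => (hS.norm_eq t s ψ).le) (fun ψ => (hS.bound R hR0 t s ψ).trans ?_) ψ).trans
    (mul_le_mul_of_nonneg_right ?_ (apply_nonneg _ _))
  · gcongr
    linarith
  · set J := √(1 + (t - s) ^ 2) with hJ
    have hJ1 : 1 ≤ J := Real.one_le_sqrt.2 (by linarith [sq_nonneg (t - s)])
    have hJ2 : |t - s| ≤ J := Real.abs_le_sqrt (by linarith)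
    have hJ0 : 0 ≤ J := by linarith
    rw [Real.mul_rpow hC1.le (Real.sqrt_nonneg _), mul_assoc]
    refine mul_le_mul_of_nonneg_left ?_ (by positivity)
    have h1 : √(1 + |t - s|) ^ (r / R) = (1 + |t - s|) ^ (r / R / 2) := by
      rw [Real.sqrt_eq_rpow, ← Real.rpow_mul (by positivity)]
      congr 1
      ring
    rw [h1]
    calc (1 + |t - s|) ^ (r / R / 2) ≤ (2 * J) ^ (r / R / 2) := by
          gcongr
          linarith
      _ = 2 ^ (r / R / 2) * J ^ (r / R / 2) := Real.mul_rpow (by norm_num) hJ0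
      _ ≤ 2 ^ (r / R / 2) * J ^ ε := by
          refine mul_le_mul_of_nonneg_left
            (Real.rpow_le_rpow_of_exponent_le hJ1 ?_) (by positivity)
          have h2 : r / R ≤ ε := by
            rw [div_le_iff₀ hR0, hR]
            have : ε * (r + r / ε) = ε * r + r := by field_simp
            rw [this]
            nlinarith
          linarith

end IsFlow

end SobolevGrowth
end

noncomputable section
namespace SobolevGrowth
variable {H : Type*} [NormedAddCommGroup H] [InnerProductSpace ℂ H] [CompleteSpace H]

/-! ## Perturbations of elliptic functions of the reference operator -/

open ReferenceOperator ReferenceOperator.IsDiscrete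

variable {K : ReferenceOperator H} {lam : ℝ} {𝒜 : OperatorClasses K}

theorem ReferenceOperator.IsDiscrete.exists_func_eq_diag (D : K.IsDiscrete lam) {g : ℝ → ℂ}
    (hg : Tempered lam g) (ψ : K.smooth) :
    ∃ h : (ψ : H) ∈ (K.func g).domain, (K.diag g ψ : H) = K.func g ⟨ψ, h⟩ := by
  have h : ∀ ψ : K.smooth, ∃ hd : (ψ : H) ∈ (K.func g).domain, K.func g ⟨ψ, hd⟩ ∈ K.smooth :=
    D.func_mem_smooth hg
  refine ⟨(h ψ).1, ?_⟩
  simp only [diag, dif_pos h]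
  rfl

theorem IsCbInfty.mem_timeClass {m : ℝ} {V : ℝ → 𝒜.cls m} (hV : IsCbInfty (𝒜.semi m) V) :
    (fun t => (V t : Module.End ℂ K.smooth)) ∈ timeClass 𝒜 m :=
  ⟨V, fun _ => rfl, hV.cbN⟩

namespace IsGradedAlgebra

theorem isUnifOrder (hI : IsGradedAlgebra 𝒜) {m : ℝ} {W : ℝ → Module.End ℂ K.smooth}
    (hW : W ∈ timeClass 𝒜 m) : IsUnifOrder K m W := fun s => hI.exists_bound hW s

theorem isHamiltonian (hI : IsGradedAlgebra 𝒜) (D : K.IsDiscrete lam)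
    (hII : HasEgorovProperty 𝒜) {f : ℝ → ℝ} {μ ρ : ℝ} (hμ : 1 < μ) (hf : IsEllipticSymbol f μ)
    (hρ : ρ < μ) {V : ℝ → Module.End ℂ K.smooth} (hV : V ∈ timeClass 𝒜 ρ)
    (hVs : ∀ t, K.IsSymm (V t)) :
    IsHamiltonian K μ ((fun _ => K.diag fun x => (f x : ℂ)) + V) := by
  obtain ⟨c₀, -, htf, hE⟩ := hI.exists_diag_symbol D hμ hf
  have hF : K.diag (fun x => (f x : ℂ)) ∈ 𝒜.cls μ := by
    have := Submodule.add_mem _ (hI.cls_mono (by linarith : μ - 1 ≤ μ) hE)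
      (Submodule.smul_mem _ (c₀ : ℂ) (hI.diag_rpow_mem D μ))
    rwa [sub_add_cancel] at this
  have hG : ((fun _ => K.diag fun x => (f x : ℂ)) + V) ∈ timeClass 𝒜 μ :=
    Submodule.add_mem _ (const_mem_timeClass hF) (hI.timeClass_mono hρ.le hV)
  refine ⟨fun t u v => ?_, hI.isUnifOrder hG, hI.continuous_apply hG, fun r _ => ?_⟩
  · simp only [Pi.add_apply, LinearMap.add_apply, Submodule.coe_add, inner_add_left,
      inner_add_right]
    rw [D.isSymm_diag htf u v, hVs t u v]
  -- Order $0$ for the Heisenberg derivative is what the energy argument needs: its expectation is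
  -- then bounded by the norm of $\mathcal H$.
  · obtain ⟨q, hq, A, hA, A', hAA', h1, h2⟩ :=
      hI.exists_modified_energy D hII hμ hf hρ hV (2 * r) 0
    exact ⟨q, hq, A, A', hI.isUnifOrder hA, hI.continuous_apply hA, hAA', hI.isUnifOrder h1,
      hI.isUnifOrder h2⟩

end IsGradedAlgebra

end SobolevGrowth
end

/-! ### Assembly of the propagator and its growth bound. -/

theorem mainTheorem1 {H : Type*} [NormedAddCommGroup H] [InnerProductSpace ℂ H] [CompleteSpace H]
    (K : SobolevGrowth.ReferenceOperator H) (𝒜 : SobolevGrowth.OperatorClasses K)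
    (hI : SobolevGrowth.IsGradedAlgebra 𝒜) (hII : SobolevGrowth.HasEgorovProperty 𝒜)
    (hA : ∃ lam : ℝ, 0 < lam ∧
      SobolevGrowth.spectrumOf K.op ⊆ Set.range fun n : ℕ => ((n : ℂ) + (lam : ℂ)))
    (μ : ℝ) (hμ : 1 < μ) (H₀ : H →ₗ.[ℂ] H)
    (hB : ∃ f : ℝ → ℝ, SobolevGrowth.IsEllipticSymbol f μ ∧ H₀ = K.func fun x => (f x : ℂ))
    (ρ : ℝ) (hρ : ρ < μ) (V : ℝ → 𝒜.cls ρ)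
    (hV : SobolevGrowth.IsCbInfty (𝒜.semi ρ) V)
    (hVsymm : ∀ t, K.IsSymm (V t : Module.End ℂ K.smooth)) :
    ∃ U : ℝ → ℝ → H →L[ℂ] H,
      SobolevGrowth.IsPropagator K H₀ (fun t => (V t : Module.End ℂ K.smooth)) U ∧
      ∀ r : ℝ, 0 < r → ∀ ε : ℝ, 0 < ε → ∃ C : ℝ, 0 < C ∧ ∀ t s : ℝ,
        SobolevGrowth.IsBoundedOn K r (C * (Real.sqrt (1 + (t - s) ^ 2)) ^ ε) (U t s) := by
  obtain ⟨lam, hlam, hspec⟩ := hA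
  obtain ⟨f, hf, rfl⟩ := hB
  have D : K.IsDiscrete lam := ⟨hlam, hspec⟩
  have hG := hI.isHamiltonian D hII hμ hf hρ hV.mem_timeClass hVsymm
  obtain ⟨S, Cst, hC, hS⟩ := hG.exists_flow D
  obtain ⟨U, hU⟩ := hS.exists_extension D
  obtain ⟨_, -, htf, -⟩ := hI.exists_diag_symbol D hμ hf
  refine ⟨U, hS.isPropagator D hC hU fun t ψ => ?_, fun r hr ε hε => ?_⟩
  · obtain ⟨h, e⟩ := D.exists_func_eq_diag htf ψ
    exact ⟨h, by rw [← e]; rfl⟩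
  · obtain ⟨C, hC0, hb⟩ := hS.exists_growth_bound D hC hr hε
    exact ⟨C, hC0, fun t s => D.isBoundedOn_of_le (hU t s) (hb t s)⟩
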